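/- Let $N\ge 0$ be an integer and $\epsilon>0$. Let $\Lambda=[0,1]\times\mathbb T^2$ with $\mathbb T=\mathbb R/\mathbb Z$, let $\mathrm e=(1,0,0)$, and let $\Gamma(x)=1$ for $x\in\{0\}\times\mathbb T^2$ and $\Gamma(x)=-1$ for $x\in\{1\}\times\mathbb T^2$. Let \[\mathcal D_\epsilon^N=\{(x_1,\dots,x_N,v_1,\dots,v_N)\in\Lambda^N\times\mathbb R^{3N}: |x_i-x_j|>\epsilon \text{ for all } i\ne j\},\] where $|x_i-x_j|$ is the smallest length of a vector $u\in\mathbb R^3$ that represents $x_i-x_j$ modulo $\{0\}\times\mathbb Z^2$. Let $\Omega$ be the set of families $\bar\omega=(\omega^j)_{j\in\mathbb Z\setminus\{0\}}$ of unit vectors of $\mathbb R^3$ with $\omega^j\cdot \mathrm e>0$ for $j>0$ and $\omega^j\cdot \mathrm e<0$ for $j<0$, and let $\mathbb P$ be the law under which the $\omega^j$ are independent, with law $c\,(\omega\cdot \mathrm e)_+d\omega$ for $j>0$ and $c\,(\omega\cdot \mathrm e)_-d\omega$ for $j<0$, where $c=\big(\int_{\mathbb S^2}(\omega\cdot \mathrm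 e)_+d\omega\big)^{-1}$. The hard-sphere dynamics with random angle reflection on $\mathcal D_\epsilon^N\times\Omega^N$ is the following. Particles move along straight lines with constant velocities and constant $\bar\omega_i$ until a shock, which is either a collision ($x_i-x_j$ has a representative $u$ with $|u|=\epsilon$; two such representatives, possible only if $\epsilon\ge 1/2$, count as two collisions) or a reflection ($x_i\in\partial\Lambda$). At a collision, with $\nu=u/|u|$, \[v_i(t^+)=v_i(t^-)-\nu\cdot(v_i(t^-)-v_j(t^-))\,\nu,\qquad v_j(t^+)=v_j(t^-)+\nu\cdot(v_i(t^-)-v_j(t^-))\,\nu .\] At a reflection of particle $i$, \[v_i(t^+)=|v_i(t^-)|\,\Gamma(x_i(t))\,\omega_i^{1}(t^-),\qquad \omega_i^{-1}(t^+)=\Gamma(x_i(t))\frac{v_i(t^-)}{|v_i(t^-)|},\qquad \omega_i^{j}(t^+)=\omega_i^{j+1}(t^-)\ \ (j\ne 0,-1).\] These rules determine the backward dynamics as well. Trajectories are taken right-continuous: the state at the time of a shock is the state just after it. A shock is grazing if the normal velocity ($\nu\cdot(v_i-v_j)$, respectively $\Gamma(x_i)\,\mathrm e\cdot v_i$) vanishes.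 Let $\mathcal B^N\subset\mathcal D_\epsilon^N\times\Omega^N$ be the set of bad initial data: those whose trajectory, forward or backward in time, leads in finite time to two simultaneous shocks (in particular, to a collision of more than two particles), to a grazing shock, or to infinitely many shocks; data with two or more particles on $\partial\Lambda$ at time $0$, or with a particle on $\partial\Lambda$ whose velocity does not point strictly into $\Lambda$, are also counted as bad. Then: 1. $\mathcal B^N$ has measure zero for $d\mathbf z_N\,d\mathbb P^N(\bar{\boldsymbol\omega}_N)$, the product of Lebesgue measure and $\mathbb P^{\otimes N}$. 2. For every initial datum in $(\mathcal D_\epsilon^N\times\Omega^N)\setminus\mathcal B^N$ there is exactly one trajectory of the dynamics, defined for all $t\in\mathbb R$, all of whose shocks are isolated, simple and not grazing. Hence the dynamics is well defined for almost all initial data. Denote its flow by $\phi^{\epsilon,t}_N$. 3. The flow preserves the measure: for every $t\in\mathbb R$ and every Borel set $A\subset\mathcal D_\epsilon^N\times\Omega^N$, the set $\phi^{\epsilon,t}_N(A\setminus\mathcal B^N)$ is measurable and has the same measure as $A$. -/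

import Mathlib

open MeasureTheory Set Filter Topology
open scoped ENNReal

noncomputable section

namespace HardSphere

/-- Velocities and representatives of displacements. Coordinate `0` is the direction orthogonal to
the walls, i.e. `e = (1,0,0)`. -/
abbrev E3 := EuclideanSpace ℝ (Fin 3)

/-- Positions: the infinite cylinder `ℝ × 𝕋²`, which contains `Λ = [0,1] × 𝕋²`. -/
abbrev Pos := ℝ × UnitAddCircle × UnitAddCircle

/-- The unit sphere of `ℝ³`. -/
abbrev S2 := Metric.sphere (0 : E3) 1

/-- The nonzero integers. -/
abbrev ZStar := {j : ℤ // j ≠ 0}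

/-- All families of unit vectors indexed by the nonzero integers. -/
abbrev Noise := ZStar → S2

/-- The space containing `D_ε^N × Ω^N`: positions and velocities, and then the noises. -/
abbrev State (N : ℕ) := (Fin N → Pos × E3) × (Fin N → Noise)

variable {N : ℕ}

/-- Position of particle `i`. -/
def pos (z : State N) (i : Fin N) : Pos := (z.1 i).1

/-- Velocity of particle `i`. -/
def vel (z : State N) (i : Fin N) : E3 := (z.1 i).2

/-- Noise of particle `i`. -/
def noise (z : State N) (i : Fin N) : Noise := z.2 i

/-- The quotient map `ℝ³ → ℝ × 𝕋²`. -/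
def proj (u : E3) : Pos := (u 0, ((u 1 : ℝ) : UnitAddCircle), ((u 2 : ℝ) : UnitAddCircle))

/-! ### Laws -/

/-- The density `(± ω·e)₊` for `± = sign j`. -/
def cosDensity (j : ZStar) (ω : S2) : ℝ≥0∞ := ENNReal.ofReal ((j.1.sign : ℝ) * (ω : E3) 0)

/-- Surface measure on the sphere. -/
def surface : Measure S2 := (volume : Measure E3).toSphere

/-- The law of `ω^j`: `c (ω·e)₊ dω` if `j > 0` and `c (ω·e)₋ dω` if `j < 0`, where `c` is the
normalizing constant. -/
def angleLaw (j : ZStar) : Measure S2 :=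
  (∫⁻ ω, cosDensity j ω ∂surface)⁻¹ • surface.withDensity (cosDensity j)

theorem measurable_cosDensity (j : ZStar) : Measurable (cosDensity j) := by
  unfold cosDensity
  fun_prop

instance (j : ZStar) : IsProbabilityMeasure (angleLaw j) := by
  have : IsFiniteMeasure surface := by unfold surface; infer_instance
  have : surface.IsOpenPosMeasure := by unfold surface; infer_instance
  have hcont : Continuous (cosDensity j) := by
    unfold cosDensity
    exact ENNReal.continuous_ofReal.comp (by fun_prop)
  have hs : ((j.1.sign : ℤ) : ℝ) * ((j.1.sign : ℤ) : ℝ) = 1 := by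
    rcases lt_or_gt_of_ne j.2 with h | h
    · rw [Int.sign_eq_neg_one_of_neg h]; norm_num
    · rw [Int.sign_eq_one_of_pos h]; norm_num
  have h0 : ∫⁻ ω, cosDensity j ω ∂surface ≠ 0 := by
    intro h
    rw [lintegral_eq_zero_iff (measurable_cosDensity j)] at h
    have h' : cosDensity j = 0 :=
      (Continuous.ae_eq_iff_eq (μ := surface) hcont continuous_const).1 h
    have hmem : EuclideanSpace.single (0 : Fin 3) ((j.1.sign : ℤ) : ℝ) ∈ Metric.sphere (0 : E3) 1 := by
      have : |((j.1.sign : ℤ) : ℝ)| = 1 := by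
        rcases mul_self_eq_one_iff.1 hs with h | h <;> rw [h] <;> simp
      simpa using this
    have h1 := congrFun h' ⟨_, hmem⟩
    simp only [cosDensity, PiLp.single_apply, Pi.zero_apply, if_true] at h1
    rw [hs] at h1
    simp at h1
  have htop : ∫⁻ ω, cosDensity j ω ∂surface ≠ ∞ := by
    refine ne_of_lt (lt_of_le_of_lt (lintegral_mono (g := fun _ => 1) ?_) ?_)
    · intro ω
      have hle : |(ω : E3) 0| ≤ 1 := by
        have h1 := PiLp.norm_apply_le (ω : E3) 0
        rw [norm_eq_of_mem_sphere, Real.norm_eq_abs] at h1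
        exact h1
      simp only [cosDensity]
      rw [ENNReal.ofReal_le_one]
      rcases abs_le.1 hle with ⟨h1, h2⟩
      rcases mul_self_eq_one_iff.1 hs with h | h <;> rw [h] <;> linarith
    · simp
  constructor
  rw [angleLaw, Measure.smul_apply, withDensity_apply _ MeasurableSet.univ, setLIntegral_univ,
    smul_eq_mul, ENNReal.inv_mul_cancel h0 htop]

/-- The reflection law `ℙ`: the `ω^j` are independent, each with its law `angleLaw j`. -/
def reflectionLaw : Measure Noise := Measure.infinitePi angleLaw

instance : IsProbabilityMeasure reflectionLaw := by
  unfold reflectionLaw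
  infer_instance

/-- The measure `dz_N dℙ^N`. -/
def phaseMeasure (N : ℕ) : Measure (State N) :=
  (volume : Measure (Fin N → Pos × E3)).prod (Measure.pi fun _ => reflectionLaw)

/-! ### Phase space -/

/-- The set `Ω`. -/
def Omega : Set Noise :=
  {ω | ∀ j : ZStar, (0 < j.1 → 0 < (ω j : E3) 0) ∧ (j.1 < 0 → (ω j : E3) 0 < 0)}

/-- `D_ε^N × Ω^N`. The distance of two points of `Λ` is the smallest length of a representative
`u ∈ ℝ³` of their difference. -/
def phaseSpace (ε : ℝ) (N : ℕ) : Set (State N) :=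
  {z | (∀ i, (pos z i).1 ∈ Icc (0 : ℝ) 1) ∧
    (∀ i j, i ≠ j → ∀ u : E3, proj u = pos z i - pos z j → ε < ‖u‖) ∧
    ∀ i, noise z i ∈ Omega}

/-- The same set with contacts allowed: `|x_i - x_j| ≥ ε`. -/
def contactPhaseSpace (ε : ℝ) (N : ℕ) : Set (State N) :=
  {z | (∀ i, (pos z i).1 ∈ Icc (0 : ℝ) 1) ∧
    (∀ i j, i ≠ j → ∀ u : E3, proj u = pos z i - pos z j → ε ≤ ‖u‖) ∧
    ∀ i, noise z i ∈ Omega}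

/-! ### Dynamics -/

/-- Free motion along straight lines with constant velocities and noises. -/
def freeFlow (t : ℝ) (z : State N) : State N :=
  (fun i => (pos z i + proj (t • vel z i), vel z i), z.2)

/-- The shocks: a collision of particles `i` and `j`, where the representative `u` of `x_i - x_j`
has length `ε`, or a reflection of particle `i` at the wall. -/
inductive Shock (N : ℕ) where
  | collision (i j : Fin N) (u : E3)
  | reflection (i : Fin N)

/-- The shock `s` takes place in the configuration `z`. -/
def IsShock (ε : ℝ) (z : State N) : Shock N → Prop
  | .collision i j u => i < j ∧ proj u = pos z i - pos z j ∧ ‖u‖ = ε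
  | .reflection i => (pos z i).1 = 0 ∨ (pos z i).1 = 1

/-- `Γ(x)`, so that the inner normal at a wall point `x` is `Γ(x) e`. -/
def wallSign (x : Pos) : ℝ := if x.1 = 0 then 1 else -1

/-- The unit vector `ν = u / |u|`. -/
def unitDir (u : E3) : E3 := ‖u‖⁻¹ • u

/-- The normal velocity of a shock: `ν·(v_i - v_j)` or `n(x_i)·v_i`. It is negative before a shock,
positive after it, and zero if the shock is grazing. -/
def normalVel (z : State N) : Shock N → ℝ
  | .collision i j u => inner ℝ (unitDir u) (vel z i - vel z j)
  | .reflection i => wallSign (pos z i) * vel z i 0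

/-- `z'` results from `z` by the shock. Collision: elastic exchange of the normal components of the
velocities. Reflection: `v_i' = |v_i| Γ ω_i^1`, the incoming direction is recorded as
`ω_i'^{-1} = Γ v_i / |v_i|`, and the other entries are shifted, `ω_i'^j = ω_i^{j+1}`, `j ≠ -1`. -/
def Jump (z z' : State N) : Shock N → Prop
  | .collision i j u =>
      let ν := unitDir u
      let c := inner ℝ ν (vel z i - vel z j)
      z' = (Function.update (Function.update z.1 i (pos z i, vel z i - c • ν)) j
        (pos z j, vel z j + c • ν), z.2)
  | .reflection i =>
      let Γ := wallSign (pos z i)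
      z'.1 = Function.update z.1 i
        (pos z i, (‖vel z i‖ * Γ) • (noise z i ⟨1, by decide⟩ : E3)) ∧
      (∀ k, k ≠ i → noise z' k = noise z k) ∧
      (noise z' i ⟨-1, by decide⟩ : E3) = (Γ / ‖vel z i‖) • vel z i ∧
      ∀ j k : ZStar, k.1 = j.1 + 1 → noise z' i j = noise z i k

/-- `z'` is the state at (and just after) a time at which the state just before is `z`: either there
is no shock, or there is exactly one, it is not grazing, and `z'` results from it. -/
def Transition (ε : ℝ) (z z' : State N) : Prop :=
  ((∀ s, ¬ IsShock ε z s) ∧ z' = z) ∨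
  ∃ s, IsShock ε z s ∧ (∀ s', IsShock ε z s' → s' = s) ∧ normalVel z s < 0 ∧ Jump z z' s

/-- `γ` is a (right-continuous) trajectory of the dynamics on the open interval `J`: around every
time `t ∈ J` it flows freely before `t` towards a state `z`, and after `t` from the state `γ t`,
which results from `z` by the rules of the dynamics. -/
def IsTrajectoryOn (ε : ℝ) (J : Set ℝ) (γ : ℝ → State N) : Prop :=
  ∀ t ∈ J, γ t ∈ contactPhaseSpace ε N ∧ ∃ z, Transition ε z (γ t) ∧
    (∀ᶠ s in 𝓝[<] t, γ s = freeFlow (s - t) z) ∧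
    ∀ᶠ s in 𝓝[≥] t, γ s = freeFlow (s - t) (γ t)

/-- Two shocks at the same time; this includes collisions of more than two particles. -/
def HasMultipleShocks (ε : ℝ) (z : State N) : Prop :=
  ∃ s s', s ≠ s' ∧ IsShock ε z s ∧ IsShock ε z s'

/-- A grazing collision or reflection. -/
def HasGrazingShock (ε : ℝ) (z : State N) : Prop :=
  ∃ s, IsShock ε z s ∧ normalVel z s = 0

/-- `γ` flows freely, on the side of the time `c` described by the filter `l`, to a state with a
multiple or grazing shock at time `c`. -/
def EndsBadly (ε : ℝ) (γ : ℝ → State N) (l : Filter ℝ) (c : ℝ) : Prop :=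
  ∃ z, (∀ᶠ s in l, γ s = freeFlow (s - c) z) ∧ (HasMultipleShocks ε z ∨ HasGrazingShock ε z)

/-- The trajectory `γ` has infinitely many shocks in the bounded interval `(a, b)`. -/
def HasInfinitelyManyShocks (ε : ℝ) (γ : ℝ → State N) (a b : ℝ) : Prop :=
  {t | t ∈ Ioo a b ∧ ∃ s, IsShock ε (γ t) s}.Infinite

/-- The set of bad initial data. Either the initial configuration itself has a multiple shock, or a
shock for which the initial velocities are not outgoing; or the trajectory, forward or backward in
time, leads in finite time to a multiple shock, to a grazing shock or to infinitely many shocks. -/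
def badSet (ε : ℝ) (N : ℕ) : Set (State N) :=
  {z | z ∈ phaseSpace ε N ∧
    (HasMultipleShocks ε z ∨ (∃ s, IsShock ε z s ∧ normalVel z s ≤ 0) ∨
      ∃ (a b : ℝ) (γ : ℝ → State N), a < 0 ∧ 0 < b ∧ IsTrajectoryOn ε (Ioo a b) γ ∧ γ 0 = z ∧
        (EndsBadly ε γ (𝓝[<] b) b ∨ EndsBadly ε γ (𝓝[>] a) a ∨
          HasInfinitelyManyShocks ε γ a b))}

open Classical in
/-- The flow: the state at time `t` of the trajectory issued from `z` (`z` itself if there is no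
trajectory). -/
def flow (ε t : ℝ) (z : State N) : State N :=
  if h : ∃ γ : ℝ → State N, IsTrajectoryOn ε univ γ ∧ γ 0 = z then h.choose t else z

end HardSphere

end

noncomputable section

namespace HardSphere

variable {N : ℕ}

/-! ### Geometry of the cylinder and free motion near contacts -/

section


/-! ### The projection to the cylinder -/

/-! The dynamics is deterministic in both time directions as long as shocks are simple and not
grazing. A collision is an involution. A reflection consumes ω^1, which becomes the outgoing
direction, and stores the incoming direction as ω^{-1}, so no information is lost and `jump` has the
inverse `unjump`. Hence trajectories through a state are unique, and each state has a maximal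
trajectory `orbit` on an open interval `life`. A trajectory can break off only at a multiple shock,
at a grazing shock or at an accumulation of shocks, so a datum of the phase space is good exactly if
its `life` is the whole line (`life_eq_univ`, `not_mem_badSet`).

Invariance of the measure is a statement about fluxes. A state with a shock at time t is described
by the contact configuration and t. In these coordinates the phase measure has the density ε² sin θ
|ν·V| for a collision with direction ν and relative velocity V, and |v·e| for a wall contact. A
collision only reflects V and translates the other particle, which leaves this density invariant
(`measure_image_collision`). At a wall, polar coordinates split |v·e| dv into the cosine law times
r³ dr. The cosine law is the law of the ω^j, so after the incoming direction has been inserted at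
index 0, a reflection becomes the shift of a two-sided sequence of independent directions, which
maps the incoming flux to the outgoing one (`measurePreserving_shiftNoise`,
`measure_image_reflection`). Therefore a time step with at most one shock preserves the measure.
Since shock times are isolated, every trajectory that is alive on [0, T] is a composition of
finitely many such steps (`transports_alive`).

It remains to see that almost every trajectory is global. The free motion of almost every state has
no multiple and no grazing shock, by Fubini along translations of a single particle
(`measure_singular`). The energy is conserved, so it may be bounded. Outside the null set, a state
with two shocks in (0, δ] lies in a tube of time-length δ over the contacts that are followed by
another shock within δ. Free flow preserves the measure, so the measure of a tube is proportional to
its length. Thus 1/δ times the measure of the short tube is a constant times the measure of a tube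
of fixed length over the same contacts, and this tends to zero because the contacts decrease to the
empty set. Two shocks in one step thus have measure o(δ) (`tendsto_measure_not_stepSet`), and by
invariance the T/δ steps up to time T together lose only o(1).

Negative times need no second estimate. The forward dynamics maps almost all of an energy ball,
which has finite measure, injectively into the ball and preserves the measure. So it covers the ball
up to a null set, and its images are states with a past of length T
(`measure_energyBall_not_alive_neg`). -/

theorem proj_add (u v : E3) : proj (u + v) = proj u + proj v := by
  simp [proj]

theorem proj_zero : proj 0 = 0 := by
  simp [proj]

theorem proj_neg (u : E3) : proj (-u) = -proj u := by
  simp [proj]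

theorem proj_sub (u v : E3) : proj (u - v) = proj u - proj v := by
  simp [proj]

theorem continuous_proj : Continuous proj := by
  unfold proj
  refine Continuous.prodMk (by fun_prop) (Continuous.prodMk ?_ ?_)
  · exact (AddCircle.continuous_mk' 1).comp (by fun_prop)
  · exact (AddCircle.continuous_mk' 1).comp (by fun_prop)

theorem proj_surjective : Function.Surjective proj := by
  rintro ⟨a, b, c⟩
  obtain ⟨b, rfl⟩ := QuotientAddGroup.mk_surjective b
  obtain ⟨c, rfl⟩ := QuotientAddGroup.mk_surjective c
  exact ⟨!₂[a, b, c], rfl⟩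

/-- The lattice vector `(0, m, n)`. -/
def latticeVec (k : ℤ × ℤ) : E3 := !₂[0, (k.1 : ℝ), (k.2 : ℝ)]

theorem coe_circle_eq_iff (x y : ℝ) : (x : UnitAddCircle) = y ↔ ∃ m : ℤ, x = y + m := by
  rw [← sub_eq_zero, ← AddCircle.coe_sub, AddCircle.coe_eq_zero_iff]
  refine exists_congr fun m => ?_
  rw [zsmul_eq_mul, mul_one]
  constructor <;> intro h <;> linarith

theorem proj_eq_proj_iff {u v : E3} : proj u = proj v ↔ ∃ k, u = v + latticeVec k := by
  simp only [proj, Prod.mk.injEq, coe_circle_eq_iff]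
  constructor
  · rintro ⟨h0, ⟨m, hm⟩, ⟨n, hn⟩⟩
    refine ⟨(m, n), ?_⟩
    ext l
    fin_cases l <;> simp [latticeVec, h0, hm, hn]
  · rintro ⟨k, rfl⟩
    exact ⟨by simp [latticeVec], ⟨k.1, by simp [latticeVec]⟩, ⟨k.2, by simp [latticeVec]⟩⟩

theorem abs_apply_le_norm (u : E3) (l : Fin 3) : |u l| ≤ ‖u‖ := by
  simpa using PiLp.norm_apply_le u l

/-- Two representatives differ by an integer vector. This gap turns "different representatives" into
a closed condition, and it identifies representatives that are known to be close. -/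
theorem one_le_norm_sub {u v : E3} (h : proj u = proj v) (hne : u ≠ v) : 1 ≤ ‖u - v‖ := by
  obtain ⟨⟨m, n⟩, rfl⟩ := proj_eq_proj_iff.1 h
  have h1 := abs_apply_le_norm (v + latticeVec (m, n) - v) 1
  have h2 := abs_apply_le_norm (v + latticeVec (m, n) - v) 2
  simp only [add_sub_cancel_left] at h1 h2 ⊢
  by_cases hm : m = 0
  · by_cases hn : n = 0
    · exfalso
      apply hne
      subst hm hn
      ext l
      fin_cases l <;> simp [latticeVec]
    · refine le_trans ?_ h2
      simp only [latticeVec]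
      have := Int.one_le_abs hn
      simpa using (by exact_mod_cast this : (1 : ℝ) ≤ |(n : ℝ)|)
  · refine le_trans ?_ h1
    simp only [latticeVec]
    have := Int.one_le_abs hm
    simpa using (by exact_mod_cast this : (1 : ℝ) ≤ |(m : ℝ)|)

theorem countable_reps (p : Pos) : {w : E3 | proj w = p}.Countable := by
  obtain ⟨v, rfl⟩ := proj_surjective p
  refine (countable_range fun k => v + latticeVec k).mono ?_
  intro w hw
  obtain ⟨k, hk⟩ := proj_eq_proj_iff.1 hw
  exact ⟨k, hk.symm⟩

/-- A length bound confines the integer coordinates of the translation. Finiteness makes statements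
"for small times" uniform over the representatives. -/
theorem finite_reps (p : Pos) (r : ℝ) : {w : E3 | proj w = p ∧ ‖w‖ ≤ r}.Finite := by
  obtain ⟨v, rfl⟩ := proj_surjective p
  set M : ℤ := ⌈r + ‖v‖⌉
  refine (((finite_Icc (-M) M).prod (finite_Icc (-M) M)).image
    fun k => v + latticeVec k).subset ?_
  rintro w ⟨hw, hr⟩
  obtain ⟨⟨m, n⟩, rfl⟩ := proj_eq_proj_iff.1 hw
  have h1 := abs_apply_le_norm (v + latticeVec (m, n)) 1
  have h2 := abs_apply_le_norm (v + latticeVec (m, n)) 2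
  have h1' := abs_apply_le_norm v 1
  have h2' := abs_apply_le_norm v 2
  have hM : r + ‖v‖ ≤ M := Int.le_ceil _
  replace h1 := h1.trans hr
  replace h2 := h2.trans hr
  simp only [latticeVec, PiLp.add_apply] at h1 h2
  simp at h1 h2
  refine ⟨(m, n), ⟨⟨?_, ?_⟩, ⟨?_, ?_⟩⟩, rfl⟩ <;>
  · rw [abs_le] at h1 h2 h1' h2'
    have : (-(M : ℝ)) ≤ m ∧ (m : ℝ) ≤ M ∧ (-(M : ℝ)) ≤ n ∧ (n : ℝ) ≤ M := by
      refine ⟨?_, ?_, ?_, ?_⟩ <;> linarith [h1.1, h1.2, h2.1, h2.2, h1'.1, h1'.2, h2'.1, h2'.2]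
    dsimp only
    first
      | exact_mod_cast this.1
      | exact_mod_cast this.2.1
      | exact_mod_cast this.2.2.1
      | exact_mod_cast this.2.2.2

/-! ### Free flow -/

@[simp] theorem pos_freeFlow (t : ℝ) (z : State N) (i : Fin N) :
    pos (freeFlow t z) i = pos z i + proj (t • vel z i) := rfl

@[simp] theorem vel_freeFlow (t : ℝ) (z : State N) (i : Fin N) :
    vel (freeFlow t z) i = vel z i := rfl

@[simp] theorem noise_freeFlow (t : ℝ) (z : State N) (i : Fin N) :
    noise (freeFlow t z) i = noise z i := rfl

theorem state_ext {z z' : State N} (hp : ∀ i, pos z i = pos z' i) (hv : ∀ i, vel z i = vel z' i)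
    (hn : ∀ i, noise z i = noise z' i) : z = z' := by
  refine Prod.ext (funext fun i => Prod.ext (hp i) (hv i)) (funext hn)

@[simp] theorem freeFlow_zero (z : State N) : freeFlow 0 z = z := by
  refine state_ext (fun i => ?_) (fun i => rfl) (fun i => rfl)
  simp [proj_zero]

theorem freeFlow_freeFlow (s t : ℝ) (z : State N) :
    freeFlow s (freeFlow t z) = freeFlow (s + t) z := by
  refine state_ext (fun i => ?_) (fun i => rfl) (fun i => rfl)
  simp only [pos_freeFlow, vel_freeFlow, add_smul, proj_add]
  abel

theorem freeFlow_injective (t : ℝ) : Function.Injective (freeFlow t : State N → State N) := by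
  intro z z' h
  have := congrArg (freeFlow (-t)) h
  simpa [freeFlow_freeFlow] using this

theorem continuous_pos (i : Fin N) : Continuous fun z : State N => pos z i := by
  unfold pos; fun_prop

theorem continuous_vel (i : Fin N) : Continuous fun z : State N => vel z i := by
  unfold vel; fun_prop

theorem continuous_noise (i : Fin N) : Continuous fun z : State N => noise z i := by
  unfold noise; fun_prop

theorem continuous_freeFlow_uncurry : Continuous fun q : ℝ × State N => freeFlow q.1 q.2 := by
  unfold freeFlow
  refine Continuous.prodMk (continuous_pi fun i => Continuous.prodMk ?_ ?_) (by fun_prop)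
  · exact ((continuous_pos i).comp continuous_snd).add (continuous_proj.comp
      (continuous_fst.smul ((continuous_vel i).comp continuous_snd)))
  · exact (continuous_vel i).comp continuous_snd

theorem continuous_freeFlow (t : ℝ) : Continuous fun z : State N => freeFlow t z :=
  continuous_freeFlow_uncurry.comp (Continuous.prodMk continuous_const continuous_id)

theorem continuous_freeFlow_left (z : State N) : Continuous fun t => freeFlow t z :=
  continuous_freeFlow_uncurry.comp (Continuous.prodMk continuous_id continuous_const)

/-! ### Reversal of velocities -/

/-- Reversal of all velocities. -/
def rev (z : State N) : State N := (fun i => (pos z i, -vel z i), z.2)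

@[simp] theorem pos_rev (z : State N) (i : Fin N) : pos (rev z) i = pos z i := rfl
@[simp] theorem vel_rev (z : State N) (i : Fin N) : vel (rev z) i = -vel z i := rfl

theorem freeFlow_rev (t : ℝ) (z : State N) : freeFlow t (rev z) = rev (freeFlow (-t) z) := by
  refine state_ext (fun i => ?_) (fun i => rfl) (fun i => rfl)
  simp

variable {ε : ℝ}

theorem isShock_congr {z z' : State N} (h : ∀ i, pos z i = pos z' i) (s : Shock N) :
    IsShock ε z s ↔ IsShock ε z' s := by
  cases s <;> simp [IsShock, h]

theorem isShock_rev {z : State N} {s : Shock N} : IsShock ε (rev z) s ↔ IsShock ε z s :=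
  isShock_congr (fun _ => rfl) s

/-- Reversal exchanges incoming and outgoing shocks, so statements about free flow to the right of a
time transfer to the left. It is applied to free flow only, since it does not touch the noises. -/
theorem normalVel_rev (z : State N) (s : Shock N) : normalVel (rev z) s = -normalVel z s := by
  cases s with
  | collision i j u =>
    simp only [normalVel, vel_rev]
    rw [← inner_neg_right]
    congr 1
    abel
  | reflection i => simp [normalVel]

theorem isOpenMap_proj : IsOpenMap proj := by
  have h1 : IsOpenMap (Prod.map (id : ℝ → ℝ)
      (Prod.map (fun x : ℝ => (x : UnitAddCircle)) (fun x : ℝ => (x : UnitAddCircle)))) :=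
    IsOpenMap.id.prodMap ((QuotientAddGroup.isOpenMap_coe).prodMap QuotientAddGroup.isOpenMap_coe)
  intro U hU
  set g : ℝ × ℝ × ℝ → E3 := fun q => !₂[q.1, q.2.1, q.2.2]
  have hg : Continuous g := by
    refine (PiLp.continuous_toLp 2 _).comp (continuous_pi fun l => ?_)
    fin_cases l <;> simp <;> fun_prop
  convert h1 _ (hU.preimage hg) using 1
  ext p
  constructor
  · rintro ⟨u, hu, rfl⟩
    refine ⟨(u 0, u 1, u 2), ?_, rfl⟩
    have : g (u 0, u 1, u 2) = u := by
      ext l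
      fin_cases l <;> rfl
    rwa [mem_preimage, this]
  · rintro ⟨q, hq, rfl⟩
    exact ⟨g q, hq, rfl⟩

/-- The condition of `contactPhaseSpace` on the positions. -/
def NoOverlap (ε : ℝ) (z : State N) : Prop :=
  (∀ i, (pos z i).1 ∈ Icc (0 : ℝ) 1) ∧
    (∀ i j, i ≠ j → ∀ u : E3, proj u = pos z i - pos z j → ε ≤ ‖u‖)

theorem mem_contact_iff {z : State N} :
    z ∈ contactPhaseSpace ε N ↔ NoOverlap ε z ∧ ∀ i, noise z i ∈ Omega := by
  simp [contactPhaseSpace, NoOverlap, and_assoc]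

/-- The quotient map is open, so displacements having a representative shorter than ε form an open
set. -/
theorem isClosed_noOverlap : IsClosed {z : State N | NoOverlap ε z} := by
  have h1 : IsClosed {p : Pos | ∀ u : E3, proj u = p → ε ≤ ‖u‖} := by
    have : {p : Pos | ∀ u : E3, proj u = p → ε ≤ ‖u‖} = (proj '' Metric.ball 0 ε)ᶜ := by
      ext p
      simp only [mem_ofPred_eq, mem_compl_iff, mem_image, mem_ball_zero_iff, not_exists, not_and]
      refine forall_congr' fun u => ?_
      rw [← not_lt]
      tauto
    rw [this]
    exact (isOpenMap_proj _ Metric.isOpen_ball).isClosed_compl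
  have h2 : {z : State N | NoOverlap ε z} =
      (⋂ i, {z | (pos z i).1 ∈ Icc (0 : ℝ) 1}) ∩ ⋂ i, ⋂ j, ⋂ (_ : i ≠ j),
        (fun z : State N => pos z i - pos z j) ⁻¹' {p : Pos | ∀ u : E3, proj u = p → ε ≤ ‖u‖} := by
    ext z
    simp [NoOverlap]
  rw [h2]
  refine IsClosed.inter (isClosed_iInter fun i => ?_) (isClosed_iInter fun i =>
    isClosed_iInter fun j => isClosed_iInter fun _ => ?_)
  · exact isClosed_Icc.preimage (continuous_fst.comp (continuous_pos i))
  · exact h1.preimage ((continuous_pos i).sub (continuous_pos j))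

/-! ### Free flow near contacts -/

theorem norm_add_smul_sq (u V : E3) (t : ℝ) :
    ‖u + t • V‖ ^ 2 = ‖u‖ ^ 2 + t * (2 * inner ℝ u V + t * ‖V‖ ^ 2) := by
  rw [norm_add_sq_real, inner_smul_right, norm_smul, mul_pow, Real.norm_eq_abs, sq_abs]
  ring

/-- Only the finitely many representatives of length at most ε + 1 matter while the displacement
stays below 1. Those longer than ε stay so by continuity; for those of length ε the squared length
increases, since its derivative at 0 is 2⟨u, V⟩ > 0. -/
theorem eventually_lt_norm_of_rep {p : Pos} {V : E3}
    (h1 : ∀ u, proj u = p → ε ≤ ‖u‖) (h2 : ∀ u, proj u = p → ‖u‖ = ε → 0 < inner ℝ u V) :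
    ∀ᶠ t in 𝓝[>] (0 : ℝ), ∀ u, proj u = p + proj (t • V) → ε < ‖u‖ := by
  have hfin := finite_reps p (ε + 1)
  have h3 : ∀ᶠ t in 𝓝[>] (0 : ℝ), ∀ w ∈ {w : E3 | proj w = p ∧ ‖w‖ ≤ ε + 1}, ε < ‖w + t • V‖ := by
    rw [hfin.eventually_all]
    rintro w ⟨hw, -⟩
    rcases (h1 w hw).lt_or_eq with h | h
    · have : Tendsto (fun t : ℝ => ‖w + t • V‖) (𝓝[>] 0) (𝓝 ‖w + (0 : ℝ) • V‖) :=
        (Continuous.tendsto (by fun_prop) 0).mono_left nhdsWithin_le_nhds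
      rw [zero_smul, add_zero] at this
      exact this.eventually (lt_mem_nhds h)
    · filter_upwards [self_mem_nhdsWithin] with t ht
      have ht : 0 < t := ht
      have h5 := h2 w hw h.symm
      have h4 := norm_add_smul_sq w V t
      have : ‖w‖ ^ 2 < ‖w + t • V‖ ^ 2 := by
        rw [h4]
        have : 0 < t * (2 * inner ℝ w V + t * ‖V‖ ^ 2) := by positivity
        linarith
      rw [h]
      exact lt_of_pow_lt_pow_left₀ 2 (norm_nonneg _) this
  have h4 : ∀ᶠ t in 𝓝[>] (0 : ℝ), ‖t • V‖ < 1 := by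
    have : Tendsto (fun t : ℝ => ‖t • V‖) (𝓝[>] 0) (𝓝 ‖(0 : ℝ) • V‖) :=
      (Continuous.tendsto (by fun_prop) 0).mono_left nhdsWithin_le_nhds
    rw [zero_smul, norm_zero] at this
    exact this.eventually (gt_mem_nhds one_pos)
  filter_upwards [h3, h4] with t ht3 ht4 u hu
  by_cases h : ‖u - t • V‖ ≤ ε + 1
  · have := ht3 (u - t • V) ⟨by rw [proj_sub, hu, add_sub_cancel_right], h⟩
    rwa [sub_add_cancel] at this
  · have := norm_sub_le u (t • V)
    linarith [not_le.1 h]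

theorem unitDir_inner {u : E3} (V : E3) : inner ℝ (unitDir u) V = ‖u‖⁻¹ * inner ℝ u V := by
  simp [unitDir, inner_smul_left]

/-- Outgoing contacts separate at once; everything that is not in contact stays apart by continuity.
-/
theorem eventually_free (hε : 0 < ε) {z : State N} (hz : NoOverlap ε z)
    (h : ∀ s, IsShock ε z s → 0 < normalVel z s) :
    ∀ᶠ t in 𝓝[>] (0 : ℝ), NoOverlap ε (freeFlow t z) ∧ ∀ s, ¬ IsShock ε (freeFlow t z) s := by
  have hwall : ∀ i, ∀ᶠ t in 𝓝[>] (0 : ℝ), (pos (freeFlow t z) i).1 ∈ Ioo (0 : ℝ) 1 := by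
    intro i
    have hlim : Tendsto (fun t : ℝ => (pos (freeFlow t z) i).1) (𝓝[>] 0) (𝓝 (pos z i).1) := by
      have : Continuous (fun t : ℝ => (pos (freeFlow t z) i).1) :=
        continuous_fst.comp ((continuous_pos i).comp (continuous_freeFlow_left z))
      have := (this.tendsto 0).mono_left (nhdsWithin_le_nhds (s := Ioi 0))
      simpa using this
    have hx : ∀ t, (pos (freeFlow t z) i).1 = (pos z i).1 + t * vel z i 0 := by
      intro t
      simp [proj]
    rcases (hz.1 i).1.eq_or_lt with h0 | h0
    · have hv := h (.reflection i) (Or.inl h0.symm)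
      simp only [normalVel, wallSign, ← h0, if_true, one_mul] at hv
      filter_upwards [hlim.eventually (gt_mem_nhds (show (pos z i).1 < 1 by rw [← h0]; simp)),
        self_mem_nhdsWithin] with t ht1 ht0
      refine ⟨?_, ht1⟩
      rw [hx, ← h0, zero_add]
      exact mul_pos ht0 hv
    rcases (hz.1 i).2.eq_or_lt with h1 | h1
    · have hv := h (.reflection i) (Or.inr h1)
      simp only [normalVel, wallSign, h1, one_ne_zero, if_false] at hv
      filter_upwards [hlim.eventually (lt_mem_nhds h0), self_mem_nhdsWithin] with t ht1 ht0
      refine ⟨ht1, ?_⟩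
      rw [hx, h1]
      have : 0 < t := ht0
      nlinarith
    · exact (hlim.eventually (lt_mem_nhds h0)).and (hlim.eventually (gt_mem_nhds h1))
  have hpair : ∀ i j, i ≠ j → ∀ᶠ t in 𝓝[>] (0 : ℝ),
      ∀ u, proj u = pos (freeFlow t z) i - pos (freeFlow t z) j → ε < ‖u‖ := by
    intro i j hij
    have := eventually_lt_norm_of_rep (ε := ε) (p := pos z i - pos z j) (V := vel z i - vel z j)
      (hz.2 i j hij) ?_
    · filter_upwards [this] with t ht u hu
      refine ht u ?_
      rw [hu, smul_sub, proj_sub]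
      simp only [pos_freeFlow]
      abel
    · intro u hu hn
      rcases lt_or_gt_of_ne hij with hlt | hlt
      · have := h (.collision i j u) ⟨hlt, hu, hn⟩
        rw [normalVel, unitDir_inner, hn] at this
        exact pos_of_mul_pos_right this (inv_nonneg.2 hε.le)
      -- A collision is listed only with the smaller index first, so this pair is treated with the
      -- opposite representative.
      · have := h (.collision j i (-u)) ⟨hlt, by rw [proj_neg, hu, neg_sub], by rwa [norm_neg]⟩
        rw [normalVel, unitDir_inner, norm_neg, hn, inner_neg_left, ← inner_neg_right, neg_sub]
          at this
        exact pos_of_mul_pos_right this (inv_nonneg.2 hε.le)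
  have hpair' : ∀ᶠ t in 𝓝[>] (0 : ℝ), ∀ i j, i ≠ j →
      ∀ u, proj u = pos (freeFlow t z) i - pos (freeFlow t z) j → ε < ‖u‖ := by
    rw [eventually_all]
    intro i
    rw [eventually_all]
    intro j
    by_cases hij : i = j
    · simp [hij]
    · filter_upwards [hpair i j hij] with t ht _ using ht
  filter_upwards [eventually_all.2 hwall, hpair'] with t ht1 ht2
  refine ⟨⟨fun i => Ioo_subset_Icc_self (ht1 i), fun i j hij u hu => (ht2 i j hij u hu).le⟩, ?_⟩
  rintro (⟨i, j, u⟩ | i) hs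
  · exact (ht2 i j hs.1.ne u hs.2.1).ne' hs.2.2
  · rcases hs with hs | hs
    · exact (ht1 i).1.ne' hs
    · exact (ht1 i).2.ne hs

theorem noOverlap_congr {z z' : State N} (h : ∀ i, pos z i = pos z' i) :
    NoOverlap ε z ↔ NoOverlap ε z' := by
  simp [NoOverlap, h]

theorem tendsto_neg_nhdsLT : Tendsto (fun t : ℝ => -t) (𝓝[<] 0) (𝓝[>] 0) := by
  have := tendsto_neg_nhdsLT_neg (a := (0 : ℝ))
  simpa using this

theorem eventually_free_left (hε : 0 < ε) {z : State N} (hz : NoOverlap ε z)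
    (h : ∀ s, IsShock ε z s → normalVel z s < 0) :
    ∀ᶠ t in 𝓝[<] (0 : ℝ), NoOverlap ε (freeFlow t z) ∧ ∀ s, ¬ IsShock ε (freeFlow t z) s := by
  have := eventually_free hε (z := rev z) ((noOverlap_congr fun _ => rfl).2 hz) (fun s hs => by
    rw [normalVel_rev]
    linarith [h s (isShock_rev.1 hs)])
  filter_upwards [tendsto_neg_nhdsLT.eventually this] with t ht
  rw [freeFlow_rev, neg_neg] at ht
  exact ⟨(noOverlap_congr fun _ => rfl).1 ht.1, fun s hs => ht.2 s (isShock_rev.2 hs)⟩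

/-- An incoming contact would create an overlap, or an exit through the wall, immediately
afterwards. -/
theorem normalVel_nonneg_of_frequently (hε : 0 < ε) {z : State N}
    (h : ∃ᶠ t in 𝓝[>] (0 : ℝ), NoOverlap ε (freeFlow t z)) {s : Shock N} (hs : IsShock ε z s) :
    0 ≤ normalVel z s := by
  by_contra! hneg
  refine h ?_
  cases s with
  | collision i j u =>
    rw [normalVel, unitDir_inner, hs.2.2] at hneg
    have hin : inner ℝ u (vel z i - vel z j) < 0 := by
      by_contra! hc
      exact absurd hneg (not_lt.2 (mul_nonneg (inv_nonneg.2 hε.le) hc))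
    set V := vel z i - vel z j
    have hlim : ∀ᶠ t in 𝓝[>] (0 : ℝ), 2 * inner ℝ u V + t * ‖V‖ ^ 2 < 0 := by
      have : Tendsto (fun t : ℝ => 2 * inner ℝ u V + t * ‖V‖ ^ 2) (𝓝[>] 0)
          (𝓝 (2 * inner ℝ u V + 0 * ‖V‖ ^ 2)) :=
        (Continuous.tendsto (by fun_prop) 0).mono_left nhdsWithin_le_nhds
      exact this.eventually (gt_mem_nhds (by linarith))
    filter_upwards [hlim, self_mem_nhdsWithin] with t ht ht0 hno
    have h1 := hno.2 i j hs.1.ne (u + t • V) (by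
      rw [proj_add, hs.2.1, smul_sub, proj_sub]
      simp only [pos_freeFlow]
      abel)
    have h2 := norm_add_smul_sq u V t
    have h3 : t * (2 * inner ℝ u V + t * ‖V‖ ^ 2) < 0 := mul_neg_of_pos_of_neg ht0 ht
    rw [hs.2.2] at h2
    nlinarith [pow_le_pow_left₀ hε.le h1 2]
  | reflection i =>
    filter_upwards [self_mem_nhdsWithin] with t ht0 hno
    have ht0 : 0 < t := ht0
    have h1 := hno.1 i
    have hx : (pos (freeFlow t z) i).1 = (pos z i).1 + t * vel z i 0 := by simp [proj]
    rw [hx] at h1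
    rcases hs with hs | hs
    · simp only [normalVel, wallSign, hs, if_true, one_mul] at hneg
      have := h1.1
      rw [hs] at this
      nlinarith
    · simp only [normalVel, wallSign, hs, one_ne_zero, if_false] at hneg
      have := h1.2
      rw [hs] at this
      nlinarith

theorem normalVel_nonpos_of_frequently (hε : 0 < ε) {z : State N}
    (h : ∃ᶠ t in 𝓝[<] (0 : ℝ), NoOverlap ε (freeFlow t z)) {s : Shock N} (hs : IsShock ε z s) :
    normalVel z s ≤ 0 := by
  have h2 : ∃ᶠ t in 𝓝[>] (0 : ℝ), NoOverlap ε (freeFlow t (rev z)) := by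
    refine tendsto_neg_nhdsLT.frequently (h.mono fun t ht => ?_)
    rw [freeFlow_rev, neg_neg]
    exact (noOverlap_congr fun _ => rfl).2 ht
  have := normalVel_nonneg_of_frequently hε h2 (isShock_rev.2 hs)
  rw [normalVel_rev] at this
  linarith

end

/-! ### The shock rules as invertible maps -/

section

variable {ε : ℝ}

/-! ### The rules at a shock -/

/-- The direction of a nonzero vector. -/
def dirS2 (v : E3) : S2 :=
  if h : v = 0 then ⟨EuclideanSpace.single 0 1, by simp⟩
  else ⟨‖v‖⁻¹ • v, by simp [norm_smul, inv_mul_cancel₀ (norm_ne_zero_iff.2 h)]⟩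

theorem dirS2_coe {v : E3} (h : v ≠ 0) : (dirS2 v : E3) = ‖v‖⁻¹ • v := by
  simp [dirS2, h]

theorem dirS2_smul_sphere {r : ℝ} (hr : 0 < r) (ω : S2) : dirS2 (r • (ω : E3)) = ω := by
  have hω : ‖(ω : E3)‖ = 1 := norm_eq_of_mem_sphere ω
  have h : r • (ω : E3) ≠ 0 := by
    rw [← norm_ne_zero_iff, norm_smul, hω, Real.norm_of_nonneg hr.le, mul_one]
    exact hr.ne'
  apply Subtype.ext
  rw [dirS2_coe h, norm_smul, hω, Real.norm_of_nonneg hr.le, mul_one, smul_smul,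
    inv_mul_cancel₀ hr.ne', one_smul]

/-- The noise after a reflection with incoming direction `θ`. -/
def shiftNoise (θ : S2) (ω : Noise) : Noise :=
  fun j => if h : j.1 = -1 then θ else ω ⟨j.1 + 1, by omega⟩

/-- The noise before a reflection with outgoing direction `θ`. -/
def unshiftNoise (θ : S2) (ω : Noise) : Noise :=
  fun j => if h : j.1 = 1 then θ else ω ⟨j.1 - 1, by omega⟩

/-- The shift drops only ω^1, and this entry survives as the direction of the outgoing velocity.
Hence a reflection loses no information. -/
theorem unshiftNoise_shiftNoise (θ : S2) (ω : Noise) :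
    unshiftNoise (ω ⟨1, by decide⟩) (shiftNoise θ ω) = ω := by
  funext ⟨j, hj⟩
  by_cases h : j = 1
  · subst h; simp [unshiftNoise]
  · have h2 : ¬ j - 1 = -1 := by omega
    simp [unshiftNoise, shiftNoise, h, h2]

theorem shiftNoise_unshiftNoise (θ : S2) (ω : Noise) :
    shiftNoise (ω ⟨-1, by decide⟩) (unshiftNoise θ ω) = ω := by
  funext ⟨j, hj⟩
  by_cases h : j = -1
  · subst h; simp [shiftNoise]
  · have h2 : ¬ j + 1 = 1 := by omega
    simp [unshiftNoise, shiftNoise, h, h2]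

@[simp] theorem shiftNoise_neg_one (θ : S2) (ω : Noise) :
    shiftNoise θ ω ⟨-1, by decide⟩ = θ := by simp [shiftNoise]

@[simp] theorem unshiftNoise_one (θ : S2) (ω : Noise) :
    unshiftNoise θ ω ⟨1, by decide⟩ = θ := by simp [unshiftNoise]

theorem shiftNoise_mem_Omega {θ : S2} {ω : Noise} (hθ : (θ : E3) 0 < 0) (hω : ω ∈ Omega) :
    shiftNoise θ ω ∈ Omega := by
  rintro ⟨j, hj⟩
  by_cases h : j = -1
  · subst h
    simpa [shiftNoise] using hθ
  · have := hω ⟨j + 1, by omega⟩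
    simp only [shiftNoise, h, dif_neg, not_false_eq_true]
    exact ⟨fun h => this.1 (by simp only; omega), fun h' => this.2 (by simp only at h' ⊢; omega)⟩

theorem unshiftNoise_mem_Omega {θ : S2} {ω : Noise} (hθ : 0 < (θ : E3) 0) (hω : ω ∈ Omega) :
    unshiftNoise θ ω ∈ Omega := by
  rintro ⟨j, hj⟩
  by_cases h : j = 1
  · subst h
    simpa [unshiftNoise] using hθ
  · have := hω ⟨j - 1, by omega⟩
    simp only [unshiftNoise, h, dif_neg, not_false_eq_true]
    exact ⟨fun h' => this.1 (by simp only at h' ⊢; omega), fun h' => this.2 (by simp only; omega)⟩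

theorem wallSign_mul_self (x : Pos) : wallSign x * wallSign x = 1 := by
  unfold wallSign; split_ifs <;> norm_num

theorem norm_wallSign_smul (x : Pos) (v : E3) : ‖wallSign x • v‖ = ‖v‖ := by
  unfold wallSign; split_ifs <;> simp

/-- Elastic exchange of normal velocities. -/
def collide (i j : Fin N) (u : E3) (z : State N) : State N :=
  (Function.update (Function.update z.1 i
      (pos z i, vel z i - (inner ℝ (unitDir u) (vel z i - vel z j) : ℝ) • unitDir u)) j
    (pos z j, vel z j + (inner ℝ (unitDir u) (vel z i - vel z j) : ℝ) • unitDir u), z.2)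

/-- The state after the shock. -/
def jump : Shock N → State N → State N
  | .collision i j u, z => collide i j u z
  | .reflection i, z =>
      (Function.update z.1 i
        (pos z i, (‖vel z i‖ * wallSign (pos z i)) • (noise z i ⟨1, by decide⟩ : E3)),
      Function.update z.2 i (shiftNoise (dirS2 (wallSign (pos z i) • vel z i)) (noise z i)))

/-- The state before the shock. -/
def unjump : Shock N → State N → State N
  | .collision i j u, z => collide i j u z
  | .reflection i, z =>
      (Function.update z.1 i
        (pos z i, (‖vel z i‖ * wallSign (pos z i)) • (noise z i ⟨-1, by decide⟩ : E3)),
      Function.update z.2 i (unshiftNoise (dirS2 (wallSign (pos z i) • vel z i)) (noise z i)))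

@[simp] theorem pos_collide (i j : Fin N) (u : E3) (z : State N) (k : Fin N) :
    pos (collide i j u z) k = pos z k := by
  by_cases hj : k = j
  · subst hj; simp [collide, pos]
  by_cases hi : k = i
  · subst hi; simp [collide, pos, hj]
  · simp [collide, pos, hi, hj]

@[simp] theorem noise_collide (i j : Fin N) (u : E3) (z : State N) (k : Fin N) :
    noise (collide i j u z) k = noise z k := rfl

theorem vel_collide_left {i j : Fin N} (hij : i ≠ j) (u : E3) (z : State N) :
    vel (collide i j u z) i =
      vel z i - (inner ℝ (unitDir u) (vel z i - vel z j) : ℝ) • unitDir u := by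
  simp [collide, vel, hij]

theorem vel_collide_right (i j : Fin N) (u : E3) (z : State N) :
    vel (collide i j u z) j =
      vel z j + (inner ℝ (unitDir u) (vel z i - vel z j) : ℝ) • unitDir u := by
  simp [collide, vel]

theorem vel_collide_other {i j k : Fin N} (hi : k ≠ i) (hj : k ≠ j) (u : E3) (z : State N) :
    vel (collide i j u z) k = vel z k := by
  simp [collide, vel, hi, hj]

theorem norm_unitDir {u : E3} (hu : u ≠ 0) : ‖unitDir u‖ = 1 := by
  simp [unitDir, norm_smul, inv_mul_cancel₀ (norm_ne_zero_iff.2 hu)]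

theorem inner_unitDir_self {u : E3} (hu : u ≠ 0) : inner ℝ (unitDir u) (unitDir u) = (1 : ℝ) := by
  rw [real_inner_self_eq_norm_sq, norm_unitDir hu, one_pow]

theorem inner_vel_collide {i j : Fin N} (hij : i ≠ j) {u : E3} (hu : u ≠ 0) (z : State N) :
    inner ℝ (unitDir u) (vel (collide i j u z) i - vel (collide i j u z) j) =
      -inner ℝ (unitDir u) (vel z i - vel z j) := by
  rw [vel_collide_left hij, vel_collide_right]
  simp only [inner_sub_right, inner_add_right, inner_smul_right, inner_unitDir_self hu]
  ring

/-- The normal relative velocity changes sign under the exchange, so the second exchange undoes the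
first. -/
theorem collide_collide {i j : Fin N} (hij : i ≠ j) {u : E3} (hu : u ≠ 0) (z : State N) :
    collide i j u (collide i j u z) = z := by
  refine state_ext (fun k => by simp) (fun k => ?_) (fun k => rfl)
  have h := inner_vel_collide hij hu z
  by_cases hj : k = j
  · subst hj
    rw [vel_collide_right, h, vel_collide_right]
    simp
  by_cases hi : k = i
  · subst hi
    rw [vel_collide_left hij, h, vel_collide_left hij]
    simp
  · rw [vel_collide_other hi hj, vel_collide_other hi hj]

@[simp] theorem pos_jump (s : Shock N) (z : State N) (k : Fin N) : pos (jump s z) k = pos z k := by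
  cases s with
  | collision i j u => simp [jump]
  | reflection i =>
    by_cases h : k = i
    · subst h; simp [jump, pos]
    · simp [jump, pos, h]

@[simp] theorem pos_unjump (s : Shock N) (z : State N) (k : Fin N) :
    pos (unjump s z) k = pos z k := by
  cases s with
  | collision i j u => simp [unjump]
  | reflection i =>
    by_cases h : k = i
    · subst h; simp [unjump, pos]
    · simp [unjump, pos, h]

/-- A nonzero normal velocity makes the velocity nonzero, so that its direction is a genuine unit
vector. For zero velocity the relation would require a recorded direction equal to 0 and has no
solution, while the function `jump` uses the default value of `dirS2`. -/
theorem jump_iff {z z' : State N} {s : Shock N} (hs : normalVel z s ≠ 0) :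
    Jump z z' s ↔ z' = jump s z := by
  cases s with
  | collision i j u => rfl
  | reflection i =>
    have hv : vel z i ≠ 0 := by
      intro h
      simp [normalVel, h] at hs
    have hw : wallSign (pos z i) • vel z i ≠ 0 := by
      rwa [← norm_ne_zero_iff, norm_wallSign_smul, norm_ne_zero_iff]
    have hd : (dirS2 (wallSign (pos z i) • vel z i) : E3) =
        (wallSign (pos z i) / ‖vel z i‖) • vel z i := by
      rw [dirS2_coe hw, norm_wallSign_smul, smul_smul, div_eq_inv_mul]
    constructor
    · rintro ⟨h1, h2, h3, h4⟩
      refine Prod.ext h1 (funext fun k => ?_)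
      by_cases hk : k = i
      · subst hk
        simp only [jump, Function.update_self]
        funext j
        by_cases hj : j.1 = -1
        · obtain rfl : j = ⟨-1, by decide⟩ := Subtype.ext hj
          rw [shiftNoise_neg_one]
          exact Subtype.ext (h3.trans hd.symm)
        · simp only [shiftNoise, hj, dif_neg, not_false_eq_true]
          exact h4 _ _ rfl
      · simp only [jump]
        rw [Function.update_of_ne hk]
        exact h2 k hk
    · rintro rfl
      refine ⟨rfl, fun k hk => ?_, ?_, ?_⟩
      · simp [jump, noise, hk]
      · rw [← hd]
        simp [jump, noise]
      · intro j k hjk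
        have hj : ¬ j.1 = -1 := by
          intro h
          exact k.2 (by omega)
        simp only [jump, noise, Function.update_self, shiftNoise, hj, dif_neg, not_false_eq_true]
        exact congrArg (z.2 i) (Subtype.ext hjk.symm)

/-- The states of a trajectory: at most one shock, which is outgoing. -/
def Adm (ε : ℝ) (z : State N) : Prop :=
  z ∈ contactPhaseSpace ε N ∧ ¬ HasMultipleShocks ε z ∧ ∀ s, IsShock ε z s → 0 < normalVel z s

/-- The states just before a regular shock. -/
def Pre (ε : ℝ) (s : Shock N) (z : State N) : Prop :=
  z ∈ contactPhaseSpace ε N ∧ IsShock ε z s ∧ (∀ s', IsShock ε z s' → s' = s) ∧ normalVel z s < 0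

theorem vel_jump_reflection (i : Fin N) (z : State N) : vel (jump (.reflection i) z) i =
    (‖vel z i‖ * wallSign (pos z i)) • (noise z i ⟨1, by decide⟩ : E3) := by
  simp [jump, vel]

theorem vel_unjump_reflection (i : Fin N) (z : State N) : vel (unjump (.reflection i) z) i =
    (‖vel z i‖ * wallSign (pos z i)) • (noise z i ⟨-1, by decide⟩ : E3) := by
  simp [unjump, vel]

theorem noise_jump_reflection (i : Fin N) (z : State N) : noise (jump (.reflection i) z) i =
    shiftNoise (dirS2 (wallSign (pos z i) • vel z i)) (noise z i) := by
  simp [jump, noise]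

theorem noise_unjump_reflection (i : Fin N) (z : State N) : noise (unjump (.reflection i) z) i =
    unshiftNoise (dirS2 (wallSign (pos z i) • vel z i)) (noise z i) := by
  simp [unjump, noise]

theorem norm_smul_wallSign (x : Pos) (r : ℝ) (hr : 0 ≤ r) (ω : S2) :
    ‖(r * wallSign x) • (ω : E3)‖ = r := by
  rw [mul_smul, norm_smul, norm_wallSign_smul, norm_eq_of_mem_sphere, mul_one,
    Real.norm_of_nonneg hr]

theorem vel_ne_zero_of_normalVel {z : State N} {i : Fin N} (h : normalVel z (.reflection i) ≠ 0) :
    vel z i ≠ 0 := by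
  intro h'
  simp [normalVel, h'] at h

theorem ne_zero_of_isShock (hε : 0 < ε) {z : State N} {i j : Fin N} {u : E3}
    (h : IsShock ε z (.collision i j u)) : u ≠ 0 := by
  rintro rfl
  have := h.2.2
  simp at this
  linarith

theorem dirS2_wall_zero {z : State N} {i : Fin N} (h : normalVel z (.reflection i) ≠ 0) :
    (dirS2 (wallSign (pos z i) • vel z i) : E3) 0 =
      ‖vel z i‖⁻¹ * normalVel z (.reflection i) := by
  have hv := vel_ne_zero_of_normalVel h
  rw [dirS2_coe (by rwa [← norm_ne_zero_iff, norm_wallSign_smul, norm_ne_zero_iff]),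
    norm_wallSign_smul]
  simp [normalVel]

theorem normalVel_jump_reflection (i : Fin N) (z : State N) :
    normalVel (jump (.reflection i) z) (.reflection i) =
      ‖vel z i‖ * (noise z i ⟨1, by decide⟩ : E3) 0 := by
  rw [normalVel, vel_jump_reflection, pos_jump]
  simp only [PiLp.smul_apply, smul_eq_mul]
  linear_combination (‖vel z i‖ * (noise z i ⟨1, by decide⟩ : E3) 0) * wallSign_mul_self (pos z i)

theorem normalVel_unjump_reflection (i : Fin N) (z : State N) :
    normalVel (unjump (.reflection i) z) (.reflection i) =
      ‖vel z i‖ * (noise z i ⟨-1, by decide⟩ : E3) 0 := by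
  rw [normalVel, vel_unjump_reflection, pos_unjump]
  simp only [PiLp.smul_apply, smul_eq_mul]
  linear_combination (‖vel z i‖ * (noise z i ⟨-1, by decide⟩ : E3) 0) * wallSign_mul_self (pos z i)

theorem normalVel_jump_pos (hε : 0 < ε) {z : State N} {s : Shock N}
    (hO : ∀ i, noise z i ∈ Omega) (hs : IsShock ε z s) (hn : normalVel z s < 0) :
    0 < normalVel (jump s z) s := by
  cases s with
  | collision i j u =>
    simp only [normalVel, jump] at hn ⊢
    rw [inner_vel_collide hs.1.ne (ne_zero_of_isShock hε hs)]
    linarith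
  | reflection i =>
    rw [normalVel_jump_reflection]
    exact mul_pos (norm_pos_iff.2 (vel_ne_zero_of_normalVel hn.ne)) ((hO i ⟨1, by decide⟩).1 (by simp))

theorem normalVel_unjump_neg (hε : 0 < ε) {z : State N} {s : Shock N}
    (hO : ∀ i, noise z i ∈ Omega) (hs : IsShock ε z s) (hn : 0 < normalVel z s) :
    normalVel (unjump s z) s < 0 := by
  cases s with
  | collision i j u =>
    simp only [normalVel, unjump] at hn ⊢
    rw [inner_vel_collide hs.1.ne (ne_zero_of_isShock hε hs)]
    linarith
  | reflection i =>
    rw [normalVel_unjump_reflection]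
    exact mul_neg_of_pos_of_neg (norm_pos_iff.2 (vel_ne_zero_of_normalVel hn.ne'))
      ((hO i ⟨-1, by decide⟩).2 (by simp))

theorem noise_jump_mem {z : State N} {s : Shock N}
    (hO : ∀ i, noise z i ∈ Omega) (hn : normalVel z s < 0) (k : Fin N) :
    noise (jump s z) k ∈ Omega := by
  cases s with
  | collision i j u => exact hO k
  | reflection i =>
    by_cases hk : k = i
    · subst hk
      rw [noise_jump_reflection]
      refine shiftNoise_mem_Omega ?_ (hO k)
      rw [dirS2_wall_zero hn.ne]
      exact mul_neg_of_pos_of_neg (inv_pos.2 (norm_pos_iff.2 (vel_ne_zero_of_normalVel hn.ne))) hn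
    · simpa [jump, noise, hk] using hO k

theorem noise_unjump_mem {z : State N} {s : Shock N}
    (hO : ∀ i, noise z i ∈ Omega) (hn : 0 < normalVel z s) (k : Fin N) :
    noise (unjump s z) k ∈ Omega := by
  cases s with
  | collision i j u => exact hO k
  | reflection i =>
    by_cases hk : k = i
    · subst hk
      rw [noise_unjump_reflection]
      refine unshiftNoise_mem_Omega ?_ (hO k)
      rw [dirS2_wall_zero hn.ne']
      exact mul_pos (inv_pos.2 (norm_pos_iff.2 (vel_ne_zero_of_normalVel hn.ne'))) hn
    · simpa [unjump, noise, hk] using hO k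

/-- For a reflection, the speed is unchanged and the old direction is read off the entry at index
−1. -/
theorem unjump_jump (hε : 0 < ε) {z : State N} {s : Shock N} (hs : IsShock ε z s)
    (hn : normalVel z s ≠ 0) : unjump s (jump s z) = z := by
  cases s with
  | collision i j u => exact collide_collide hs.1.ne (ne_zero_of_isShock hε hs) z
  | reflection i =>
    have hv := vel_ne_zero_of_normalVel hn
    refine state_ext (fun k => by simp) (fun k => ?_) (fun k => ?_)
    · by_cases hk : k = i
      · subst hk
        rw [vel_unjump_reflection, vel_jump_reflection, pos_jump, noise_jump_reflection,
          shiftNoise_neg_one, norm_smul_wallSign _ _ (norm_nonneg _),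
          dirS2_coe (by rwa [← norm_ne_zero_iff, norm_wallSign_smul, norm_ne_zero_iff]),
          norm_wallSign_smul, smul_smul, smul_smul]
        have h1 := wallSign_mul_self (pos z k)
        have h2 : ‖vel z k‖ ≠ 0 := norm_ne_zero_iff.2 hv
        rw [show ‖vel z k‖ * wallSign (pos z k) * ‖vel z k‖⁻¹ * wallSign (pos z k) = 1 by
          field_simp; linear_combination h1, one_smul]
      · simp [unjump, jump, vel, hk]
    · by_cases hk : k = i
      · subst hk
        rw [noise_unjump_reflection, vel_jump_reflection, pos_jump, noise_jump_reflection,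
          smul_smul, mul_left_comm, wallSign_mul_self, mul_one,
          dirS2_smul_sphere (norm_pos_iff.2 hv), unshiftNoise_shiftNoise]
      · simp [unjump, jump, noise, hk]

theorem jump_unjump (hε : 0 < ε) {z : State N} {s : Shock N} (hs : IsShock ε z s)
    (hn : normalVel z s ≠ 0) : jump s (unjump s z) = z := by
  cases s with
  | collision i j u => exact collide_collide hs.1.ne (ne_zero_of_isShock hε hs) z
  | reflection i =>
    have hv := vel_ne_zero_of_normalVel hn
    refine state_ext (fun k => by simp) (fun k => ?_) (fun k => ?_)
    · by_cases hk : k = i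
      · subst hk
        rw [vel_jump_reflection, vel_unjump_reflection, pos_unjump, noise_unjump_reflection,
          unshiftNoise_one, norm_smul_wallSign _ _ (norm_nonneg _),
          dirS2_coe (by rwa [← norm_ne_zero_iff, norm_wallSign_smul, norm_ne_zero_iff]),
          norm_wallSign_smul, smul_smul, smul_smul]
        have h1 := wallSign_mul_self (pos z k)
        have h2 : ‖vel z k‖ ≠ 0 := norm_ne_zero_iff.2 hv
        rw [show ‖vel z k‖ * wallSign (pos z k) * ‖vel z k‖⁻¹ * wallSign (pos z k) = 1 by
          field_simp; linear_combination h1, one_smul]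
      · simp [unjump, jump, vel, hk]
    · by_cases hk : k = i
      · subst hk
        rw [noise_jump_reflection, vel_unjump_reflection, pos_unjump, noise_unjump_reflection,
          smul_smul, mul_left_comm, wallSign_mul_self, mul_one,
          dirS2_smul_sphere (norm_pos_iff.2 hv), shiftNoise_unshiftNoise]
      · simp [unjump, jump, noise, hk]

theorem hasMultipleShocks_congr {z z' : State N} (h : ∀ i, pos z i = pos z' i) :
    HasMultipleShocks ε z ↔ HasMultipleShocks ε z' := by
  simp only [HasMultipleShocks, isShock_congr h]

theorem eq_of_not_hasMultipleShocks {z : State N} (h : ¬ HasMultipleShocks ε z) {s s' : Shock N}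
    (hs : IsShock ε z s) (hs' : IsShock ε z s') : s' = s := by
  by_contra hne
  exact h ⟨s', s, hne, hs', hs⟩

theorem Pre.not_hasMultipleShocks {s : Shock N} {z : State N} (h : Pre ε s z) :
    ¬ HasMultipleShocks ε z := by
  rintro ⟨s₁, s₂, hne, h₁, h₂⟩
  exact hne ((h.2.2.1 _ h₁).trans (h.2.2.1 _ h₂).symm)

/-- Positions do not change, so the same single shock is present afterwards; it is now outgoing, for
reflections because ω^1 lies in the inner hemisphere. -/
theorem Pre.adm_jump (hε : 0 < ε) {s : Shock N} {z : State N} (h : Pre ε s z) :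
    Adm ε (jump s z) := by
  have hc := mem_contact_iff.1 h.1
  refine ⟨mem_contact_iff.2 ⟨(noOverlap_congr (by simp)).2 hc.1, noise_jump_mem hc.2 h.2.2.2⟩,
    ?_, ?_⟩
  · rw [hasMultipleShocks_congr (z' := z) (by simp)]
    exact h.not_hasMultipleShocks
  · intro s' hs'
    rw [isShock_congr (z' := z) (by simp)] at hs'
    rw [h.2.2.1 s' hs']
    exact normalVel_jump_pos hε hc.2 h.2.1 h.2.2.2

/-- The sign condition on ω^{-1} is what makes the reconstructed velocity incoming. Together with
`Pre.adm_jump` this makes the shock rule a bijection. -/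
theorem Adm.pre_unjump (hε : 0 < ε) {s : Shock N} {z : State N} (h : Adm ε z)
    (hs : IsShock ε z s) : Pre ε s (unjump s z) := by
  have hc := mem_contact_iff.1 h.1
  refine ⟨mem_contact_iff.2 ⟨(noOverlap_congr (by simp)).2 hc.1,
    noise_unjump_mem hc.2 (h.2.2 s hs)⟩, ?_, ?_, ?_⟩
  · rwa [isShock_congr (z' := z) (by simp)]
  · intro s' hs'
    rw [isShock_congr (z' := z) (by simp)] at hs'
    exact eq_of_not_hasMultipleShocks h.2.1 hs hs'
  · exact normalVel_unjump_neg hε hc.2 hs (h.2.2 s hs)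

theorem adm_of_forall_not_isShock {z : State N} (hc : z ∈ contactPhaseSpace ε N)
    (h : ∀ s, ¬ IsShock ε z s) : Adm ε z :=
  ⟨hc, fun ⟨s, _, _, hs, _⟩ => h s hs, fun s hs => absurd hs (h s)⟩

theorem transition_iff {z z' : State N} (hc : z ∈ contactPhaseSpace ε N) :
    Transition ε z z' ↔ ((∀ s, ¬ IsShock ε z s) ∧ z' = z) ∨ ∃ s, Pre ε s z ∧ z' = jump s z := by
  refine or_congr Iff.rfl (exists_congr fun s => ?_)
  constructor
  · rintro ⟨h1, h2, h3, h4⟩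
    exact ⟨⟨hc, h1, h2, h3⟩, (jump_iff h3.ne).1 h4⟩
  · rintro ⟨⟨_, h1, h2, h3⟩, h4⟩
    exact ⟨h1, h2, h3, (jump_iff h3.ne).2 h4⟩

theorem Transition.pos_eq {z z' : State N} (h : Transition ε z z') (i : Fin N) :
    pos z' i = pos z i := by
  rcases h with ⟨_, rfl⟩ | ⟨s, _, _, h, hj⟩
  · rfl
  · rw [(jump_iff h.ne).1 hj, pos_jump]

theorem Transition.unique {z z₁ z₂ : State N} (h₁ : Transition ε z z₁) (h₂ : Transition ε z z₂) :
    z₁ = z₂ := by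
  rcases h₁ with ⟨h, rfl⟩ | ⟨s, hs, hu, hn, hj⟩
  · rcases h₂ with ⟨_, rfl⟩ | ⟨s, hs, _⟩
    · rfl
    · exact absurd hs (h s)
  · rcases h₂ with ⟨h, _⟩ | ⟨s', hs', _, _, hj'⟩
    · exact absurd hs (h s)
    · rw [hu s' hs'] at hj'
      rw [(jump_iff hn.ne).1 hj, (jump_iff hn.ne).1 hj']

/-- Both preceding states have the positions of the common successor, hence the same shock, and
`unjump` recovers each of them. -/
theorem Transition.unique_left (hε : 0 < ε) {z z₁ z₂ : State N} (h₁ : Transition ε z₁ z)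
    (h₂ : Transition ε z₂ z) : z₁ = z₂ := by
  have hp : ∀ i, pos z₁ i = pos z₂ i := fun i => (h₁.pos_eq i).symm.trans (h₂.pos_eq i)
  rcases h₁ with ⟨h, rfl⟩ | ⟨s, hs, hu, hn, hj⟩
  · rcases h₂ with ⟨_, rfl⟩ | ⟨s, hs, _⟩
    · rfl
    · exact absurd ((isShock_congr hp s).2 hs) (h s)
  · rcases h₂ with ⟨h, _⟩ | ⟨s', hs', _, hn', hj'⟩
    · exact absurd ((isShock_congr hp s).1 hs) (h s)
    · obtain rfl := hu s' ((isShock_congr hp s').2 hs')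
      rw [← unjump_jump hε hs hn.ne, ← unjump_jump hε hs' hn'.ne, ← (jump_iff hn.ne).1 hj,
        ← (jump_iff hn'.ne).1 hj']

theorem Adm.exists_transition (hε : 0 < ε) {z : State N} (h : Adm ε z) :
    ∃ z₀ ∈ contactPhaseSpace ε N, Transition ε z₀ z := by
  by_cases hs : ∃ s, IsShock ε z s
  · obtain ⟨s, hs⟩ := hs
    have hp := h.pre_unjump hε hs
    exact ⟨unjump s z, hp.1, (transition_iff hp.1).2
      (Or.inr ⟨s, hp, (jump_unjump hε hs (h.2.2 s hs).ne').symm⟩)⟩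
  · push Not at hs
    exact ⟨z, h.1, Or.inl ⟨hs, rfl⟩⟩

end

/-! ### Uniqueness, local existence and maximal trajectories -/

section

variable {ε : ℝ}

/-! ### Trajectories -/

theorem isTrajectoryOn_congr {J : Set ℝ} (hJ : IsOpen J) {γ γ' : ℝ → State N}
    (h : IsTrajectoryOn ε J γ) (he : EqOn γ γ' J) : IsTrajectoryOn ε J γ' := by
  intro t ht
  obtain ⟨h1, z, h2, h3, h4⟩ := h t ht
  have hev : ∀ᶠ s in 𝓝 t, γ s = γ' s := by
    filter_upwards [hJ.mem_nhds ht] with s hs using he hs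
  rw [he ht] at h1 h2 h4
  refine ⟨h1, z, h2, ?_, ?_⟩
  · filter_upwards [h3, nhdsWithin_le_nhds hev] with s hs hs'
    rw [← hs', hs]
  · filter_upwards [h4, nhdsWithin_le_nhds hev] with s hs hs'
    rw [← hs', hs]

theorem IsTrajectoryOn.mono {J J' : Set ℝ} {γ : ℝ → State N} (h : IsTrajectoryOn ε J γ)
    (hJ : J' ⊆ J) : IsTrajectoryOn ε J' γ := fun t ht => h t (hJ ht)

theorem IsTrajectoryOn.union {J J' : Set ℝ} {γ : ℝ → State N} (h : IsTrajectoryOn ε J γ)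
    (h' : IsTrajectoryOn ε J' γ) : IsTrajectoryOn ε (J ∪ J') γ :=
  fun t ht => ht.elim (h t) (h' t)

theorem tendsto_add_nhdsLT (t c : ℝ) : Tendsto (fun s => s + c) (𝓝[<] t) (𝓝[<] (t + c)) := by
  refine tendsto_nhdsWithin_iff.2 ⟨?_, ?_⟩
  · exact ((continuous_add_const c).tendsto t).mono_left nhdsWithin_le_nhds
  · filter_upwards [self_mem_nhdsWithin] with s hs using by simpa using hs

theorem tendsto_add_nhdsGE (t c : ℝ) : Tendsto (fun s => s + c) (𝓝[≥] t) (𝓝[≥] (t + c)) := by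
  refine tendsto_nhdsWithin_iff.2 ⟨?_, ?_⟩
  · exact ((continuous_add_const c).tendsto t).mono_left nhdsWithin_le_nhds
  · filter_upwards [self_mem_nhdsWithin] with s hs using by simpa using hs

theorem tendsto_add_nhdsGT (t c : ℝ) : Tendsto (fun s => s + c) (𝓝[>] t) (𝓝[>] (t + c)) := by
  refine tendsto_nhdsWithin_iff.2 ⟨?_, ?_⟩
  · exact ((continuous_add_const c).tendsto t).mono_left nhdsWithin_le_nhds
  · filter_upwards [self_mem_nhdsWithin] with s hs using by simpa using hs

theorem IsTrajectoryOn.shift {J : Set ℝ} {γ : ℝ → State N} (h : IsTrajectoryOn ε J γ) (c : ℝ) :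
    IsTrajectoryOn ε ((fun s => s + c) ⁻¹' J) (fun s => γ (s + c)) := by
  intro t ht
  obtain ⟨h1, z, h2, h3, h4⟩ := h (t + c) ht
  refine ⟨h1, z, h2, ?_, ?_⟩
  · filter_upwards [(tendsto_add_nhdsLT t c).eventually h3] with s hs
    rw [hs, add_sub_add_right_eq_sub]
  · filter_upwards [(tendsto_add_nhdsGE t c).eventually h4] with s hs
    rw [hs, add_sub_add_right_eq_sub]

/-- The definition constrains only the values of the trajectory. The state before a transition
inherits the positions of the state after it, and its noises from the free stretch just before. -/
theorem IsTrajectoryOn.data {J : Set ℝ} (hJ : IsOpen J) {γ : ℝ → State N}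
    (h : IsTrajectoryOn ε J γ) {t : ℝ} (ht : t ∈ J) :
    ∃ z ∈ contactPhaseSpace ε N, Transition ε z (γ t) ∧
      (∀ᶠ s in 𝓝[<] t, γ s = freeFlow (s - t) z) ∧
      ∀ᶠ s in 𝓝[≥] t, γ s = freeFlow (s - t) (γ t) := by
  obtain ⟨h1, z, h2, h3, h4⟩ := h t ht
  refine ⟨z, mem_contact_iff.2 ⟨?_, ?_⟩, h2, h3, h4⟩
  · exact (noOverlap_congr fun i => h2.pos_eq i).1 (mem_contact_iff.1 h1).1
  · obtain ⟨s, hs, hsJ⟩ := (h3.and (nhdsWithin_le_nhds (hJ.mem_nhds ht))).exists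
    intro i
    have := (mem_contact_iff.1 (h s hsJ).1).2 i
    rw [hs] at this
    exact this

theorem IsTrajectoryOn.adm (hε : 0 < ε) {J : Set ℝ} (hJ : IsOpen J) {γ : ℝ → State N}
    (h : IsTrajectoryOn ε J γ) {t : ℝ} (ht : t ∈ J) : Adm ε (γ t) := by
  obtain ⟨z, hz, h2, -⟩ := h.data hJ ht
  rcases (transition_iff hz).1 h2 with ⟨hn, he⟩ | ⟨s, hs, he⟩
  · rw [he]
    exact adm_of_forall_not_isShock hz hn
  · rw [he]
    exact hs.adm_jump hε

theorem Transition.normalVel_neg {z z' : State N} (h : Transition ε z z') {s : Shock N}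
    (hs : IsShock ε z s) : normalVel z s < 0 := by
  rcases h with ⟨h, _⟩ | ⟨s', _, hu, hn, _⟩
  · exact absurd hs (h s)
  · rwa [hu s hs]

/-- Shock times are isolated. -/
theorem IsTrajectoryOn.eventually_not_isShock (hε : 0 < ε) {J : Set ℝ} (hJ : IsOpen J)
    {γ : ℝ → State N} (h : IsTrajectoryOn ε J γ) {t : ℝ} (ht : t ∈ J) :
    ∀ᶠ s in 𝓝[≠] t, ∀ σ, ¬ IsShock ε (γ s) σ := by
  obtain ⟨z, hz, h2, h3, h4⟩ := h.data hJ ht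
  have hadm := h.adm hε hJ ht
  rw [← nhdsLT_sup_nhdsGT, eventually_sup]
  constructor
  · have h5 := eventually_free_left hε (mem_contact_iff.1 hz).1 (fun s hs => h2.normalVel_neg hs)
    have h6 := tendsto_add_nhdsLT t (-t)
    rw [add_neg_cancel] at h6
    filter_upwards [h3, h6.eventually h5] with s hs hs'
    rw [hs, sub_eq_add_neg]
    exact hs'.2
  · have h5 := eventually_free hε (mem_contact_iff.1 hadm.1).1 hadm.2.2
    have h6 := tendsto_add_nhdsGT t (-t)
    rw [add_neg_cancel] at h6
    filter_upwards [nhdsWithin_mono t Ioi_subset_Ici_self h4, h6.eventually h5] with s hs hs'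
    rw [hs, sub_eq_add_neg]
    exact hs'.2

theorem eventually_eq_of_sides {t : ℝ} {p : ℝ → Prop} (h1 : ∀ᶠ s in 𝓝[<] t, p s)
    (h2 : ∀ᶠ s in 𝓝[≥] t, p s) : ∀ᶠ s in 𝓝 t, p s := by
  rw [← nhdsLT_sup_nhdsGE]
  exact eventually_sup.2 ⟨h1, h2⟩

/-- A property of times that is locally either nowhere or everywhere true propagates. -/
theorem forall_of_locally {J : Set ℝ} (hJ : IsOpen J) (hc : J.OrdConnected) {p : ℝ → Prop}
    {m : ℝ} (hm : m ∈ J) (hpm : p m) (h1 : ∀ t ∈ J, p t → ∀ᶠ s in 𝓝 t, p s)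
    (h2 : ∀ t ∈ J, (∃ᶠ s in 𝓝 t, p s) → p t) : ∀ t ∈ J, p t := by
  have hsub := (isPreconnected_iff_ordConnected.2 hc).subset_of_closure_inter_subset
    (u := {t | t ∈ J ∧ p t}) ?_ ⟨m, hm, hm, hpm⟩ ?_
  · exact fun t ht => (hsub ht).2
  · rw [isOpen_iff_mem_nhds]
    rintro t ⟨ht, hpt⟩
    filter_upwards [hJ.mem_nhds ht, h1 t ht hpt] with s hs hs' using ⟨hs, hs'⟩
  · rintro t ⟨ht, htJ⟩
    refine ⟨htJ, h2 t htJ ?_⟩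
    exact (mem_closure_iff_frequently.1 ht).mono fun s hs => hs.2

/-- The set of times of agreement is open and closed. Across a shock, agreement passes to the left
by `Transition.unique_left` and to the right by `Transition.unique`; between shocks the free flow is
injective. -/
theorem IsTrajectoryOn.eqOn (hε : 0 < ε) {J : Set ℝ} (hJ : IsOpen J) (hc : J.OrdConnected)
    {γ₁ γ₂ : ℝ → State N} (h₁ : IsTrajectoryOn ε J γ₁) (h₂ : IsTrajectoryOn ε J γ₂) {m : ℝ}
    (hm : m ∈ J) (he : γ₁ m = γ₂ m) : EqOn γ₁ γ₂ J := by
  refine forall_of_locally hJ hc (p := fun t => γ₁ t = γ₂ t) hm he ?_ ?_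
  · intro t ht he
    obtain ⟨z₁, -, hT₁, hl₁, hr₁⟩ := h₁.data hJ ht
    obtain ⟨z₂, -, hT₂, hl₂, hr₂⟩ := h₂.data hJ ht
    refine eventually_eq_of_sides ?_ ?_
    · rw [he] at hT₁
      obtain rfl := hT₁.unique_left hε hT₂
      filter_upwards [hl₁, hl₂] with s hs₁ hs₂
      rw [hs₁, hs₂]
    · filter_upwards [hr₁, hr₂] with s hs₁ hs₂
      rw [hs₁, hs₂, he]
  · intro t ht hf
    obtain ⟨z₁, -, hT₁, hl₁, hr₁⟩ := h₁.data hJ ht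
    obtain ⟨z₂, -, hT₂, hl₂, hr₂⟩ := h₂.data hJ ht
    rw [← nhdsLT_sup_nhdsGE, frequently_sup] at hf
    rcases hf with hf | hf
    · obtain ⟨s, ⟨hs, hs₁⟩, hs₂⟩ := ((hf.and_eventually hl₁).and_eventually hl₂).exists
      rw [hs₁, hs₂] at hs
      rw [freeFlow_injective _ hs] at hT₁
      exact hT₁.unique hT₂
    · obtain ⟨s, ⟨hs, hs₁⟩, hs₂⟩ := ((hf.and_eventually hr₁).and_eventually hr₂).exists
      rw [hs₁, hs₂] at hs
      exact freeFlow_injective _ hs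

theorem IsTrajectoryOn.eventually_free_of_not_isShock {J : Set ℝ} (hJ : IsOpen J)
    {γ : ℝ → State N} (h : IsTrajectoryOn ε J γ) {t : ℝ} (ht : t ∈ J)
    (hn : ∀ σ, ¬ IsShock ε (γ t) σ) : ∀ᶠ s in 𝓝 t, γ s = freeFlow (s - t) (γ t) := by
  obtain ⟨z, -, hT, hl, hr⟩ := h.data hJ ht
  refine eventually_eq_of_sides ?_ hr
  have hz : γ t = z := by
    have hp := hT.pos_eq
    rcases hT with ⟨_, he⟩ | ⟨s, hs, _⟩
    · exact he
    · exact absurd ((isShock_congr hp s).2 hs) (hn s)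
  rwa [hz]

theorem IsTrajectoryOn.eq_freeFlow {J : Set ℝ} (hJ : IsOpen J) (hc : J.OrdConnected)
    {γ : ℝ → State N} (h : IsTrajectoryOn ε J γ) (hn : ∀ t ∈ J, ∀ σ, ¬ IsShock ε (γ t) σ) {m : ℝ}
    (hm : m ∈ J) : ∀ t ∈ J, γ t = freeFlow (t - m) (γ m) := by
  refine forall_of_locally hJ hc hm (by simp) ?_ ?_
  · intro t ht he
    filter_upwards [h.eventually_free_of_not_isShock hJ ht (hn t ht)] with s hs
    rw [hs, he, freeFlow_freeFlow]
    congr 1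
    ring
  · intro t ht hf
    obtain ⟨s, hs, hs'⟩ :=
      (hf.and_eventually (h.eventually_free_of_not_isShock hJ ht (hn t ht))).exists
    apply freeFlow_injective (s - t)
    rw [← hs', hs, freeFlow_freeFlow]
    congr 1
    ring

/-! ### Local existence -/

/-- Free flow towards `z₀` before time `0`, and from `z` afterwards. -/
def curve (z₀ z : State N) (s : ℝ) : State N := if s < 0 then freeFlow s z₀ else freeFlow s z

/-- An overlap cannot begin without a contact: the set of overlap-free times is closed, it contains
small positive times, and it is open because no shock occurs. -/
theorem noOverlap_of_not_isShock (hε : 0 < ε) {z : State N} (hz : Adm ε z) {δ : ℝ}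
    (hn : ∀ s ∈ Ioo 0 δ, ∀ σ, ¬ IsShock ε (freeFlow s z) σ) :
    ∀ s ∈ Ioo 0 δ, NoOverlap ε (freeFlow s z) := by
  intro s₀ hs₀
  have hδ : 0 < δ := hs₀.1.trans hs₀.2
  have hev := eventually_free hε (mem_contact_iff.1 hz.1).1 hz.2.2
  obtain ⟨m, hm, hmδ⟩ := (hev.and (Ioo_mem_nhdsGT hδ)).exists
  refine forall_of_locally isOpen_Ioo ordConnected_Ioo (p := fun s => NoOverlap ε (freeFlow s z))
    hmδ hm.1 ?_ ?_ s₀ hs₀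
  · intro t ht hno
    have hr := eventually_free hε hno (fun s hs => absurd hs (hn t ht s))
    have hl := eventually_free_left hε hno (fun s hs => absurd hs (hn t ht s))
    have h6 := tendsto_add_nhdsLT t (-t)
    have h7 := tendsto_add_nhdsGT t (-t)
    rw [add_neg_cancel] at h6 h7
    refine eventually_eq_of_sides ?_ ?_
    · filter_upwards [h6.eventually hl] with s hs
      rw [freeFlow_freeFlow] at hs
      simpa using hs.1
    · rw [← Ioi_insert, nhdsWithin_insert, eventually_sup]
      refine ⟨by simpa using hno, ?_⟩
      filter_upwards [h7.eventually hr] with s hs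
      rw [freeFlow_freeFlow] at hs
      simpa using hs.1
  · intro t ht hf
    have : IsClosed {s | NoOverlap ε (freeFlow s z)} :=
      isClosed_noOverlap.preimage (continuous_freeFlow_left z)
    exact this.mem_of_frequently_of_tendsto hf tendsto_id

/-- Local existence. On the right the curve is good as long as free flow meets no shock; on the left
only some short time η is obtained. -/
theorem isTrajectoryOn_curve (hε : 0 < ε) {z₀ z : State N} (hz₀ : z₀ ∈ contactPhaseSpace ε N)
    (hT : Transition ε z₀ z) (hz : Adm ε z) {δ : ℝ}
    (hn : ∀ s ∈ Ioo 0 δ, ∀ σ, ¬ IsShock ε (freeFlow s z) σ) :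
    ∃ η > 0, IsTrajectoryOn ε (Ioo (-η) δ) (curve z₀ z) := by
  have hl := eventually_free_left hε (mem_contact_iff.1 hz₀).1 (fun s hs => hT.normalVel_neg hs)
  obtain ⟨c, hc, hcs⟩ := mem_nhdsLT_iff_exists_Ioo_subset.1 hl
  have hc0 : c < 0 := hc
  refine ⟨-c, by linarith, ?_⟩
  rw [neg_neg]
  have hno := noOverlap_of_not_isShock hε hz hn
  intro t ht
  rcases lt_trichotomy t 0 with h0 | rfl | h0
  · have ht' := hcs ⟨ht.1, h0⟩
    have hct : curve z₀ z t = freeFlow t z₀ := by simp [curve, h0]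
    have hmem : freeFlow t z₀ ∈ contactPhaseSpace ε N :=
      mem_contact_iff.2 ⟨ht'.1, (mem_contact_iff.1 hz₀).2⟩
    have hev : ∀ᶠ s in 𝓝 t, curve z₀ z s = freeFlow (s - t) (freeFlow t z₀) := by
      filter_upwards [gt_mem_nhds h0] with s hs
      simp [curve, hs, freeFlow_freeFlow]
    rw [hct]
    exact ⟨hmem, freeFlow t z₀, Or.inl ⟨ht'.2, rfl⟩, nhdsWithin_le_nhds hev,
      nhdsWithin_le_nhds hev⟩
  · have hct : curve z₀ z 0 = z := by simp [curve]
    rw [hct]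
    refine ⟨hz.1, z₀, hT, ?_, ?_⟩
    · filter_upwards [self_mem_nhdsWithin] with s hs
      have hs : s < 0 := hs
      simp [curve, hs]
    · filter_upwards [self_mem_nhdsWithin] with s hs
      have hs : ¬ s < 0 := not_lt.2 hs
      simp [curve, hs]
  · have hct : curve z₀ z t = freeFlow t z := by simp [curve, h0.le]
    have hmem : freeFlow t z ∈ contactPhaseSpace ε N :=
      mem_contact_iff.2 ⟨hno t ⟨h0, ht.2⟩, (mem_contact_iff.1 hz.1).2⟩
    have hev : ∀ᶠ s in 𝓝 t, curve z₀ z s = freeFlow (s - t) (freeFlow t z) := by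
      filter_upwards [lt_mem_nhds h0] with s hs
      have hs : ¬ s < 0 := not_lt.2 hs.le
      simp [curve, hs, freeFlow_freeFlow]
    rw [hct]
    exact ⟨hmem, freeFlow t z, Or.inl ⟨hn t ⟨h0, ht.2⟩, rfl⟩, nhdsWithin_le_nhds hev,
      nhdsWithin_le_nhds hev⟩

theorem Adm.exists_free (hε : 0 < ε) {z : State N} (hz : Adm ε z) :
    ∃ δ > 0, ∀ s ∈ Ioo 0 δ, ∀ σ, ¬ IsShock ε (freeFlow s z) σ := by
  have hr := eventually_free hε (mem_contact_iff.1 hz.1).1 hz.2.2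
  obtain ⟨δ, hδ, hs⟩ := mem_nhdsGT_iff_exists_Ioo_subset.1 hr
  exact ⟨δ, hδ, fun s h => (hs h).2⟩

/-! ### Maximal trajectories -/

/-- The trajectory issued from `z` exists at time `t`. -/
def Lives (ε : ℝ) (z : State N) (t : ℝ) : Prop :=
  ∃ J : Set ℝ, IsOpen J ∧ J.OrdConnected ∧ 0 ∈ J ∧ t ∈ J ∧
    ∃ γ : ℝ → State N, IsTrajectoryOn ε J γ ∧ γ 0 = z

/-- The maximal interval of existence. -/
def life (ε : ℝ) (z : State N) : Set ℝ := {t | Lives ε z t}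

open Classical in
/-- The maximal trajectory issued from `z`. -/
def orbit (ε : ℝ) (z : State N) (t : ℝ) : State N :=
  if h : Lives ε z t then h.choose_spec.2.2.2.2.choose t else z

theorem subset_life {J : Set ℝ} (hJ : IsOpen J) (hc : J.OrdConnected) (h0 : 0 ∈ J)
    {γ : ℝ → State N} (h : IsTrajectoryOn ε J γ) : J ⊆ life ε (γ 0) :=
  fun _ ht => ⟨J, hJ, hc, h0, ht, γ, h, rfl⟩

/-- The choice made in `orbit`, separately for each time, is harmless: any two trajectories through
the same state agree on the intersection of their intervals. -/
theorem orbit_eq (hε : 0 < ε) {J : Set ℝ} (hJ : IsOpen J) (hc : J.OrdConnected) (h0 : 0 ∈ J)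
    {γ : ℝ → State N} (h : IsTrajectoryOn ε J γ) : EqOn (orbit ε (γ 0)) γ J := by
  intro t ht
  have hl : Lives ε (γ 0) t := subset_life hJ hc h0 h ht
  simp only [orbit, hl, dif_pos]
  obtain ⟨h1, h2, h3, h4, h5⟩ := hl.choose_spec
  obtain ⟨h6, h7⟩ := h5.choose_spec
  exact (h6.mono inter_subset_left).eqOn hε (h1.inter hJ) (h2.inter hc)
    (h.mono inter_subset_right) ⟨h3, h0⟩ h7 ⟨h4, ht⟩

theorem isOpen_life (z : State N) : IsOpen (life ε z) := by
  rw [isOpen_iff_mem_nhds]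
  rintro t ⟨J, hJ, hc, h0, ht, γ, h, rfl⟩
  exact mem_of_superset (hJ.mem_nhds ht) (subset_life hJ hc h0 h)

theorem ordConnected_life (z : State N) : (life ε z).OrdConnected := by
  rw [← isPreconnected_iff_ordConnected]
  refine isPreconnected_of_forall 0 ?_
  rintro t ⟨J, hJ, hc, h0, ht, γ, h, rfl⟩
  exact ⟨J, subset_life hJ hc h0 h, h0, ht, isPreconnected_iff_ordConnected.2 hc⟩

theorem isTrajectoryOn_orbit (hε : 0 < ε) (z : State N) :
    IsTrajectoryOn ε (life ε z) (orbit ε z) := by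
  rintro t ⟨J, hJ, hc, h0, ht, γ, h, rfl⟩
  exact isTrajectoryOn_congr hJ h (orbit_eq hε hJ hc h0 h).symm t ht

theorem zero_mem_life_of_mem {z : State N} {t : ℝ} (h : t ∈ life ε z) : (0 : ℝ) ∈ life ε z := by
  obtain ⟨J, hJ, hc, h0, ht, γ, h, rfl⟩ := h
  exact subset_life hJ hc h0 h h0

@[simp] theorem orbit_zero (z : State N) : orbit ε z 0 = z := by
  unfold orbit
  split_ifs with h
  · exact h.choose_spec.2.2.2.2.choose_spec.2
  · rfl

theorem adm_orbit (hε : 0 < ε) {z : State N} {t : ℝ} (h : t ∈ life ε z) : Adm ε (orbit ε z t) :=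
  (isTrajectoryOn_orbit hε z).adm hε (isOpen_life z) h

theorem sub_mem_life (hε : 0 < ε) {z : State N} {t r : ℝ} (ht : t ∈ life ε z) (hr : r ∈ life ε z) :
    r - t ∈ life ε (orbit ε z t) ∧ orbit ε (orbit ε z t) (r - t) = orbit ε z r := by
  have h := (isTrajectoryOn_orbit hε z).shift t
  have hJ : IsOpen ((fun s => s + t) ⁻¹' life ε z) :=
    (isOpen_life z).preimage (continuous_add_const t)
  have hc : ((fun s => s + t) ⁻¹' life ε z).OrdConnected :=
    (ordConnected_life z).preimage_mono (fun _ _ h => by gcongr)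
  have h0 : (0 : ℝ) ∈ (fun s => s + t) ⁻¹' life ε z := by simpa using ht
  have hr' : r - t ∈ (fun s => s + t) ⁻¹' life ε z := by simpa using hr
  have h1 := subset_life hJ hc h0 h hr'
  have h2 := orbit_eq hε hJ hc h0 h hr'
  simp only [zero_add, sub_add_cancel] at h1 h2
  exact ⟨h1, h2⟩

/-- The trajectory of `orbit ε z t`, shifted in time, agrees with that of `z` where both exist.
Gluing gives a trajectory on the union, which is an interval because both pieces contain `t`. -/
theorem add_mem_life (hε : 0 < ε) {z : State N} {t s : ℝ} (ht : t ∈ life ε z)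
    (hs : s ∈ life ε (orbit ε z t)) :
    t + s ∈ life ε z ∧ orbit ε z (t + s) = orbit ε (orbit ε z t) s := by
  classical
  set y := orbit ε z t
  set J₁ := life ε z
  set J₂ := (fun r => r + -t) ⁻¹' life ε y
  have hJ₁ : IsOpen J₁ := isOpen_life z
  have hJ₂ : IsOpen J₂ := (isOpen_life y).preimage (continuous_add_const (-t))
  have hc₁ : J₁.OrdConnected := ordConnected_life z
  have hc₂ : J₂.OrdConnected := (ordConnected_life y).preimage_mono (fun _ _ h => by gcongr)
  have hγ₁ : IsTrajectoryOn ε J₁ (orbit ε z) := isTrajectoryOn_orbit hε z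
  have hγ₂ : IsTrajectoryOn ε J₂ (fun r => orbit ε y (r + -t)) :=
    (isTrajectoryOn_orbit hε y).shift (-t)
  have ht₂ : t ∈ J₂ := by
    simpa [J₂] using zero_mem_life_of_mem hs
  have heq : EqOn (orbit ε z) (fun r => orbit ε y (r + -t)) (J₁ ∩ J₂) :=
    (hγ₁.mono inter_subset_left).eqOn hε (hJ₁.inter hJ₂) (hc₁.inter hc₂)
      (hγ₂.mono inter_subset_right) ⟨ht, ht₂⟩ (by simp [y])
  set γ : ℝ → State N := fun r => if r ∈ J₁ then orbit ε z r else orbit ε y (r + -t)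
  have he₁ : EqOn (orbit ε z) γ J₁ := fun r hr => by simp [γ, hr]
  have he₂ : EqOn (fun r => orbit ε y (r + -t)) γ J₂ := fun r hr => by
    by_cases h : r ∈ J₁
    · simpa [γ, h] using (heq ⟨h, hr⟩).symm
    · simp [γ, h]
  have hγ : IsTrajectoryOn ε (J₁ ∪ J₂) γ :=
    (isTrajectoryOn_congr hJ₁ hγ₁ he₁).union (isTrajectoryOn_congr hJ₂ hγ₂ he₂)
  have h0 : (0 : ℝ) ∈ J₁ := zero_mem_life_of_mem ht
  have hc : (J₁ ∪ J₂).OrdConnected := isPreconnected_iff_ordConnected.1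
    (IsPreconnected.union t ht ht₂ (isPreconnected_iff_ordConnected.2 hc₁)
      (isPreconnected_iff_ordConnected.2 hc₂))
  have hγ0 : γ 0 = z := by rw [← he₁ h0]; simp
  have hmem : t + s ∈ J₁ ∪ J₂ := Or.inr (by simpa [J₂] using hs)
  have h1 := subset_life (hJ₁.union hJ₂) hc (Or.inl h0) hγ hmem
  have h2 := orbit_eq hε (hJ₁.union hJ₂) hc (Or.inl h0) hγ hmem
  rw [hγ0] at h1 h2
  refine ⟨h1, ?_⟩
  rw [h2, ← he₂ (show t + s ∈ J₂ by simpa [J₂] using hs)]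
  simp

theorem neg_mem_life (hε : 0 < ε) {z : State N} {t : ℝ} (ht : t ∈ life ε z) :
    -t ∈ life ε (orbit ε z t) ∧ orbit ε (orbit ε z t) (-t) = z := by
  simpa using sub_mem_life hε ht (zero_mem_life_of_mem ht)

end

/-! ### Continuation of trajectories and decomposition into steps -/

section

variable {ε : ℝ}

/-! ### Extension of trajectories -/

theorem zero_mem_life (hε : 0 < ε) {z : State N} (hz : Adm ε z) : (0 : ℝ) ∈ life ε z := by
  obtain ⟨z₀, hz₀, hT⟩ := hz.exists_transition hε
  obtain ⟨δ, hδ, hn⟩ := hz.exists_free hε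
  obtain ⟨η, hη, h⟩ := isTrajectoryOn_curve hε hz₀ hT hz hn
  have h0 : (0 : ℝ) ∈ Ioo (-η) δ := ⟨by linarith, hδ⟩
  have := subset_life isOpen_Ioo ordConnected_Ioo h0 h h0
  simpa [curve] using this

/-- A trajectory that flows freely towards a state from which a transition is possible can be
continued. -/
theorem mem_life_of_transition (hε : 0 < ε) {z z₀ z₁ : State N} {t : ℝ}
    (hz₀ : z₀ ∈ contactPhaseSpace ε N) (hT : Transition ε z₀ z₁) (hz₁ : Adm ε z₁)
    (h : ∃ᶠ s in 𝓝[<] (0 : ℝ), t + s ∈ life ε z ∧ orbit ε z (t + s) = freeFlow s z₀) :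
    t ∈ life ε z ∧ orbit ε z t = z₁ := by
  obtain ⟨δ, hδ, hn⟩ := hz₁.exists_free hε
  obtain ⟨η, hη, hc⟩ := isTrajectoryOn_curve hε hz₀ hT hz₁ hn
  have h0 : (0 : ℝ) ∈ Ioo (-η) δ := ⟨by linarith, hδ⟩
  obtain ⟨s, ⟨hs, hs'⟩, hsη⟩ :=
    (h.and_eventually (Ioo_mem_nhdsLT (show -η < 0 by linarith))).exists
  have hsm : s ∈ Ioo (-η) δ := ⟨hsη.1, hsη.2.trans hδ⟩
  have h1 := subset_life isOpen_Ioo ordConnected_Ioo h0 hc hsm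
  have h2 := orbit_eq hε isOpen_Ioo ordConnected_Ioo h0 hc hsm
  have e0 : curve z₀ z₁ 0 = z₁ := by simp [curve]
  have es : curve z₀ z₁ s = freeFlow s z₀ := by simp [curve, hsη.2]
  rw [e0] at h1 h2
  rw [es] at h2
  -- The orbit of `z` at time `t + s` and the local curve at time `s` are at the same state; from
  -- there the curve leads to `z₁` within the time `-s`.
  have h3 := neg_mem_life hε h1
  rw [h2, ← hs'] at h3
  have h4 := add_mem_life hε hs h3.1
  rw [h3.2] at h4
  simpa using h4

/-- The backward analogue of `mem_life_of_transition`. -/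
theorem mem_life_of_adm (hε : 0 < ε) {z z₁ : State N} {t : ℝ} (hz₁ : Adm ε z₁)
    (h : ∃ᶠ s in 𝓝[>] (0 : ℝ), t + s ∈ life ε z ∧ orbit ε z (t + s) = freeFlow s z₁) :
    t ∈ life ε z ∧ orbit ε z t = z₁ := by
  obtain ⟨z₀, hz₀, hT⟩ := hz₁.exists_transition hε
  obtain ⟨δ, hδ, hn⟩ := hz₁.exists_free hε
  obtain ⟨η, hη, hc⟩ := isTrajectoryOn_curve hε hz₀ hT hz₁ hn
  have h0 : (0 : ℝ) ∈ Ioo (-η) δ := ⟨by linarith, hδ⟩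
  obtain ⟨s, ⟨hs, hs'⟩, hsη⟩ := (h.and_eventually (Ioo_mem_nhdsGT hδ)).exists
  have hsm : s ∈ Ioo (-η) δ := ⟨by linarith [hsη.1], hsη.2⟩
  have h1 := subset_life isOpen_Ioo ordConnected_Ioo h0 hc hsm
  have h2 := orbit_eq hε isOpen_Ioo ordConnected_Ioo h0 hc hsm
  have e0 : curve z₀ z₁ 0 = z₁ := by simp [curve]
  have es : curve z₀ z₁ s = freeFlow s z₁ := by simp [curve, hsη.1.le]
  rw [e0] at h1 h2
  rw [es] at h2
  have h3 := neg_mem_life hε h1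
  rw [h2, ← hs'] at h3
  have h4 := add_mem_life hε hs h3.1
  rw [h3.2] at h4
  simpa using h4

theorem finite_shocks_near_right {a b : ℝ} (hab : a < b) {γ : ℝ → State N}
    (h : ¬ HasInfinitelyManyShocks ε γ a b) :
    ∃ c ∈ Ico a b, ∀ t ∈ Ioo c b, ∀ σ, ¬ IsShock ε (γ t) σ := by
  rw [HasInfinitelyManyShocks, not_infinite] at h
  have : ∀ᶠ t in 𝓝[<] b, ∀ σ, ¬ IsShock ε (γ t) σ := by
    have h1 : ∀ᶠ t in 𝓝[<] b, t ∉ {t | t ∈ Ioo a b ∧ ∃ s, IsShock ε (γ t) s} :=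
      nhdsWithin_le_nhds (h.isClosed.isOpen_compl.mem_nhds fun hb => lt_irrefl _ hb.1.2)
    filter_upwards [h1, Ioo_mem_nhdsLT hab] with t ht ht' σ hσ using ht ⟨ht', σ, hσ⟩
  obtain ⟨c, hc, hs⟩ := (mem_nhdsLT_iff_exists_mem_Ico_Ioo_subset hab).1 this
  exact ⟨c, hc, fun t ht => hs ht⟩

theorem finite_shocks_near_left {a b : ℝ} (hab : a < b) {γ : ℝ → State N}
    (h : ¬ HasInfinitelyManyShocks ε γ a b) :
    ∃ c ∈ Ioc a b, ∀ t ∈ Ioo a c, ∀ σ, ¬ IsShock ε (γ t) σ := by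
  rw [HasInfinitelyManyShocks, not_infinite] at h
  have : ∀ᶠ t in 𝓝[>] a, ∀ σ, ¬ IsShock ε (γ t) σ := by
    have h1 : ∀ᶠ t in 𝓝[>] a, t ∉ {t | t ∈ Ioo a b ∧ ∃ s, IsShock ε (γ t) s} :=
      nhdsWithin_le_nhds (h.isClosed.isOpen_compl.mem_nhds fun hb => lt_irrefl _ hb.1.1)
    filter_upwards [h1, Ioo_mem_nhdsGT hab] with t ht ht' σ hσ using ht ⟨ht', σ, hσ⟩
  obtain ⟨c, hc, hs⟩ := (mem_nhdsGT_iff_exists_mem_Ioc_Ioo_subset hab).1 this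
  exact ⟨c, hc, fun t ht => hs ht⟩

/-- After the last shock the motion is free, so it has a limit state at `b`, which is overlap-free
by closedness. A shock there is not outgoing, because the state is reached without overlap; it is
not grazing and not multiple by hypothesis. So a transition is possible and the trajectory
continues. -/
theorem mem_life_right (hε : 0 < ε) {z : State N} {a b : ℝ} (hab : a < b)
    (hJ : Ioo a b ⊆ life ε z) (h1 : ¬ EndsBadly ε (orbit ε z) (𝓝[<] b) b)
    (h2 : ¬ HasInfinitelyManyShocks ε (orbit ε z) a b) : b ∈ life ε z := by
  obtain ⟨c, hc, hn⟩ := finite_shocks_near_right hab h2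
  have hsub : Ioo c b ⊆ Ioo a b := Ioo_subset_Ioo_left hc.1
  have htraj := (isTrajectoryOn_orbit hε z).mono (hsub.trans hJ)
  obtain ⟨m, hm⟩ := nonempty_Ioo.2 hc.2
  have hfree := htraj.eq_freeFlow isOpen_Ioo ordConnected_Ioo hn hm
  set y := orbit ε z m
  set z₀ := freeFlow (b - m) y
  have hfree' : ∀ t ∈ Ioo c b, orbit ε z t = freeFlow (t - b) z₀ := by
    intro t ht
    rw [hfree t ht, freeFlow_freeFlow]
    congr 1
    ring
  have hev : ∀ᶠ s in 𝓝[<] (0 : ℝ), b + s ∈ Ioo c b := by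
    filter_upwards [Ioo_mem_nhdsLT (show c - b < 0 by linarith [hc.2])] with s hs
    exact ⟨by linarith [hs.1], by linarith [hs.2]⟩
  have hev' : ∀ᶠ s in 𝓝[<] (0 : ℝ), NoOverlap ε (freeFlow s z₀) := by
    filter_upwards [hev] with s hs
    have := (mem_contact_iff.1 (adm_orbit hε (hJ (hsub hs))).1).1
    rwa [hfree' _ hs, add_sub_cancel_left] at this
  have hz₀ : z₀ ∈ contactPhaseSpace ε N := by
    refine mem_contact_iff.2 ⟨?_, (mem_contact_iff.1 (adm_orbit hε (hJ (hsub hm))).1).2⟩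
    have hcl : IsClosed {s | NoOverlap ε (freeFlow s z₀)} :=
      isClosed_noOverlap.preimage (continuous_freeFlow_left z₀)
    have := hcl.mem_of_frequently_of_tendsto hev'.frequently
      (tendsto_id.mono_left nhdsWithin_le_nhds)
    simpa using this
  have hbad : ¬ (HasMultipleShocks ε z₀ ∨ HasGrazingShock ε z₀) := by
    intro hb
    refine h1 ⟨z₀, ?_, hb⟩
    filter_upwards [Ioo_mem_nhdsLT hc.2] with t ht using hfree' t ht
  rw [not_or] at hbad
  have hneg : ∀ s, IsShock ε z₀ s → normalVel z₀ s < 0 := fun s hs =>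
    lt_of_le_of_ne (normalVel_nonpos_of_frequently hε hev'.frequently hs)
      fun h => hbad.2 ⟨s, hs, h⟩
  have hfin : ∃ z₁, Transition ε z₀ z₁ ∧ Adm ε z₁ := by
    by_cases hs : ∃ s, IsShock ε z₀ s
    · obtain ⟨s, hs⟩ := hs
      have hp : Pre ε s z₀ := ⟨hz₀, hs, fun s' hs' => eq_of_not_hasMultipleShocks hbad.1 hs hs',
        hneg s hs⟩
      exact ⟨jump s z₀, (transition_iff hz₀).2 (Or.inr ⟨s, hp, rfl⟩), hp.adm_jump hε⟩
    · push Not at hs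
      exact ⟨z₀, Or.inl ⟨hs, rfl⟩, adm_of_forall_not_isShock hz₀ hs⟩
  obtain ⟨z₁, hT, hz₁⟩ := hfin
  refine (mem_life_of_transition hε hz₀ hT hz₁ (Eventually.frequently ?_)).1
  filter_upwards [hev] with s hs
  refine ⟨hJ (hsub hs), ?_⟩
  rw [hfree' _ hs, add_sub_cancel_left]

/-- At the left end the limit is a state after the transition. Its shock, if any, is strictly
outgoing, so the state is admissible and `unjump` provides the past. -/
theorem mem_life_left (hε : 0 < ε) {z : State N} {a b : ℝ} (hab : a < b)
    (hJ : Ioo a b ⊆ life ε z) (h1 : ¬ EndsBadly ε (orbit ε z) (𝓝[>] a) a)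
    (h2 : ¬ HasInfinitelyManyShocks ε (orbit ε z) a b) : a ∈ life ε z := by
  obtain ⟨c, hc, hn⟩ := finite_shocks_near_left hab h2
  have hsub : Ioo a c ⊆ Ioo a b := Ioo_subset_Ioo_right hc.2
  have htraj := (isTrajectoryOn_orbit hε z).mono (hsub.trans hJ)
  obtain ⟨m, hm⟩ := nonempty_Ioo.2 hc.1
  have hfree := htraj.eq_freeFlow isOpen_Ioo ordConnected_Ioo hn hm
  set y := orbit ε z m
  set z₀ := freeFlow (a - m) y
  have hfree' : ∀ t ∈ Ioo a c, orbit ε z t = freeFlow (t - a) z₀ := by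
    intro t ht
    rw [hfree t ht, freeFlow_freeFlow]
    congr 1
    ring
  have hev : ∀ᶠ s in 𝓝[>] (0 : ℝ), a + s ∈ Ioo a c := by
    filter_upwards [Ioo_mem_nhdsGT (show 0 < c - a by linarith [hc.1])] with s hs
    exact ⟨by linarith [hs.1], by linarith [hs.2]⟩
  have hev' : ∀ᶠ s in 𝓝[>] (0 : ℝ), NoOverlap ε (freeFlow s z₀) := by
    filter_upwards [hev] with s hs
    have := (mem_contact_iff.1 (adm_orbit hε (hJ (hsub hs))).1).1
    rwa [hfree' _ hs, add_sub_cancel_left] at this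
  have hz₀ : z₀ ∈ contactPhaseSpace ε N := by
    refine mem_contact_iff.2 ⟨?_, (mem_contact_iff.1 (adm_orbit hε (hJ (hsub hm))).1).2⟩
    have hcl : IsClosed {s | NoOverlap ε (freeFlow s z₀)} :=
      isClosed_noOverlap.preimage (continuous_freeFlow_left z₀)
    have := hcl.mem_of_frequently_of_tendsto hev'.frequently
      (tendsto_id.mono_left nhdsWithin_le_nhds)
    simpa using this
  have hbad : ¬ (HasMultipleShocks ε z₀ ∨ HasGrazingShock ε z₀) := by
    intro hb
    refine h1 ⟨z₀, ?_, hb⟩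
    filter_upwards [Ioo_mem_nhdsGT hc.1] with t ht using hfree' t ht
  rw [not_or] at hbad
  have hz₀' : Adm ε z₀ := ⟨hz₀, hbad.1, fun s hs =>
    lt_of_le_of_ne (normalVel_nonneg_of_frequently hε hev'.frequently hs)
      fun h => hbad.2 ⟨s, hs, h.symm⟩⟩
  refine (mem_life_of_adm hε hz₀' (Eventually.frequently ?_)).1
  filter_upwards [hev] with s hs
  refine ⟨hJ (hsub hs), ?_⟩
  rw [hfree' _ hs, add_sub_cancel_left]

/-! ### Global trajectories -/

theorem orbit_eqOn_of_Ioo (hε : 0 < ε) {z : State N} {a b : ℝ} (ha : a < 0) (hb : 0 < b)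
    {γ : ℝ → State N} (h : IsTrajectoryOn ε (Ioo a b) γ) (h0 : γ 0 = z) :
    EqOn (orbit ε z) γ (Ioo a b) := by
  subst h0
  exact orbit_eq hε isOpen_Ioo ordConnected_Ioo ⟨ha, hb⟩ h

/-- A finite end point of the maximal interval would belong to it by the continuation lemmas,
contradicting openness. -/
theorem life_eq_univ (hε : 0 < ε) {z : State N} (hz : z ∈ phaseSpace ε N \ badSet ε N) :
    life ε z = univ := by
  obtain ⟨hz, hgood⟩ := hz
  have hgood' : ¬ (HasMultipleShocks ε z ∨ (∃ s, IsShock ε z s ∧ normalVel z s ≤ 0) ∨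
      ∃ (a b : ℝ) (γ : ℝ → State N), a < 0 ∧ 0 < b ∧ IsTrajectoryOn ε (Ioo a b) γ ∧ γ 0 = z ∧
        (EndsBadly ε γ (𝓝[<] b) b ∨ EndsBadly ε γ (𝓝[>] a) a ∨
          HasInfinitelyManyShocks ε γ a b)) := fun h => hgood ⟨hz, h⟩
  push Not at hgood'
  obtain ⟨h1, h2, h3⟩ := hgood'
  have hadm : Adm ε z := ⟨⟨hz.1, fun i j hij u hu => (hz.2.1 i j hij u hu).le, hz.2.2⟩, h1, h2⟩
  have h0 := zero_mem_life hε hadm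
  obtain ⟨l, r, ⟨hl, hr⟩, hlr⟩ := mem_nhds_iff_exists_Ioo_subset.1 ((isOpen_life z).mem_nhds h0)
  have hoc := ordConnected_life (ε := ε) z
  have htraj := isTrajectoryOn_orbit hε z
  have hup : ∀ t, 0 < t → t ∈ life ε z := by
    by_contra! hc
    obtain ⟨t, ht0, ht⟩ := hc
    have hbdd : BddAbove (life ε z) := ⟨t, fun s hs => by
      by_contra! hlt
      exact ht (hoc.out h0 hs ⟨ht0.le, hlt.le⟩)⟩
    set b := sSup (life ε z)
    -- The interval starts at some `l < 0` because the definition of bad data speaks of trajectories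
    -- on intervals around 0.
    have hsub : Ioo l b ⊆ life ε z := by
      intro s hs
      by_cases hsr : s < r
      · exact hlr ⟨hs.1, hsr⟩
      · obtain ⟨s', hs', hlt⟩ := exists_lt_of_lt_csSup ⟨0, h0⟩ hs.2
        exact hoc.out h0 hs' ⟨by linarith, hlt.le⟩
    have hrb : r ≤ b := by
      refine le_of_forall_lt fun s hs => ?_
      obtain ⟨s', hs1, hs2⟩ := exists_between (max_lt hs hr)
      have := le_csSup hbdd (hlr ⟨by linarith [le_max_right s 0], hs2⟩)
      exact ((le_max_left _ _).trans_lt hs1).trans_le this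
    have h5 := h3 l b (orbit ε z) hl (hr.trans_le hrb) (htraj.mono hsub) (orbit_zero z)
    have hb := mem_life_right hε (by linarith) hsub h5.1 h5.2.2
    obtain ⟨l', r', ⟨hl', hr'⟩, hlr'⟩ :=
      mem_nhds_iff_exists_Ioo_subset.1 ((isOpen_life z).mem_nhds hb)
    obtain ⟨s, hs⟩ := exists_between hr'
    exact absurd (le_csSup hbdd (hlr' ⟨hl'.trans hs.1, hs.2⟩)) (not_le.2 hs.1)
  have hdown : ∀ t, t < 0 → t ∈ life ε z := by
    by_contra! hc
    obtain ⟨t, ht0, ht⟩ := hc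
    have hbdd : BddBelow (life ε z) := ⟨t, fun s hs => by
      by_contra! hlt
      exact ht (hoc.out hs h0 ⟨hlt.le, ht0.le⟩)⟩
    set a := sInf (life ε z)
    have hsub : Ioo a r ⊆ life ε z := by
      intro s hs
      by_cases hsl : l < s
      · exact hlr ⟨hsl, hs.2⟩
      · obtain ⟨s', hs', hlt⟩ := exists_lt_of_csInf_lt ⟨0, h0⟩ hs.1
        exact hoc.out hs' h0 ⟨hlt.le, by linarith⟩
    have hal : a ≤ l := by
      refine le_of_forall_gt fun s hs => ?_
      obtain ⟨s', hs1, hs2⟩ := exists_between (lt_min hs hl)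
      have := csInf_le hbdd (hlr ⟨hs1, by linarith [min_le_right s 0]⟩)
      exact this.trans_lt (hs2.trans_le (min_le_left _ _))
    have h5 := h3 a r (orbit ε z) (hal.trans_lt hl) hr (htraj.mono hsub) (orbit_zero z)
    have ha := mem_life_left hε (by linarith) hsub h5.2.1 h5.2.2
    obtain ⟨l', r', ⟨hl', hr'⟩, hlr'⟩ :=
      mem_nhds_iff_exists_Ioo_subset.1 ((isOpen_life z).mem_nhds ha)
    obtain ⟨s, hs⟩ := exists_between hl'
    exact absurd (csInf_le hbdd (hlr' ⟨hs.1, hs.2.trans hr'⟩)) (not_le.2 hs.2)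
  rw [eq_univ_iff_forall]
  intro t
  rcases lt_trichotomy t 0 with h | rfl | h
  exacts [hdown t h, h0, hup t h]

/-- A bad limit state at a finite time would coincide with the actual one-sided limit of the global
trajectory, where at most one shock occurs and it is not grazing. Infinitely many shock times in a
bounded interval would accumulate, but shock times are isolated. -/
theorem not_mem_badSet (hε : 0 < ε) {z : State N} (h : life ε z = univ) : z ∉ badSet ε N := by
  have hm : ∀ t, t ∈ life ε z := fun t => h ▸ mem_univ t
  have hadm : Adm ε z := by simpa using adm_orbit hε (hm 0)
  have htraj := isTrajectoryOn_orbit hε z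
  rintro ⟨-, h1 | ⟨s, hs, hn⟩ | ⟨a, b, γ, ha, hb, hγ, h0, hbad⟩⟩
  · exact hadm.2.1 h1
  · exact absurd (hadm.2.2 s hs) (not_lt.2 hn)
  · have he := orbit_eqOn_of_Ioo hε ha hb hγ h0
    rcases hbad with ⟨z', hz', hb'⟩ | ⟨z', hz', hb'⟩ | hinf
    · obtain ⟨z₀, hz₀, hT, hl, -⟩ := htraj.data (isOpen_life z) (hm b)
      obtain ⟨s, hs, hs₁, hs₂⟩ :=
        (hz'.and (hl.and (Ioo_mem_nhdsLT (ha.trans hb)))).exists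
      rw [he hs₂, hs] at hs₁
      rw [freeFlow_injective _ hs₁] at hb'
      rcases hb' with hb' | ⟨σ, hσ, hσ'⟩
      · rcases (transition_iff hz₀).1 hT with ⟨hn, _⟩ | ⟨σ, hσ, _⟩
        · obtain ⟨σ, _, _, hσ, _⟩ := hb'
          exact hn σ hσ
        · exact hσ.not_hasMultipleShocks hb'
      · exact (hT.normalVel_neg hσ).ne hσ'
    · obtain ⟨z₀, hz₀, hT, -, hr⟩ := htraj.data (isOpen_life z) (hm a)
      obtain ⟨s, hs, hs₁, hs₂⟩ := (hz'.and ((hr.filter_mono (nhdsWithin_mono a Ioi_subset_Ici_self)).and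
        (Ioo_mem_nhdsGT (ha.trans hb)))).exists
      rw [he hs₂, hs] at hs₁
      rw [freeFlow_injective _ hs₁] at hb'
      have hadm' := adm_orbit hε (hm a)
      rcases hb' with hb' | ⟨σ, hσ, hσ'⟩
      · exact hadm'.2.1 hb'
      · exact (hadm'.2.2 σ hσ).ne' hσ'
    · obtain ⟨x, -, hx⟩ := hinf.exists_accPt_of_subset_isCompact (isCompact_Icc (a := a) (b := b))
        (fun t ht => Ioo_subset_Icc_self ht.1)
      rw [accPt_iff_frequently_nhdsNE] at hx
      have hev := htraj.eventually_not_isShock hε (isOpen_life z) (hm x)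
      obtain ⟨s, ⟨hs, σ, hσ⟩, hs'⟩ := (hx.and_eventually hev).exists
      rw [← he hs] at hσ
      exact hs' σ hσ

theorem existsUnique_of_life_eq_univ (hε : 0 < ε) {z : State N} (h : life ε z = univ) :
    ∃! γ : ℝ → State N, IsTrajectoryOn ε univ γ ∧ γ 0 = z := by
  refine ⟨orbit ε z, ⟨h ▸ isTrajectoryOn_orbit hε z, orbit_zero z⟩, ?_⟩
  rintro γ ⟨hγ, rfl⟩
  funext t
  exact (orbit_eq hε isOpen_univ ordConnected_univ (mem_univ 0) hγ (mem_univ t)).symm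

theorem flow_eq_orbit (hε : 0 < ε) {z : State N} (h : life ε z = univ) (t : ℝ) :
    flow ε t z = orbit ε z t := by
  obtain ⟨γ, hγ, hu⟩ := existsUnique_of_life_eq_univ hε h
  have hex : ∃ γ : ℝ → State N, IsTrajectoryOn ε univ γ ∧ γ 0 = z := ⟨γ, hγ⟩
  simp only [flow, hex, dif_pos]
  rw [hu _ hex.choose_spec, ← hu (orbit ε z) ⟨h ▸ isTrajectoryOn_orbit hε z, orbit_zero z⟩]

/-! ### Steps with at most one shock -/

/-- No shock in `(0, δ]`. -/
def FreeStep (ε δ : ℝ) (z : State N) : Prop :=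
  Adm ε z ∧ ∀ s ∈ Ioc 0 δ, ∀ σ, ¬ IsShock ε (freeFlow s z) σ

/-- The only shock in `(0, δ]` is `σ`, at time `t`. -/
def ShockStep (ε δ : ℝ) (σ : Shock N) (t : ℝ) (z : State N) : Prop :=
  Adm ε z ∧ t ∈ Ioc 0 δ ∧ (∀ s ∈ Ioo 0 t, ∀ σ', ¬ IsShock ε (freeFlow s z) σ') ∧
    Pre ε σ (freeFlow t z) ∧ FreeStep ε (δ - t) (jump σ (freeFlow t z))

theorem orbit_eq_free (hε : 0 < ε) {δ : ℝ} {z : State N} (hz : Adm ε z)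
    (hn : ∀ s ∈ Ioo 0 δ, ∀ σ, ¬ IsShock ε (freeFlow s z) σ) :
    ∀ s ∈ Ioo 0 δ, s ∈ life ε z ∧ orbit ε z s = freeFlow s z := by
  intro s hs
  obtain ⟨z₀, hz₀, hT⟩ := hz.exists_transition hε
  obtain ⟨η, hη, hc⟩ := isTrajectoryOn_curve hε hz₀ hT hz hn
  have h0 : (0 : ℝ) ∈ Ioo (-η) δ := ⟨by linarith, hs.1.trans hs.2⟩
  have hs' : s ∈ Ioo (-η) δ := ⟨by linarith [hs.1], hs.2⟩
  have h1 := subset_life isOpen_Ioo ordConnected_Ioo h0 hc hs'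
  have h2 := orbit_eq hε isOpen_Ioo ordConnected_Ioo h0 hc hs'
  have e0 : curve z₀ z 0 = z := by simp [curve]
  have es : curve z₀ z s = freeFlow s z := by simp [curve, hs.1.le]
  rw [e0] at h1 h2
  rw [es] at h2
  exact ⟨h1, h2⟩

theorem FreeStep.orbit_eq (hε : 0 < ε) {δ : ℝ} (hδ : 0 ≤ δ) {z : State N} (h : FreeStep ε δ z) :
    δ ∈ life ε z ∧ orbit ε z δ = freeFlow δ z := by
  rcases hδ.eq_or_lt with rfl | hδ
  · simpa using zero_mem_life hε h.1
  have hn : ∀ s ∈ Ioo 0 δ, ∀ σ, ¬ IsShock ε (freeFlow s z) σ :=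
    fun s hs => h.2 s (Ioo_subset_Ioc_self hs)
  have hno := noOverlap_of_not_isShock hε h.1 hn
  have hno' : freeFlow δ z ∈ contactPhaseSpace ε N := by
    refine mem_contact_iff.2 ⟨?_, (mem_contact_iff.1 h.1.1).2⟩
    have hcl : IsClosed {s | NoOverlap ε (freeFlow s z)} :=
      isClosed_noOverlap.preimage (continuous_freeFlow_left z)
    have hev : ∀ᶠ s in 𝓝[<] δ, NoOverlap ε (freeFlow s z) := by
      filter_upwards [Ioo_mem_nhdsLT hδ] with s hs using hno s hs
    exact hcl.mem_of_frequently_of_tendsto hev.frequently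
      (tendsto_id.mono_left nhdsWithin_le_nhds)
  have hnδ := h.2 δ ⟨hδ, le_rfl⟩
  refine mem_life_of_transition hε hno' (Or.inl ⟨hnδ, rfl⟩)
    (adm_of_forall_not_isShock hno' hnδ) (Eventually.frequently ?_)
  filter_upwards [Ioo_mem_nhdsLT (show -δ < 0 by linarith)] with s hs
  rw [freeFlow_freeFlow, add_comm s δ]
  exact orbit_eq_free hε h.1 hn _ ⟨by linarith [hs.1], by linarith [hs.2]⟩

theorem ShockStep.orbit_eq (hε : 0 < ε) {δ t : ℝ} {σ : Shock N} {z : State N}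
    (h : ShockStep ε δ σ t z) :
    δ ∈ life ε z ∧ orbit ε z δ = freeFlow (δ - t) (jump σ (freeFlow t z)) := by
  obtain ⟨h1, ht, h2, h3, h4⟩ := h
  have h5 : t ∈ life ε z ∧ orbit ε z t = jump σ (freeFlow t z) := by
    refine mem_life_of_transition hε h3.1 ((transition_iff h3.1).2 (Or.inr ⟨σ, h3, rfl⟩))
      (h3.adm_jump hε) (Eventually.frequently ?_)
    filter_upwards [Ioo_mem_nhdsLT (show -t < 0 by linarith [ht.1])] with s hs
    rw [freeFlow_freeFlow, add_comm s t]
    exact orbit_eq_free hε h1 h2 _ ⟨by linarith [hs.1], by linarith [hs.2]⟩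
  have h6 := h4.orbit_eq hε (by linarith [ht.2])
  rw [← h5.2] at h6
  have h7 := add_mem_life hε h5.1 h6.1
  rw [h6.2, h5.2, add_sub_cancel] at h7
  exact h7

theorem free_until (hε : 0 < ε) {t : ℝ} (ht0 : 0 < t) {z : State N} (ht : t ∈ life ε z)
    (hn : ∀ s ∈ Ioo 0 t, ∀ σ, ¬ IsShock ε (orbit ε z s) σ) :
    (∀ s ∈ Ioo 0 t, orbit ε z s = freeFlow s z) ∧ freeFlow t z ∈ contactPhaseSpace ε N ∧
      Transition ε (freeFlow t z) (orbit ε z t) := by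
  have h0 := zero_mem_life_of_mem ht
  have htraj := isTrajectoryOn_orbit hε z
  have hsub : Ioo 0 t ⊆ life ε z := fun s hs =>
    (ordConnected_life z).out h0 ht (Ioo_subset_Icc_self hs)
  have hfree : ∀ s ∈ Ioo 0 t, orbit ε z s = freeFlow s z := by
    intro s hs
    obtain ⟨z₀, -, -, -, hr⟩ := htraj.data (isOpen_life z) h0
    obtain ⟨m, hm, hmt⟩ := ((hr.filter_mono (nhdsWithin_mono 0 Ioi_subset_Ici_self)).and
      (Ioo_mem_nhdsGT ht0)).exists
    have := (htraj.mono hsub).eq_freeFlow isOpen_Ioo ordConnected_Ioo hn hmt s hs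
    rw [this, hm, orbit_zero, sub_zero, freeFlow_freeFlow, sub_add_cancel]
  refine ⟨hfree, ?_⟩
  obtain ⟨z₀, hz₀, hT, hl, -⟩ := htraj.data (isOpen_life z) ht
  obtain ⟨s, hs, hs'⟩ := (hl.and (Ioo_mem_nhdsLT ht0)).exists
  rw [hfree s hs'] at hs
  have : freeFlow t z = z₀ := by
    apply freeFlow_injective (s - t)
    rw [← hs, freeFlow_freeFlow, sub_add_cancel]
  rw [this]
  exact ⟨hz₀, hT⟩

theorem freeStep_of_orbit (hε : 0 < ε) {δ : ℝ} {z : State N} (hl : δ ∈ life ε z)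
    (hn : ∀ s ∈ Ioc 0 δ, ∀ σ, ¬ IsShock ε (orbit ε z s) σ) : FreeStep ε δ z := by
  have h0 := zero_mem_life_of_mem hl
  refine ⟨by simpa using adm_orbit hε h0, fun s hs σ hσ => ?_⟩
  have hsl : s ∈ life ε z := (ordConnected_life z).out h0 hl (Ioc_subset_Icc_self hs)
  obtain ⟨-, -, hT⟩ := free_until hε hs.1 hsl fun r hr => hn r ⟨hr.1, hr.2.le.trans hs.2⟩
  exact hn s hs σ ((isShock_congr hT.pos_eq σ).2 hσ)

/-- Conversely to `FreeStep.orbit_eq` and `ShockStep.orbit_eq`: if the orbit has at most one shock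
time in the step, then the step can be described by free flow alone, which makes the set of such
states accessible to measure theory. -/
theorem step_of_mem_life (hε : 0 < ε) {δ : ℝ} {z : State N} (hl : δ ∈ life ε z)
    (hone : ∀ s ∈ Ioc 0 δ, ∀ s' ∈ Ioc 0 δ, (∃ σ, IsShock ε (orbit ε z s) σ) →
      (∃ σ, IsShock ε (orbit ε z s') σ) → s = s') :
    FreeStep ε δ z ∨ ∃ σ t, ShockStep ε δ σ t z := by
  have h0 := zero_mem_life_of_mem hl
  by_cases h : ∃ t ∈ Ioc 0 δ, ∃ σ, IsShock ε (orbit ε z t) σ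
  · right
    obtain ⟨t, ht, σ, hσ⟩ := h
    have htl : t ∈ life ε z := (ordConnected_life z).out h0 hl (Ioc_subset_Icc_self ht)
    have hn : ∀ s ∈ Ioo 0 t, ∀ σ, ¬ IsShock ε (orbit ε z s) σ := fun s hs σ' hσ' =>
      hs.2.ne (hone s ⟨hs.1, hs.2.le.trans ht.2⟩ t ht ⟨σ', hσ'⟩ ⟨σ, hσ⟩)
    obtain ⟨h1, h2, h3⟩ := free_until hε ht.1 htl hn
    rcases (transition_iff h2).1 h3 with ⟨h4, -⟩ | ⟨σ', h4, h5⟩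
    · exact absurd ((isShock_congr h3.pos_eq σ).1 hσ) (h4 σ)
    refine ⟨σ', t, by simpa using adm_orbit hε h0, ht, fun s hs => h1 s hs ▸ hn s hs, h4, ?_⟩
    rw [← h5]
    have h6 := sub_mem_life hε htl hl
    refine freeStep_of_orbit hε h6.1 fun s hs σ'' hσ'' => ?_
    have hs' : t + s ∈ Ioc 0 δ := ⟨by linarith [ht.1, hs.1], by linarith [hs.2]⟩
    have h7 := sub_mem_life hε htl
      ((ordConnected_life z).out h0 hl (Ioc_subset_Icc_self hs') : t + s ∈ life ε z)
    rw [add_sub_cancel_left] at h7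
    rw [h7.2] at hσ''
    have := hone _ hs' _ ht ⟨σ'', hσ''⟩ ⟨σ, hσ⟩
    linarith [hs.1]
  · left
    push Not at h
    exact freeStep_of_orbit hε hl fun s hs => h s hs

/-- Cover the compact interval by open sets with at most one shock time each; a Lebesgue number of
the cover is a lower bound for the distance of two shock times. -/
theorem exists_gap (hε : 0 < ε) {T : ℝ} {z : State N} (hT : T ∈ life ε z) :
    ∃ r > 0, ∀ s ∈ Icc 0 T, ∀ s' ∈ Icc 0 T, (∃ σ, IsShock ε (orbit ε z s) σ) →
      (∃ σ, IsShock ε (orbit ε z s') σ) → |s - s'| < r → s = s' := by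
  have h0 := zero_mem_life_of_mem hT
  have hsub := (ordConnected_life (ε := ε) z).out h0 hT
  have hloc : ∀ x ∈ Icc 0 T, ∃ U : Set ℝ, IsOpen U ∧ x ∈ U ∧
      ∀ s ∈ U, (∃ σ, IsShock ε (orbit ε z s) σ) → s = x := by
    intro x hx
    have hev := (isTrajectoryOn_orbit hε z).eventually_not_isShock hε (isOpen_life z) (hsub hx)
    rw [eventually_nhdsWithin_iff, eventually_nhds_iff] at hev
    obtain ⟨U, hU, hUo, hxU⟩ := hev
    refine ⟨U, hUo, hxU, fun s hs hσ => ?_⟩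
    by_contra hne
    obtain ⟨σ, hσ⟩ := hσ
    exact hU s hs hne σ hσ
  choose! U hUo hxU hU using hloc
  obtain ⟨r, hr, hleb⟩ := lebesgue_number_lemma_of_metric (s := Icc 0 T)
    (c := fun x : Icc (0 : ℝ) T => U x) isCompact_Icc (fun x => hUo x x.2)
    (fun x hx => mem_iUnion.2 ⟨⟨x, hx⟩, hxU x hx⟩)
  refine ⟨r, hr, fun s hs s' hs' hσ hσ' hlt => ?_⟩
  obtain ⟨x, hx⟩ := hleb s hs
  rw [hU x x.2 s (hx (Metric.mem_ball_self hr)) hσ]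
  refine (hU x x.2 s' (hx ?_) hσ').symm
  rwa [Metric.mem_ball, Real.dist_eq, abs_sub_comm]

end

/-! ### Contact coordinates for collisions and their Jacobian -/

section


/-! ### Spherical coordinates -/

/-- The unit vector with polar angle `a 0` and azimuth `a 1`. -/
def nu (a : E3) : E3 :=
  !₂[Real.sin (a 0) * Real.cos (a 1), Real.sin (a 0) * Real.sin (a 1), Real.cos (a 0)]

/-- The domain of the angles, on which `nu` is a bijection to the sphere. -/
def angleSet : Set E3 :=
  {a | (a 0 ∈ Ioo 0 Real.pi ∧ a 1 ∈ Ioc (-Real.pi) Real.pi) ∨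
    ((a 0 = 0 ∨ a 0 = Real.pi) ∧ a 1 = 0)}

theorem norm_nu (a : E3) : ‖nu a‖ = 1 := by
  rw [← sq_eq_sq₀ (norm_nonneg _) zero_le_one, EuclideanSpace.norm_sq_eq, Fin.sum_univ_three]
  simp only [nu, Real.norm_eq_abs, sq_abs]
  simp
  nlinarith [Real.sin_sq_add_cos_sq (a 0), Real.sin_sq_add_cos_sq (a 1)]

theorem measurableSet_angleSet : MeasurableSet angleSet := by
  unfold angleSet
  have h : ∀ l : Fin 3, Measurable fun a : E3 => a l := fun l => by fun_prop
  refine MeasurableSet.union (MeasurableSet.inter ?_ ?_) (MeasurableSet.inter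
    (MeasurableSet.union ?_ ?_) ?_)
  · exact h 0 measurableSet_Ioo
  · exact h 1 measurableSet_Ioc
  · exact h 0 (measurableSet_singleton 0)
  · exact h 0 (measurableSet_singleton Real.pi)
  · exact h 1 (measurableSet_singleton 0)

theorem sin_nonneg_of_mem_angleSet {a : E3} (ha : a ∈ angleSet) : 0 ≤ Real.sin (a 0) := by
  rcases ha with ⟨h, _⟩ | ⟨h | h, _⟩
  · exact (Real.sin_pos_of_mem_Ioo h).le
  · simp [h]
  · simp [h]

theorem nu_inj {a b : E3} (ha : a ∈ angleSet) (hb : b ∈ angleSet) (h : nu a = nu b) :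
    a 0 = b 0 ∧ a 1 = b 1 := by
  have hIcc : ∀ c ∈ angleSet, c 0 ∈ Icc 0 Real.pi := by
    rintro c (⟨h, _⟩ | ⟨h | h, _⟩)
    · exact Ioo_subset_Icc_self h
    · rw [h]; exact ⟨le_rfl, Real.pi_pos.le⟩
    · rw [h]; exact ⟨Real.pi_pos.le, le_rfl⟩
  have h0 := congrFun (congrArg WithLp.ofLp h) 0
  have h1 := congrFun (congrArg WithLp.ofLp h) 1
  have h2 := congrFun (congrArg WithLp.ofLp h) 2
  simp [nu] at h0 h1 h2
  have e0 : a 0 = b 0 := Real.injOn_cos (hIcc a ha) (hIcc b hb) h2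
  refine ⟨e0, ?_⟩
  rcases ha with ⟨ha0, ha1⟩ | ⟨ha0, ha1⟩ <;> rcases hb with ⟨hb0, hb1⟩ | ⟨hb0, hb1⟩
  · have hs : Real.sin (a 0) ≠ 0 := (Real.sin_pos_of_mem_Ioo ha0).ne'
    rw [← e0] at h0 h1
    have hc := mul_left_cancel₀ hs h0
    have hs' := mul_left_cancel₀ hs h1
    have : (a 1 : Real.Angle) = (b 1 : Real.Angle) := Real.Angle.cos_sin_inj hc hs'
    have h3 := congrArg Real.Angle.toReal this
    rwa [Real.Angle.toReal_coe_eq_self_iff.2 ha1, Real.Angle.toReal_coe_eq_self_iff.2 hb1] at h3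
  · rw [e0] at ha0
    rcases hb0 with hb0 | hb0 <;> rw [hb0] at ha0 <;> simp at ha0
  · rw [← e0] at hb0
    rcases ha0 with ha0 | ha0 <;> rw [ha0] at hb0 <;> simp at hb0
  · rw [ha1, hb1]

/-- The azimuth is the argument of the complex number u₀ + i u₁, and each pole has azimuth 0. The
third coordinate does not enter `nu` and is reserved for the time. -/
theorem exists_nu {u : E3} (hu : ‖u‖ = 1) (t : ℝ) : ∃ a ∈ angleSet, nu a = u ∧ a 2 = t := by
  have hsq : u 0 ^ 2 + u 1 ^ 2 + u 2 ^ 2 = 1 := by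
    have := EuclideanSpace.norm_sq_eq u
    rw [hu, Fin.sum_univ_three] at this
    simp only [Real.norm_eq_abs, sq_abs] at this
    linarith
  have h2 : -1 ≤ u 2 ∧ u 2 ≤ 1 := by
    constructor <;> nlinarith [sq_nonneg (u 0), sq_nonneg (u 1)]
  set θ := Real.arccos (u 2)
  have hcos : Real.cos θ = u 2 := Real.cos_arccos h2.1 h2.2
  have hθ : θ ∈ Icc 0 Real.pi := ⟨Real.arccos_nonneg _, Real.arccos_le_pi _⟩
  have hsin0 : 0 ≤ Real.sin θ := Real.sin_nonneg_of_mem_Icc hθ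
  have hsin : Real.sin θ ^ 2 = u 0 ^ 2 + u 1 ^ 2 := by
    have := Real.sin_sq_add_cos_sq θ
    rw [hcos] at this
    linarith
  by_cases hs : Real.sin θ = 0
  · rw [hs] at hsin
    have e0 : u 0 = 0 := by nlinarith [sq_nonneg (u 0), sq_nonneg (u 1)]
    have e1 : u 1 = 0 := by nlinarith [sq_nonneg (u 0), sq_nonneg (u 1)]
    refine ⟨!₂[θ, 0, t], Or.inr ⟨?_, by simp⟩, ?_, by simp⟩
    · rcases hθ.1.eq_or_lt with h | h
      · left; simp [← h]
      rcases hθ.2.eq_or_lt with h' | h'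
      · right; simp [h']
      · exact absurd hs (Real.sin_pos_of_mem_Ioo ⟨h, h'⟩).ne'
    · ext l
      fin_cases l <;> simp [nu, hs, hcos, e0, e1]
  · have hθ' : θ ∈ Ioo 0 Real.pi := by
      refine ⟨hθ.1.lt_of_ne fun h => hs (by rw [← h]; simp), hθ.2.lt_of_ne fun h => hs (by rw [h]; simp)⟩
    set w : ℂ := ⟨u 0, u 1⟩
    have hw : ‖w‖ = Real.sin θ := by
      rw [← sq_eq_sq₀ (norm_nonneg _) hsin0, hsin, Complex.sq_norm, Complex.normSq_apply]
      simp only [w]; ring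
    have hre : ‖w‖ * Real.cos w.arg = u 0 := Complex.norm_mul_cos_arg w
    have him : ‖w‖ * Real.sin w.arg = u 1 := Complex.norm_mul_sin_arg w
    rw [hw] at hre him
    refine ⟨!₂[θ, w.arg, t], Or.inl ⟨by simpa using hθ', by simpa using Complex.arg_mem_Ioc w⟩,
      ?_, by simp⟩
    ext l
    fin_cases l <;> simp [nu, hcos, hre, him]

/-- The point at time `-a 2` on the line of velocity `V` that hits the sphere at `ε • nu a`. -/
def lineMap (ε : ℝ) (V a : E3) : E3 := ε • nu a - a 2 • V

/-- The Jacobian matrix of `lineMap`. -/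
def lineMatrix (ε : ℝ) (V a : E3) : Matrix (Fin 3) (Fin 3) ℝ :=
  !![ε * (Real.cos (a 0) * Real.cos (a 1)), ε * (-Real.sin (a 0) * Real.sin (a 1)), -V 0;
    ε * (Real.cos (a 0) * Real.sin (a 1)), ε * (Real.sin (a 0) * Real.cos (a 1)), -V 1;
    ε * -Real.sin (a 0), 0, -V 2]

/-- The columns are ε ∂ν/∂θ, ε ∂ν/∂φ and −V. The cross product of the first two is ε² sin θ ν, so
the determinant is the flux of V through the sphere, up to sign. -/
theorem det_lineMatrix (ε : ℝ) (V a : E3) :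
    (lineMatrix ε V a).det = -(ε ^ 2 * Real.sin (a 0) * inner ℝ (nu a) V) := by
  rw [lineMatrix, Matrix.det_fin_three]
  simp [nu, PiLp.inner_apply, Fin.sum_univ_three]
  have h0 := Real.sin_sq_add_cos_sq (a 0)
  have h1 := Real.sin_sq_add_cos_sq (a 1)
  generalize Real.sin (a 0) = s at *
  generalize Real.cos (a 0) = c at *
  generalize Real.sin (a 1) = s' at *
  generalize Real.cos (a 1) = c' at *
  linear_combination (-ε ^ 2 * V 2 * s * c) * h1

theorem hasFDerivAt_lineMap (ε : ℝ) (V a : E3) :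
    HasFDerivAt (lineMap ε V)
      (LinearMap.toContinuousLinearMap (Matrix.toEuclideanLin (lineMatrix ε V a))) a := by
  have hc : ∀ l : Fin 3, HasFDerivAt (fun a : E3 => a l) (EuclideanSpace.proj l : E3 →L[ℝ] ℝ) a :=
    fun l => (EuclideanSpace.proj l : E3 →L[ℝ] ℝ).hasFDerivAt
  rw [← hasFDerivWithinAt_univ, hasFDerivWithinAt_euclidean]
  intro l
  fin_cases l
  · have := ((((hc 0).sin.mul (hc 1).cos).const_mul ε).sub ((hc 2).mul_const (V 0))).hasFDerivWithinAt (s := univ)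
    refine HasFDerivWithinAt.congr_fderiv (f := fun x => lineMap ε V x 0) this ?_
    ext1 b
    simp [lineMatrix, Matrix.toEuclideanLin, Matrix.mulVec, dotProduct, Fin.sum_univ_three]
    ring
  · have := ((((hc 0).sin.mul (hc 1).sin).const_mul ε).sub ((hc 2).mul_const (V 1))).hasFDerivWithinAt (s := univ)
    refine HasFDerivWithinAt.congr_fderiv (f := fun x => lineMap ε V x 1) this ?_
    ext1 b
    simp [lineMatrix, Matrix.toEuclideanLin, Matrix.mulVec, dotProduct, Fin.sum_univ_three]
    ring
  · have := (((hc 0).cos.const_mul ε).sub ((hc 2).mul_const (V 2))).hasFDerivWithinAt (s := univ)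
    refine HasFDerivWithinAt.congr_fderiv (f := fun x => lineMap ε V x 2) this ?_
    ext1 b
    simp [lineMatrix, Matrix.toEuclideanLin, Matrix.mulVec, dotProduct, Fin.sum_univ_three]
    ring

theorem abs_det_lineMap {ε : ℝ} {V a : E3} (ha : a ∈ angleSet) :
    |(LinearMap.toContinuousLinearMap (Matrix.toEuclideanLin (lineMatrix ε V a))).det| =
      ε ^ 2 * Real.sin (a 0) * |inner ℝ (nu a) V| := by
  have : (LinearMap.toContinuousLinearMap (Matrix.toEuclideanLin (lineMatrix ε V a))).det =
      (lineMatrix ε V a).det := by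
    rw [ContinuousLinearMap.det, LinearMap.coe_toContinuousLinearMap]
    exact LinearMap.det_toLin (PiLp.basisFun 2 ℝ (Fin 3)) _
  rw [this, det_lineMatrix, abs_neg, abs_mul, abs_of_nonneg]
  exact mul_nonneg (sq_nonneg _) (sin_nonneg_of_mem_angleSet ha)

/-- A line crosses a sphere at most once inwards and at most once outwards. -/
theorem line_sphere_unique {r σ t t' : ℝ} {u u' V : E3} (hu : ‖u‖ = r) (hu' : ‖u'‖ = r)
    (h : u - t • V = u' - t' • V) (hs : 0 < σ * inner ℝ u V) (hs' : 0 < σ * inner ℝ u' V) :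
    u = u' ∧ t = t' := by
  have e : u' = u + (t' - t) • V := by
    rw [sub_smul]
    have := congrArg (fun x => x + t' • V) h
    simp only [sub_add_cancel] at this
    rw [← this]
    abel
  have h1 := norm_add_smul_sq u V (t' - t)
  rw [← e, hu, hu'] at h1
  have h2 : inner ℝ u' V = inner ℝ u V + (t' - t) * ‖V‖ ^ 2 := by
    rw [e, inner_add_left, inner_smul_left, real_inner_self_eq_norm_sq]
    simp
  have h3 : (t' - t) * (2 * inner ℝ u V + (t' - t) * ‖V‖ ^ 2) = 0 := by linarith
  rcases mul_eq_zero.1 h3 with h4 | h4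
  · refine ⟨by rw [e, h4]; simp, by linarith⟩
  · exfalso
    have : inner ℝ u' V = -inner ℝ u V := by linarith
    rw [this] at hs'
    linarith

/-- The sign σ selects either the incoming or the outgoing crossings of the sphere, and each line
has at most one of each kind. -/
theorem lineMap_injOn {ε : ℝ} (hε : 0 < ε) {V : E3} {σ : ℝ} {Q : Set E3} (hQ : Q ⊆ angleSet)
    (hs : ∀ a ∈ Q, 0 < σ * inner ℝ (nu a) V) : InjOn (lineMap ε V) Q := by
  intro a ha b hb h
  have hn : ∀ c, ‖ε • nu c‖ = ε := fun c => by
    rw [norm_smul, norm_nu, mul_one, Real.norm_of_nonneg hε.le]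
  have hi : ∀ c ∈ Q, 0 < σ * inner ℝ (ε • nu c) V := fun c hc => by
    rw [inner_smul_left, mul_left_comm]
    exact mul_pos hε (hs c hc)
  obtain ⟨h1, h2⟩ := line_sphere_unique (hn a) (hn b) h (hi a ha) (hi b hb)
  obtain ⟨h3, h4⟩ := nu_inj (hQ ha) (hQ hb) (smul_right_injective _ hε.ne' h1)
  ext l
  fin_cases l
  exacts [h3, h4, h2]

/-- The density of the flux through the sphere. -/
def fluxDensity (ε : ℝ) (V a : E3) : ℝ≥0∞ :=
  ENNReal.ofReal (ε ^ 2 * Real.sin (a 0) * |inner ℝ (nu a) V|)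

theorem volume_image_lineMap {ε : ℝ} (hε : 0 < ε) {V : E3} {σ : ℝ} {Q : Set E3}
    (hm : MeasurableSet Q) (hQ : Q ⊆ angleSet) (hs : ∀ a ∈ Q, 0 < σ * inner ℝ (nu a) V) :
    volume (lineMap ε V '' Q) = ∫⁻ a in Q, fluxDensity ε V a := by
  have h := lintegral_image_eq_lintegral_abs_det_fderiv_mul volume hm
    (fun a _ => (hasFDerivAt_lineMap ε V a).hasFDerivWithinAt) (lineMap_injOn hε hQ hs)
    (fun _ => 1)
  simp only [mul_one, lintegral_one, Measure.restrict_apply MeasurableSet.univ, univ_inter] at h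
  rw [h]
  refine setLIntegral_congr_fun hm fun a ha => ?_
  simp only [abs_det_lineMap (hQ ha), fluxDensity]

end

/-! ### Measure theory: isolating one particle, lifting positions to ℝ³ -/

section


/-! ### Instances -/

instance : StandardBorelSpace UnitAddCircle := by
  have : PolishSpace UnitAddCircle := inferInstance
  infer_instance

instance : PolishSpace S2 := Metric.isClosed_sphere.polishSpace

instance {ι : Type*} [Countable ι] : BorelSpace (ι → Pos × E3) :=
  have h : BorelSpace (Pos × E3) := inferInstance
  @Pi.borelSpace _ _ _ _ _ _ fun _ => h

instance {ι : Type*} [Countable ι] : StandardBorelSpace (ι → Pos × E3) :=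
  have h : StandardBorelSpace (Pos × E3) := inferInstance
  @StandardBorelSpace.pi_countable _ _ _ _ fun _ => h

instance {ι : Type*} [Fintype ι] :
    SigmaFinite (Measure.pi fun _ : ι => (volume : Measure (Pos × E3))) :=
  have h : SigmaFinite (volume : Measure (Pos × E3)) := inferInstance
  @Measure.pi.sigmaFinite _ _ _ _ _ fun _ => h

instance {ι : Type*} [Fintype ι] : SigmaFinite (volume : Measure (ι → Pos × E3)) :=
  inferInstanceAs (SigmaFinite (Measure.pi fun _ : ι => (volume : Measure (Pos × E3))))

instance : StandardBorelSpace Pos := inferInstance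
instance : StandardBorelSpace Noise := inferInstance
instance : StandardBorelSpace (State N) := inferInstance
instance : BorelSpace (State N) := inferInstance

/-- The Lusin–Souslin theorem. Many sets below are images of contact parameters, and their
measurability rests on injectivity in standard Borel spaces. -/
theorem measurableSet_image_of_injOn {X Y : Type*} [MeasurableSpace X] [StandardBorelSpace X]
    [MeasurableSpace Y] [StandardBorelSpace Y] {f : X → Y} {s : Set X} (hf : Measurable f)
    (hs : MeasurableSet s) (hi : InjOn f s) : MeasurableSet (f '' s) :=
  hs.image_of_measurable_injOn hf hi

instance : SigmaFinite (phaseMeasure N) := by unfold phaseMeasure; infer_instance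

theorem measurePreserving_add_pos (a : Pos) :
    MeasurePreserving (fun x : Pos => x + a) volume volume :=
  (measurePreserving_add_right volume a.1).prod
    ((measurePreserving_add_right volume a.2.1).prod (measurePreserving_add_right volume a.2.2))

/-! ### Product measures -/

section Products

variable {A B C D E : Type*} [MeasurableSpace A] [MeasurableSpace B] [MeasurableSpace C]
  [MeasurableSpace D] [MeasurableSpace E]

theorem measurePreserving_skew_fst {μ : Measure A} {ν : Measure B} [SFinite μ] [SFinite ν]
    {g : B → A → A} (hg : Measurable (Function.uncurry g)) (h : ∀ b, MeasurePreserving (g b) μ μ) :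
    MeasurePreserving (fun p : A × B => (g p.2 p.1, p.2)) (μ.prod ν) (μ.prod ν) := by
  have h1 := (MeasurePreserving.id ν).skew_product (μc := μ) (μd := μ) (g := g) hg
    (ae_of_all _ fun b => (h b).map_eq)
  exact (Measure.measurePreserving_swap.comp h1).comp Measure.measurePreserving_swap

theorem measurePreserving_prod_left_comm (μ : Measure A) (ν : Measure B) (τ : Measure C)
    [SFinite μ] [SFinite ν] [SFinite τ] :
    MeasurePreserving (fun p : A × (B × C) => (p.2.1, (p.1, p.2.2))) (μ.prod (ν.prod τ))
      (ν.prod (μ.prod τ)) := by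
  have h1 := (measurePreserving_prodAssoc μ ν τ).symm
  have h2 := (Measure.measurePreserving_swap (μ := μ) (ν := ν)).prod (MeasurePreserving.id τ)
  exact (measurePreserving_prodAssoc ν μ τ).comp (h2.comp h1)

theorem measurePreserving_prod_shuffle (μ : Measure A) (ν : Measure B) (τ : Measure C)
    (κ : Measure D) (ξ : Measure E) [SFinite μ] [SFinite ν] [SFinite τ] [SFinite κ] [SFinite ξ] :
    MeasurePreserving (fun p : A × (B × (C × (D × E))) =>
      (((p.1, p.2.1), p.2.2.2.1), (p.2.2.1, p.2.2.2.2)))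
      (μ.prod (ν.prod (τ.prod (κ.prod ξ)))) (((μ.prod ν).prod κ).prod (τ.prod ξ)) := by
  have h1 := (measurePreserving_prodAssoc μ ν (τ.prod (κ.prod ξ))).symm
  have h2 := (MeasurePreserving.id (μ.prod ν)).prod (measurePreserving_prod_left_comm τ κ ξ)
  have h3 := (measurePreserving_prodAssoc (μ.prod ν) κ (τ.prod ξ)).symm
  exact h3.comp (h2.comp h1)

/-- Insertion of a value at the index `i`. -/
def insertAt {Y : Type*} (i : Fin N) (q : Y × ({k : Fin N // k ≠ i} → Y)) : Fin N → Y :=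
  fun k => if h : k = i then q.1 else q.2 ⟨k, h⟩

theorem measurable_insertAt (i : Fin N) :
    Measurable (insertAt i : A × ({k : Fin N // k ≠ i} → A) → _) := by
  refine measurable_pi_iff.2 fun k => ?_
  unfold insertAt
  by_cases h : k = i
  · simp only [h, dif_pos]; fun_prop
  · simp only [h, dif_neg, not_false_eq_true]; fun_prop

theorem measurePreserving_insertAt (μ : Measure A) [SigmaFinite μ] (i : Fin N) :
    MeasurePreserving (insertAt i) (μ.prod (Measure.pi fun _ : {k : Fin N // k ≠ i} => μ))
      (Measure.pi fun _ : Fin N => μ) := by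
  refine ⟨measurable_insertAt i, ?_⟩
  refine (Measure.pi_eq fun s hs => ?_).symm
  rw [Measure.map_apply (measurable_insertAt i) (MeasurableSet.univ_pi hs)]
  have : insertAt i ⁻¹' univ.pi s = s i ×ˢ univ.pi fun k : {k : Fin N // k ≠ i} => s k := by
    ext q
    simp only [mem_preimage, mem_univ_pi, mem_prod, insertAt]
    constructor
    · intro h
      refine ⟨by simpa using h i, fun k => by simpa [k.2] using h k⟩
    · rintro ⟨h1, h2⟩ k
      by_cases hk : k = i
      · subst hk; simpa using h1
      · simpa [hk] using h2 ⟨k, hk⟩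
  rw [this, Measure.prod_prod, Measure.pi_pi,
    ← Fintype.prod_subtype_mul_prod_subtype (fun k => k = i) fun k => μ (s k)]
  congr 1
  simp
  rfl

end Products

/-- The data of all particles except the `i`-th. -/
abbrev Rest (N : ℕ) (i : Fin N) :=
  ({k : Fin N // k ≠ i} → Pos × E3) × ({k : Fin N // k ≠ i} → Noise)

/-- The measure on `Rest N i`. -/
def restMeasure (N : ℕ) (i : Fin N) : Measure (Rest N i) :=
  (Measure.pi fun _ => volume).prod (Measure.pi fun _ => reflectionLaw)

instance (i : Fin N) : SigmaFinite (restMeasure N i) := by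
  unfold restMeasure; infer_instance

instance (i : Fin N) : StandardBorelSpace (Rest N i) := inferInstance
instance (i : Fin N) : StandardBorelSpace (Noise × Rest N i) := inferInstance
instance (i : Fin N) : StandardBorelSpace (E3 × (Noise × Rest N i)) := inferInstance
instance (i : Fin N) : SigmaFinite (reflectionLaw.prod (restMeasure N i)) := inferInstance

/-- The state with the given data of particle `i`. -/
def assemble (i : Fin N) (q : Pos × (E3 × (Noise × Rest N i))) : State N :=
  (insertAt i ((q.1, q.2.1), q.2.2.2.1), insertAt i (q.2.2.1, q.2.2.2.2))

theorem measurePreserving_assemble (i : Fin N) : MeasurePreserving (assemble i)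
    ((volume : Measure Pos).prod ((volume : Measure E3).prod
      (reflectionLaw.prod (restMeasure N i)))) (phaseMeasure N) := by
  have h1 := (measurePreserving_insertAt (volume : Measure (Pos × E3)) i).prod
    (measurePreserving_insertAt reflectionLaw i)
  have h2 := measurePreserving_prod_shuffle (volume : Measure Pos) (volume : Measure E3)
    reflectionLaw (Measure.pi fun _ : {k : Fin N // k ≠ i} => (volume : Measure (Pos × E3)))
    (Measure.pi fun _ : {k : Fin N // k ≠ i} => reflectionLaw)
  exact h1.comp h2

/-- The data of particle `i` and of the others. -/
def disassemble (i : Fin N) (z : State N) : Pos × (E3 × (Noise × Rest N i)) :=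
  (pos z i, vel z i, noise z i, (fun k => z.1 k), (fun k => z.2 k))

theorem assemble_disassemble (i : Fin N) (z : State N) : assemble i (disassemble i z) = z := by
  refine Prod.ext (funext fun k => ?_) (funext fun k => ?_)
  · by_cases h : k = i
    · subst h; simp [assemble, disassemble, insertAt, pos, vel]
    · simp [assemble, disassemble, insertAt, h]
  · by_cases h : k = i
    · subst h; simp [assemble, disassemble, insertAt, noise]
    · simp [assemble, disassemble, insertAt, h]

theorem disassemble_assemble (i : Fin N) (q) : disassemble i (assemble i q) = q := by
  obtain ⟨x, v, ω, r₁, r₂⟩ := q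
  simp only [assemble, disassemble, insertAt, pos, vel, noise, dif_pos]
  simp only [Prod.mk.injEq, true_and]
  refine ⟨funext fun k => ?_, funext fun k => ?_⟩ <;> simp [k.2]

theorem assemble_injective (i : Fin N) : Function.Injective (assemble i) :=
  Function.LeftInverse.injective (disassemble_assemble i)

/-! ### Lifting from the cylinder to the space -/

theorem measurePreserving_coords : MeasurePreserving (fun u : E3 => ((u 0, u 1, u 2) : ℝ × ℝ × ℝ))
    volume volume := by
  have h1 := PiLp.volume_preserving_ofLp (Fin 3)
  have h2 := volume_preserving_piFinSuccAbove (fun _ : Fin 3 => ℝ) 0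
  have h3 := (MeasurePreserving.id (volume : Measure ℝ)).prod
    (volume_preserving_finTwoArrow ℝ)
  exact h3.comp (h2.comp h1)

/-- A fundamental domain of the projection. -/
def cell (k : ℤ × ℤ) : Set E3 :=
  {u | u 1 ∈ Ioc (k.1 : ℝ) (k.1 + 1) ∧ u 2 ∈ Ioc (k.2 : ℝ) (k.2 + 1)}

theorem measurableSet_cell (k : ℤ × ℤ) : MeasurableSet (cell k) := by
  have h : ∀ l : Fin 3, Measurable fun a : E3 => a l := fun l => by fun_prop
  exact (h 1 measurableSet_Ioc).inter (h 2 measurableSet_Ioc)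

theorem measurePreserving_proj (k : ℤ × ℤ) :
    MeasurePreserving proj (volume.restrict (cell k)) volume := by
  have h1 : MeasurePreserving (fun x : ℝ × ℝ × ℝ =>
      ((x.1, (x.2.1 : UnitAddCircle), (x.2.2 : UnitAddCircle)) : Pos))
      (volume.restrict (univ ×ˢ (Ioc (k.1 : ℝ) (k.1 + 1) ×ˢ Ioc (k.2 : ℝ) (k.2 + 1)))) volume := by
    have := (MeasurePreserving.id (volume : Measure ℝ)).prod
      ((UnitAddCircle.measurePreserving_mk (k.1 : ℝ)).prod
        (UnitAddCircle.measurePreserving_mk (k.2 : ℝ)))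
    rw [Measure.prod_restrict, ← Measure.restrict_univ (μ := (volume : Measure ℝ)),
      Measure.prod_restrict, Measure.restrict_univ] at this
    exact this
  have h2 := measurePreserving_coords.restrict_preimage
    (s := univ ×ˢ (Ioc (k.1 : ℝ) (k.1 + 1) ×ˢ Ioc (k.2 : ℝ) (k.2 + 1)))
    (MeasurableSet.univ.prod (measurableSet_Ioc.prod measurableSet_Ioc))
  have h3 := h1.comp h2
  have h4 : (fun u : E3 => ((u 0, u 1, u 2) : ℝ × ℝ × ℝ)) ⁻¹'
      (univ ×ˢ (Ioc (k.1 : ℝ) (k.1 + 1) ×ˢ Ioc (k.2 : ℝ) (k.2 + 1))) = cell k := by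
    ext u
    simp [cell]
  rw [h4] at h3
  exact h3

theorem proj_injOn_cell (k : ℤ × ℤ) : InjOn proj (cell k) := by
  intro u hu v hv h
  obtain ⟨l, rfl⟩ := proj_eq_proj_iff.1 h
  have h1 := hu.1
  have h2 := hu.2
  have h3 := hv.1
  have h4 := hv.2
  simp [latticeVec] at h1 h2
  have e1 : l.1 = 0 := by
    have a1 : ((l.1 : ℤ) : ℝ) < (1 : ℤ) := by push_cast; linarith [h1.2, h3.1]
    have a2 : ((-1 : ℤ) : ℝ) < (l.1 : ℤ) := by push_cast; linarith [h1.1, h3.2]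
    have := Int.cast_lt.1 a1
    have := Int.cast_lt.1 a2
    omega
  have e2 : l.2 = 0 := by
    have a1 : ((l.2 : ℤ) : ℝ) < (1 : ℤ) := by push_cast; linarith [h2.2, h4.1]
    have a2 : ((-1 : ℤ) : ℝ) < (l.2 : ℤ) := by push_cast; linarith [h2.1, h4.2]
    have := Int.cast_lt.1 a1
    have := Int.cast_lt.1 a2
    omega
  have : latticeVec l = 0 := by
    ext m
    fin_cases m <;> simp [latticeVec, e1, e2]
  rw [this, add_zero]

theorem iUnion_cell : ⋃ k, cell k = univ := by
  rw [eq_univ_iff_forall]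
  intro u
  refine mem_iUnion.2 ⟨(⌈u 1⌉ - 1, ⌈u 2⌉ - 1), ?_, ?_⟩ <;> constructor <;> push_cast <;>
    linarith [Int.le_ceil (u 1), Int.ceil_lt_add_one (u 1), Int.le_ceil (u 2),
      Int.ceil_lt_add_one (u 2)]

theorem pairwise_disjoint_cell : Pairwise (Function.onFun Disjoint cell) := by
  intro k l hkl
  rw [Function.onFun, disjoint_left]
  intro u hk hl
  apply hkl
  have hc : ∀ (x : ℝ) (m : ℤ), x ∈ Ioc (m : ℝ) (m + 1) → ⌈x⌉ = m + 1 := by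
    intro x m hx
    rw [Int.ceil_eq_iff]
    push_cast
    exact ⟨by linarith [hx.1], hx.2⟩
  have h1 := (hc _ _ hk.1).symm.trans (hc _ _ hl.1)
  have h2 := (hc _ _ hk.2).symm.trans (hc _ _ hl.2)
  exact Prod.ext (by omega) (by omega)

/-- The projection preserves the measure of sets on which it is injective. -/
theorem measure_image_proj {Y : Type*} [MeasurableSpace Y] [StandardBorelSpace Y] (ρ : Measure Y)
    [SFinite ρ] {W : Set (E3 × Y)} (hW : MeasurableSet W)
    (hinj : InjOn (Prod.map proj (id : Y → Y)) W) :
    (volume : Measure Pos).prod ρ (Prod.map proj id '' W) = (volume : Measure E3).prod ρ W := by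
  have hm : Measurable (Prod.map proj (id : Y → Y)) :=
    continuous_proj.measurable.prodMap measurable_id
  set c : ℤ × ℤ → Set (E3 × Y) := fun k => W ∩ (cell k ×ˢ univ)
  have hc : ∀ k, MeasurableSet (c k) := fun k =>
    hW.inter ((measurableSet_cell k).prod MeasurableSet.univ)
  -- On the part over one fundamental cell the projection preserves the measure; injectivity on `W`
  -- keeps the images of different parts disjoint.
  have hcW : W = ⋃ k, c k := by
    rw [← inter_iUnion, ← iUnion_prod_const, iUnion_cell, univ_prod_univ, inter_univ]
  have hdisj : Pairwise (Function.onFun Disjoint c) := by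
    intro k l hkl
    refine Disjoint.mono inter_subset_right inter_subset_right ?_
    exact Disjoint.set_prod_left (pairwise_disjoint_cell hkl) _ _
  have hsub : ∀ k, c k ⊆ W := fun k => inter_subset_left
  have himg : ∀ k, MeasurableSet (Prod.map proj id '' c k) := fun k =>
    measurableSet_image_of_injOn hm (hc k) (hinj.mono (hsub k))
  have heq : ∀ k, (volume : Measure Pos).prod ρ (Prod.map proj id '' c k) =
      (volume : Measure E3).prod ρ (c k) := by
    intro k
    have h1 := (measurePreserving_proj k).prod (MeasurePreserving.id ρ)
    rw [← h1.measure_preimage (himg k).nullMeasurableSet, ← Measure.restrict_univ (μ := ρ),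
      Measure.prod_restrict, Measure.restrict_apply' ((measurableSet_cell k).prod .univ)]
    simp only [Measure.restrict_univ]
    congr 1
    ext ⟨u, y⟩
    constructor
    · rintro ⟨⟨⟨u', y'⟩, hu', he⟩, hu⟩
      simp only [Prod.map_apply, id, Prod.mk.injEq] at he
      obtain ⟨he, rfl⟩ := he
      obtain rfl := proj_injOn_cell k hu'.2.1 hu.1 he
      exact hu'
    · intro h
      exact ⟨⟨_, h, rfl⟩, h.2⟩
  rw [hcW, image_iUnion, measure_iUnion ?_ himg, measure_iUnion hdisj hc]
  · exact tsum_congr heq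
  · intro k l hkl
    rw [Function.onFun, disjoint_left]
    rintro _ ⟨a, ha, rfl⟩ ⟨b, hb, hab⟩
    obtain rfl := hinj (hsub l hb) (hsub k ha) hab
    exact disjoint_left.1 (hdisj hkl) ha hb

end

/-! ### Invariance of the flux under collisions -/

section

variable {ε : ℝ} {i j : Fin N}

/-! ### Collisions preserve the measure -/

@[simp] theorem pos_assemble_self (i : Fin N) (q) : pos (assemble i q) i = q.1 := by
  simp [assemble, insertAt, pos]

@[simp] theorem vel_assemble_self (i : Fin N) (q) : vel (assemble i q) i = q.2.1 := by
  simp [assemble, insertAt, vel]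

@[simp] theorem noise_assemble_self (i : Fin N) (q) : noise (assemble i q) i = q.2.2.1 := by
  simp [assemble, insertAt, noise]

theorem pos_assemble_of_ne {k : Fin N} (h : k ≠ i) (q) :
    pos (assemble i q) k = (q.2.2.2.1 ⟨k, h⟩).1 := by
  simp [assemble, insertAt, pos, h]

theorem vel_assemble_of_ne {k : Fin N} (h : k ≠ i) (q) :
    vel (assemble i q) k = (q.2.2.2.1 ⟨k, h⟩).2 := by
  simp [assemble, insertAt, vel, h]

theorem noise_assemble_of_ne {k : Fin N} (h : k ≠ i) (q) :
    noise (assemble i q) k = q.2.2.2.2 ⟨k, h⟩ := by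
  simp [assemble, insertAt, noise, h]

/-- The state in which particle `i` has the given position and velocity relative to `j`. -/
def relState (hij : i ≠ j) (p : Pos × (E3 × (Noise × Rest N i))) : State N :=
  assemble i (p.1 + (p.2.2.2.1 ⟨j, hij.symm⟩).1, (p.2.1 + (p.2.2.2.1 ⟨j, hij.symm⟩).2, p.2.2))

theorem relState_injective (hij : i ≠ j) : Function.Injective (relState hij) := by
  intro p p' h
  have h := assemble_injective i h
  obtain ⟨x, V, y⟩ := p
  obtain ⟨x', V', y'⟩ := p'
  simp only [Prod.mk.injEq] at h
  obtain ⟨h1, h2, rfl⟩ := h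
  rw [add_right_cancel h1, add_right_cancel h2]

/-- The measure on the data of particle `i` without the position. -/
def dataMeasure (N : ℕ) (i : Fin N) : Measure (E3 × (Noise × Rest N i)) :=
  volume.prod (reflectionLaw.prod (restMeasure N i))

instance : SigmaFinite (dataMeasure N i) := by unfold dataMeasure; infer_instance

/-- For fixed data of the other particles, the position and the velocity of `i` are translated by
those of `j`. -/
theorem measurePreserving_relState (hij : i ≠ j) :
    MeasurePreserving (relState hij) ((volume : Measure Pos).prod (dataMeasure N i))
      (phaseMeasure N) := by
  have h1 := measurePreserving_skew_fst (μ := (volume : Measure Pos)) (ν := dataMeasure N i)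
    (g := fun y x => x + (y.2.2.1 ⟨j, hij.symm⟩).1) (by fun_prop)
    fun y => measurePreserving_add_pos _
  have h2 := measurePreserving_skew_fst (μ := (volume : Measure E3))
    (ν := reflectionLaw.prod (restMeasure N i))
    (g := fun y x => x + (y.2.1 ⟨j, hij.symm⟩).2) (by fun_prop)
    fun y => measurePreserving_add_right _ _
  exact (measurePreserving_assemble i).comp
    (h1.comp ((MeasurePreserving.id (volume : Measure Pos)).prod h2))

/-- The state at time `-a 2` before (or after) a contact of `i` and `j` in the direction `nu a`. -/
def fluxState (ε : ℝ) (hij : i ≠ j) (p : E3 × (E3 × (Noise × Rest N i))) : State N :=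
  relState hij (proj (lineMap ε p.2.1 p.1), p.2)

theorem measurable_nu : Measurable nu := by
  unfold nu
  refine (WithLp.measurable_toLp 2 _).comp (measurable_pi_iff.2 fun l => ?_)
  fin_cases l <;> simp <;> fun_prop

theorem measurable_lineMap {X : Type*} [MeasurableSpace X] {V a : X → E3} (hV : Measurable V)
    (ha : Measurable a) : Measurable fun p => lineMap ε (V p) (a p) := by
  unfold lineMap
  have := measurable_nu
  fun_prop

theorem measurable_fluxDensity {X : Type*} [MeasurableSpace X] {V a : X → E3} (hV : Measurable V)
    (ha : Measurable a) : Measurable fun p => fluxDensity ε (V p) (a p) := by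
  unfold fluxDensity
  have := measurable_nu
  fun_prop

theorem measurable_freeFlow {X : Type*} [MeasurableSpace X] {t : X → ℝ} {z : X → State N}
    (ht : Measurable t) (hz : Measurable z) : Measurable fun p => freeFlow (t p) (z p) :=
  continuous_freeFlow_uncurry.measurable.comp (ht.prodMk hz)

theorem measurable_fluxState (hij : i ≠ j) : Measurable (fluxState (N := N) ε hij) := by
  refine (measurePreserving_relState hij).measurable.comp (Measurable.prodMk ?_ measurable_snd)
  exact continuous_proj.measurable.comp
    (measurable_lineMap (measurable_fst.comp measurable_snd) measurable_fst)

/-- The parameters of the contacts in `Q`. -/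
def fluxSet (ε : ℝ) (hij : i ≠ j) (Q : Set (State N × E3 × ℝ)) :
    Set (E3 × (E3 × (Noise × Rest N i))) :=
  {p | p.1 ∈ angleSet ∧ (freeFlow (p.1 2) (fluxState ε hij p), ε • nu p.1, p.1 2) ∈ Q}

theorem measurableSet_fluxSet (hij : i ≠ j) {Q : Set (State N × E3 × ℝ)} (hQ : MeasurableSet Q) :
    MeasurableSet (fluxSet ε hij Q) := by
  have h2 : Measurable fun p : E3 × (E3 × (Noise × Rest N i)) => p.1 2 := by fun_prop
  have h3 : Measurable fun p : E3 × (E3 × (Noise × Rest N i)) =>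
      (freeFlow (p.1 2) (fluxState ε hij p), ε • nu p.1, p.1 2) := ?_
  · exact (measurable_fst measurableSet_angleSet).inter (h3 hQ)
  refine Measurable.prodMk ?_ (Measurable.prodMk ?_ h2)
  · exact measurable_freeFlow h2 (measurable_fluxState hij)
  · exact (measurable_nu.comp measurable_fst).const_smul ε

/-- Fubini: for each fixed value of the remaining data this is the change of variables
`volume_image_lineMap`. -/
theorem measure_image_lineMap {Y : Type*} [MeasurableSpace Y] [StandardBorelSpace Y]
    {ρ : Measure Y} [SFinite ρ] (hε : 0 < ε) {σ : ℝ} {V : Y → E3} (hV : Measurable V)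
    {Q : Set (E3 × Y)} (hm : MeasurableSet Q) (hQ : ∀ p ∈ Q, p.1 ∈ angleSet)
    (hs : ∀ p ∈ Q, 0 < σ * inner ℝ (nu p.1) (V p.2)) :
    (volume : Measure E3).prod ρ ((fun p => (lineMap ε (V p.2) p.1, p.2)) '' Q) =
      ∫⁻ p in Q, fluxDensity ε (V p.2) p.1 ∂(volume : Measure E3).prod ρ := by
  have hf : Measurable fun p : E3 × Y => (lineMap ε (V p.2) p.1, p.2) :=
    (measurable_lineMap (hV.comp measurable_snd) measurable_fst).prodMk measurable_snd
  have hinj : InjOn (fun p : E3 × Y => (lineMap ε (V p.2) p.1, p.2)) Q := by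
    rintro ⟨a, y⟩ ha ⟨b, y'⟩ hb h
    simp only [Prod.mk.injEq] at h
    obtain ⟨h, rfl⟩ := h
    have hab : a = b := lineMap_injOn hε (V := V y) (Q := {a | (a, y) ∈ Q})
      (fun a ha => hQ (a, y) ha) (fun a ha => hs (a, y) ha) ha hb h
    rw [hab]
  have hd : Measurable fun p : E3 × Y => fluxDensity ε (V p.2) p.1 :=
    measurable_fluxDensity (hV.comp measurable_snd) measurable_fst
  rw [Measure.prod_apply_symm (measurableSet_image_of_injOn hf hm hinj), ← lintegral_indicator hm,
    lintegral_prod_symm' _ (hd.indicator hm)]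
  refine lintegral_congr fun y => ?_
  have hy : MeasurableSet {a | (a, y) ∈ Q} := measurable_prodMk_right hm
  have he : (fun x => (x, y)) ⁻¹' ((fun p => (lineMap ε (V p.2) p.1, p.2)) '' Q) =
      lineMap ε (V y) '' {a | (a, y) ∈ Q} := by
    ext x
    constructor
    · rintro ⟨⟨a, y'⟩, ha, h⟩
      simp only [Prod.mk.injEq] at h
      obtain ⟨h, rfl⟩ := h
      exact ⟨a, ha, h⟩
    · rintro ⟨a, ha, rfl⟩
      exact ⟨(a, y), ha, rfl⟩
  rw [he, volume_image_lineMap hε hy (fun a ha => hQ (a, y) ha) (fun a ha => hs (a, y) ha),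
    ← lintegral_indicator hy]
  rfl

/-- The measure of a set of states that are reached by free motion from contacts of `i` and `j`. -/
theorem measure_image_contact (hε : 0 < ε) (hij : i ≠ j) {σ : ℝ} {Q : Set (State N × E3 × ℝ)}
    (hm : MeasurableSet Q)
    (hQ : ∀ q ∈ Q, proj q.2.1 = pos q.1 i - pos q.1 j ∧ ‖q.2.1‖ = ε ∧
      0 < σ * inner ℝ q.2.1 (vel q.1 i - vel q.1 j))
    (hinj : InjOn (fun q : State N × E3 × ℝ => freeFlow (-q.2.2) q.1) Q) :
    phaseMeasure N ((fun q => freeFlow (-q.2.2) q.1) '' Q) =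
      ∫⁻ p in fluxSet ε hij Q, fluxDensity ε p.2.1 p.1 ∂volume.prod (dataMeasure N i) := by
  set S := fluxSet ε hij Q
  have hS : MeasurableSet S := measurableSet_fluxSet hij hm
  have hvel : ∀ p : E3 × (E3 × (Noise × Rest N i)),
      vel (fluxState ε hij p) i - vel (fluxState ε hij p) j = p.2.1 := by
    intro p
    rw [fluxState, relState, vel_assemble_self, vel_assemble_of_ne hij.symm]
    simp
  have hsgn : ∀ p ∈ S, 0 < σ * inner ℝ (nu p.1) p.2.1 := by
    intro p hp
    have h := (hQ _ hp.2).2.2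
    simp only [vel_freeFlow, hvel, inner_smul_left, conj_trivial] at h
    rw [mul_left_comm] at h
    exact (mul_pos_iff_of_pos_left hε).1 h
  have hfinj : InjOn (fluxState ε hij) S := by
    intro p hp p' hp' h
    have h1 := hinj hp.2 hp'.2 (by simp only [freeFlow_freeFlow, neg_add_cancel, freeFlow_zero, h])
    simp only [Prod.mk.injEq] at h1
    have h2 := nu_inj hp.1 hp'.1 (smul_right_injective _ hε.ne' h1.2.1)
    have h3 : p.1 = p'.1 := by
      ext l
      fin_cases l
      exacts [h2.1, h2.2, h1.2.2]
    have h4 := relState_injective hij h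
    simp only [Prod.mk.injEq] at h4
    exact Prod.ext h3 h4.2
  have himg : (fun q : State N × E3 × ℝ => freeFlow (-q.2.2) q.1) '' Q = fluxState ε hij '' S := by
    ext z
    constructor
    · rintro ⟨⟨ζ, u, t⟩, hq, rfl⟩
      obtain ⟨h1, h2, h3⟩ := hQ _ hq
      simp only at h1 h2 h3
      obtain ⟨a, ha, hau, hat⟩ := exists_nu (u := ε⁻¹ • u) (by
        rw [norm_smul, h2, Real.norm_of_nonneg (inv_nonneg.2 hε.le), inv_mul_cancel₀ hε.ne']) t
      have hau' : ε • nu a = u := by rw [hau, smul_smul, mul_inv_cancel₀ hε.ne', one_smul]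
      obtain ⟨p, hp⟩ : ∃ p, p = disassemble i (freeFlow (-t) ζ) := ⟨_, rfl⟩
      have hst : fluxState ε hij (a, (vel ζ i - vel ζ j, p.2.2)) = freeFlow (-t) ζ := by
        rw [← assemble_disassemble i (freeFlow (-t) ζ), ← hp, fluxState, relState]
        congr 1
        subst hp
        refine Prod.ext ?_ (Prod.ext ?_ rfl)
        · simp only [disassemble, lineMap, hau', hat]
          have : pos (freeFlow (-t) ζ) j = ((freeFlow (-t) ζ).1 j).1 := rfl
          rw [← this, pos_freeFlow, pos_freeFlow, proj_sub, smul_sub, proj_sub, h1, neg_smul,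
            neg_smul, proj_neg, proj_neg]
          abel
        · simp only [disassemble]
          have : vel (freeFlow (-t) ζ) j = ((freeFlow (-t) ζ).1 j).2 := rfl
          rw [← this]
          simp
      refine ⟨(a, (vel ζ i - vel ζ j, p.2.2)), ⟨ha, ?_⟩, hst⟩
      simp only
      rw [hst, hau', hat, freeFlow_freeFlow, add_neg_cancel, freeFlow_zero]
      exact hq
    · rintro ⟨p, hp, rfl⟩
      exact ⟨_, hp.2, by simp [freeFlow_freeFlow]⟩
  set P : E3 × (E3 × (Noise × Rest N i)) → E3 × (E3 × (Noise × Rest N i)) :=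
    fun p => (lineMap ε p.2.1 p.1, p.2)
  have hP : Measurable P := (measurable_lineMap (measurable_fst.comp measurable_snd)
    measurable_fst).prodMk measurable_snd
  -- Only `P` has a nontrivial Jacobian. The projection preserves the measure of the sets on which
  -- it is injective, and `relState` preserves the measure.
  have hcomp : fluxState ε hij = relState hij ∘ Prod.map proj id ∘ P := rfl
  have hPinj : InjOn P S := fun p hp p' hp' h =>
    hfinj hp hp' (by rw [hcomp, Function.comp_apply, Function.comp_apply, Function.comp_apply,
      Function.comp_apply, h])
  have hprinj : InjOn (Prod.map proj (id : E3 × (Noise × Rest N i) → _)) (P '' S) := by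
    rintro _ ⟨p, hp, rfl⟩ _ ⟨p', hp', rfl⟩ h
    rw [hfinj hp hp' (by rw [hcomp]; exact congrArg (relState hij) h)]
  have hPS : MeasurableSet (P '' S) := measurableSet_image_of_injOn hP hS hPinj
  rw [himg, hcomp, image_comp, image_comp]
  set B := Prod.map proj (id : E3 × (Noise × Rest N i) → _) '' (P '' S)
  have hB : MeasurableSet B := measurableSet_image_of_injOn
    (continuous_proj.measurable.prodMap measurable_id) hPS hprinj
  have hr := measurePreserving_relState (N := N) hij
  have hWB : MeasurableSet (relState hij '' B) :=
    measurableSet_image_of_injOn hr.measurable hB (relState_injective hij).injOn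
  rw [← hr.measure_preimage hWB.nullMeasurableSet, preimage_image_eq _ (relState_injective hij),
    measure_image_proj _ hPS hprinj]
  exact measure_image_lineMap hε measurable_fst hS (fun p hp => hp.1) hsgn

/-- Reflection at the plane orthogonal to `ν`. -/
theorem measurePreserving_reflect {ν : E3} (hν : ‖ν‖ = 1) :
    MeasurePreserving (fun V : E3 => V - (2 * inner ℝ ν V) • ν) volume volume := by
  have h := ((ℝ ∙ ν)ᗮ.reflection).measurePreserving
  have he : ⇑(ℝ ∙ ν)ᗮ.reflection = fun V : E3 => V - (2 * inner ℝ ν V) • ν := by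
    funext V
    rw [Submodule.reflection_orthogonal_apply, Submodule.reflection_singleton_apply, hν]
    simp [two_smul, two_mul, add_smul]
  rwa [he] at h

/-- Change of the position and the velocity of particle `j`. -/
def shiftRest (hij : i ≠ j) (b : Pos) (w : E3) (r : Rest N i) : Rest N i :=
  (fun k => if k = ⟨j, hij.symm⟩ then ((r.1 k).1 + b, (r.1 k).2 + w) else r.1 k, r.2)

theorem measurable_shiftRest (hij : i ≠ j) :
    Measurable fun p : Pos × E3 × Rest N i => shiftRest hij p.1 p.2.1 p.2.2 := by
  unfold shiftRest
  refine Measurable.prodMk (measurable_pi_iff.2 fun k => ?_) (by fun_prop)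
  split_ifs <;> fun_prop

theorem measurePreserving_shiftRest (hij : i ≠ j) (b : Pos) (w : E3) :
    MeasurePreserving (shiftRest hij b w : Rest N i → _) (restMeasure N i) (restMeasure N i) := by
  have h : SigmaFinite (volume : Measure (Pos × E3)) := inferInstance
  refine MeasurePreserving.prod (@measurePreserving_pi {k : Fin N // k ≠ i} _ (fun _ => Pos × E3)
    (fun _ => Pos × E3) _ _ (fun _ => volume) (fun _ => volume)
    (fun k y => if k = ⟨j, hij.symm⟩ then (y.1 + b, y.2 + w) else y) (fun _ => h) fun k => ?_)
    (MeasurePreserving.id _)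
  by_cases hk : k = ⟨j, hij.symm⟩
  · simp only [hk, if_true]
    exact (measurePreserving_add_pos b).prod (measurePreserving_add_right volume w)
  · simp only [hk, if_false]
    exact MeasurePreserving.id _

/-- The collision in the coordinates of `fluxState`. -/
def fluxCollide (hij : i ≠ j) (p : E3 × (E3 × (Noise × Rest N i))) :
    E3 × (E3 × (Noise × Rest N i)) :=
  (p.1, (p.2.1 - (2 * inner ℝ (nu p.1) p.2.1) • nu p.1, (p.2.2.1,
    shiftRest hij (proj (-((p.1 2) • (inner ℝ (nu p.1) p.2.1 : ℝ) • nu p.1)))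
      ((inner ℝ (nu p.1) p.2.1 : ℝ) • nu p.1) p.2.2.2)))

/-- The map is triangular: direction and time are fixed, the relative velocity is reflected, and for
given values of these the data of particle `j` are translated. Its velocity gains (ν·V)ν, so its
position at the reference time −t before the contact must change by −t(ν·V)ν for the contact point
to stay the same. -/
theorem measurePreserving_fluxCollide (hij : i ≠ j) :
    MeasurePreserving (fluxCollide (N := N) hij) (volume.prod (dataMeasure N i))
      (volume.prod (dataMeasure N i)) := by
  have hnu := measurable_nu
  have hpr : Measurable proj := continuous_proj.measurable
  have hsh := measurable_shiftRest (N := N) hij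
  refine MeasurePreserving.skew_product (f := id) (MeasurePreserving.id _)
    (g := fun a y => (fluxCollide hij (a, y)).2) ?_ (ae_of_all _ fun a => ?_)
  · simp only [fluxCollide, Function.uncurry_def]
    refine Measurable.prodMk (by fun_prop) (Measurable.prodMk (by fun_prop) ?_)
    refine hsh.comp (Measurable.prodMk ?_ (Measurable.prodMk ?_ ?_)) <;> fun_prop
  · refine MeasurePreserving.map_eq ?_
    refine MeasurePreserving.skew_product (μa := (volume : Measure E3))
      (f := fun V : E3 => V - (2 * inner ℝ (nu a) V) • nu a)
      (measurePreserving_reflect (norm_nu a))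
      (g := fun V (y : Noise × Rest N i) => (y.1, shiftRest hij (proj (-((a 2) • (inner ℝ (nu a) V : ℝ) • nu a)))
        ((inner ℝ (nu a) V : ℝ) • nu a) y.2)) ?_ (ae_of_all _ fun V => ?_)
    · simp only [Function.uncurry_def]
      refine Measurable.prodMk (by fun_prop) ?_
      refine hsh.comp (Measurable.prodMk ?_ (Measurable.prodMk ?_ ?_)) <;> fun_prop
    · exact ((MeasurePreserving.id reflectionLaw).prod (measurePreserving_shiftRest hij _ _)).map_eq

theorem inner_nu_reflect (a V : E3) :
    inner ℝ (nu a) (V - (2 * inner ℝ (nu a) V) • nu a) = -inner ℝ (nu a) V := by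
  rw [inner_sub_right, inner_smul_right, real_inner_self_eq_norm_sq, norm_nu]
  ring

theorem unitDir_smul_nu (hε : 0 < ε) (a : E3) : unitDir (ε • nu a) = nu a := by
  rw [unitDir, norm_smul, norm_nu, mul_one, Real.norm_of_nonneg hε.le, smul_smul,
    inv_mul_cancel₀ hε.ne', one_smul]

/-- This justifies `fluxCollide`: the coordinates extrapolate the states before and after the
collision back to the same reference time, and at the time of contact the two differ exactly by
`collide`. -/
theorem freeFlow_fluxCollide (hε : 0 < ε) (hij : i ≠ j) (p : E3 × (E3 × (Noise × Rest N i))) :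
    freeFlow (p.1 2) (fluxState ε hij (fluxCollide hij p)) =
      collide i j (ε • nu p.1) (freeFlow (p.1 2) (fluxState ε hij p)) := by
  obtain ⟨a, V, ω, r⟩ := p
  have hji : (⟨j, hij.symm⟩ : {k : Fin N // k ≠ i}) = ⟨j, hij.symm⟩ := rfl
  refine state_ext (fun k => ?_) (fun k => ?_) (fun k => ?_)
  · rw [pos_collide, pos_freeFlow, pos_freeFlow]
    by_cases hi : k = i
    · subst hi
      simp only [fluxState, relState, pos_assemble_self, vel_assemble_self, fluxCollide, shiftRest,
        if_true, lineMap, add_assoc, smul_add, proj_sub, proj_neg, smul_sub, two_mul,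
        add_smul, proj_add]
      abel
    · by_cases hj : k = j
      · subst hj
        simp only [fluxState, relState, pos_assemble_of_ne hi, vel_assemble_of_ne hi, fluxCollide,
          shiftRest, if_true, smul_add, proj_add, proj_neg]
        abel
      · have : ¬ (⟨k, hi⟩ : {k : Fin N // k ≠ i}) = ⟨j, hij.symm⟩ := fun h => hj (congrArg Subtype.val h)
        simp only [fluxState, relState, pos_assemble_of_ne hi, vel_assemble_of_ne hi, fluxCollide,
          shiftRest, this, if_false]
  · have hc : vel (freeFlow (a 2) (fluxState ε hij (a, V, ω, r))) i -
        vel (freeFlow (a 2) (fluxState ε hij (a, V, ω, r))) j = V := by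
      rw [vel_freeFlow, vel_freeFlow, fluxState, relState, vel_assemble_self,
        vel_assemble_of_ne hij.symm]
      simp
    by_cases hi : k = i
    · subst hi
      rw [vel_collide_left hij, hc, unitDir_smul_nu hε, vel_freeFlow, vel_freeFlow]
      simp only [fluxState, relState, vel_assemble_self, fluxCollide, shiftRest, if_true, two_mul,
        add_smul]
      abel
    · by_cases hj : k = j
      · subst hj
        rw [vel_collide_right, hc, unitDir_smul_nu hε, vel_freeFlow, vel_freeFlow]
        simp only [fluxState, relState, vel_assemble_of_ne hi, fluxCollide, shiftRest, if_true]
      · have : ¬ (⟨k, hi⟩ : {k : Fin N // k ≠ i}) = ⟨j, hij.symm⟩ := fun h => hj (congrArg Subtype.val h)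
        rw [vel_collide_other hi hj, vel_freeFlow, vel_freeFlow]
        simp only [fluxState, relState, vel_assemble_of_ne hi, fluxCollide, shiftRest, this,
          if_false]
  · rw [noise_collide, noise_freeFlow, noise_freeFlow]
    by_cases hi : k = i
    · subst hi
      simp only [fluxState, relState, noise_assemble_self, fluxCollide]
    · simp only [fluxState, relState, noise_assemble_of_ne hi, fluxCollide, shiftRest]

theorem measurable_collide (i j : Fin N) {X : Type*} [MeasurableSpace X] {u : X → E3}
    {z : X → State N} (hu' : Measurable u) (hz : Measurable z) :
    Measurable fun q => collide i j (u q) (z q) := by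
  have h : ∀ k, Measurable fun q => pos (z q) k := fun k => (continuous_pos k).measurable.comp hz
  have h' : ∀ k, Measurable fun q => vel (z q) k := fun k => (continuous_vel k).measurable.comp hz
  have hu : Measurable unitDir := by unfold unitDir; fun_prop
  unfold collide
  refine Measurable.prodMk (measurable_pi_iff.2 fun k => ?_) (by fun_prop)
  by_cases hj : k = j
  · subst hj
    simp only [Function.update_self]
    have := h k; have := h' i; have := h' k
    fun_prop
  · simp only [Function.update_of_ne hj]
    by_cases hi : k = i
    · subst hi
      simp only [Function.update_self]
      have := h k; have := h' j; have := h' k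
      fun_prop
    · simp only [Function.update_of_ne hi]
      fun_prop

/-- The flow through a collision preserves the measure. -/
theorem measure_image_collision (hε : 0 < ε) (hij : i ≠ j) {Q : Set (State N × E3 × ℝ)}
    (hm : MeasurableSet Q)
    (hQ : ∀ q ∈ Q, proj q.2.1 = pos q.1 i - pos q.1 j ∧ ‖q.2.1‖ = ε ∧
      inner ℝ q.2.1 (vel q.1 i - vel q.1 j) < 0)
    (hinj : InjOn (fun q : State N × E3 × ℝ => freeFlow (-q.2.2) q.1) Q)
    (hinj' : InjOn (fun q : State N × E3 × ℝ => freeFlow (-q.2.2) (collide i j q.2.1 q.1)) Q) :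
    phaseMeasure N ((fun q => freeFlow (-q.2.2) (collide i j q.2.1 q.1)) '' Q) =
      phaseMeasure N ((fun q => freeFlow (-q.2.2) q.1) '' Q) := by
  set C : State N × E3 × ℝ → State N × E3 × ℝ := fun q => (collide i j q.2.1 q.1, q.2) with hC
  have hCm : Measurable C := (measurable_collide i j (measurable_fst.comp measurable_snd)
    measurable_fst).prodMk measurable_snd
  have hCC : ∀ q, q.2.1 ≠ 0 → C (C q) = q := fun q hq => by
    simp only [hC, collide_collide hij hq]
  have hne : ∀ q ∈ Q, q.2.1 ≠ 0 := fun q hq h => by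
    have := (hQ q hq).2.1
    rw [h, norm_zero] at this
    exact hε.ne this
  -- The contacts after collision, obtained as a preimage because `C` is an involution away from `u
  -- = 0`.
  set Q' : Set (State N × E3 × ℝ) := {q | q.2.1 ≠ 0 ∧ C q ∈ Q}
  have hQ'm : MeasurableSet Q' := by
    refine MeasurableSet.inter ?_ (hCm hm)
    have : Measurable fun q : State N × E3 × ℝ => q.2.1 := by fun_prop
    exact (this (measurableSet_singleton 0)).compl
  have himg : (fun q : State N × E3 × ℝ => freeFlow (-q.2.2) (collide i j q.2.1 q.1)) '' Q =
      (fun q : State N × E3 × ℝ => freeFlow (-q.2.2) q.1) '' Q' := by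
    ext z
    constructor
    · rintro ⟨q, hq, rfl⟩
      exact ⟨C q, ⟨hne q hq, by rwa [hCC q (hne q hq)]⟩, rfl⟩
    · rintro ⟨q, ⟨hq0, hq⟩, rfl⟩
      refine ⟨C q, hq, ?_⟩
      simp only [hC, collide_collide hij hq0]
  have hQ' : ∀ q ∈ Q', proj q.2.1 = pos q.1 i - pos q.1 j ∧ ‖q.2.1‖ = ε ∧
      0 < (1 : ℝ) * inner ℝ q.2.1 (vel q.1 i - vel q.1 j) := by
    rintro q ⟨hq0, hq⟩
    obtain ⟨h1, h2, h3⟩ := hQ _ hq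
    simp only [hC, pos_collide] at h1 h2 h3
    refine ⟨h1, h2, ?_⟩
    have h4 := inner_vel_collide hij hq0 q.1
    rw [unitDir_inner, unitDir_inner, ← mul_neg] at h4
    have h5 := mul_left_cancel₀ (inv_ne_zero (norm_ne_zero_iff.2 hq0)) h4
    rw [h5] at h3
    linarith
  have hinjQ' : InjOn (fun q : State N × E3 × ℝ => freeFlow (-q.2.2) q.1) Q' := by
    rintro q ⟨hq0, hq⟩ q' ⟨hq0', hq'⟩ h
    have := hinj' hq hq' (by simpa only [hC, collide_collide hij hq0, collide_collide hij hq0'] using h)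
    rw [← hCC q hq0, ← hCC q' hq0', this]
  rw [himg, measure_image_contact hε hij (σ := 1) hQ'm hQ' hinjQ',
    measure_image_contact hε hij (σ := -1) hm (fun q hq => by
      obtain ⟨h1, h2, h3⟩ := hQ q hq
      exact ⟨h1, h2, by linarith⟩) hinj]
  have hflux : fluxSet ε hij Q' = fluxCollide hij ⁻¹' fluxSet ε hij Q := by
    ext p
    have h0 : ε • nu p.1 ≠ 0 := smul_ne_zero hε.ne' fun h => by
      have := norm_nu p.1
      simp [h] at this
    have h1 : (freeFlow ((fluxCollide hij p).1 2) (fluxState ε hij (fluxCollide hij p)),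
        ε • nu (fluxCollide hij p).1, (fluxCollide hij p).1 2) =
        C (freeFlow (p.1 2) (fluxState ε hij p), ε • nu p.1, p.1 2) := by
      simp only [hC]
      rw [← freeFlow_fluxCollide hε hij p]
      rfl
    constructor
    · rintro ⟨ha, _, hq⟩
      refine ⟨ha, ?_⟩
      rw [h1]
      exact hq
    · rintro ⟨ha, hq⟩
      rw [h1] at hq
      exact ⟨ha, h0, hq⟩
  have hd : Measurable fun p : E3 × (E3 × (Noise × Rest N i)) => fluxDensity ε p.2.1 p.1 :=
    measurable_fluxDensity (measurable_fst.comp measurable_snd) measurable_fst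
  -- Both measures are flux integrals over sets that correspond under `fluxCollide`. The density
  -- agrees since it contains only |ν·V|.
  rw [hflux, ← (measurePreserving_fluxCollide (N := N) hij).setLIntegral_comp_preimage
    (measurableSet_fluxSet hij hm) hd]
  refine lintegral_congr fun p => ?_
  simp only [fluxCollide, fluxDensity, inner_nu_reflect, abs_neg]

end

/-! ### The cosine law and the shift of the noise -/

section


/-! ### Reflections preserve the measure -/

/-- The bi-infinite sequence with the entry `θ` at `0`. -/
def extendNoise (p : S2 × Noise) : ℤ → S2 := fun k => if h : k = 0 then p.1 else p.2 ⟨k, h⟩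

theorem measurable_extendNoise : Measurable extendNoise := by
  refine measurable_pi_iff.2 fun k => ?_
  unfold extendNoise
  split_ifs <;> fun_prop

/-- The laws of the entries of `extendNoise`. -/
def extendLaw (α : Measure S2) (k : ℤ) : Measure S2 := if h : k = 0 then α else angleLaw ⟨k, h⟩

instance (α : Measure S2) [IsProbabilityMeasure α] (k : ℤ) :
    IsProbabilityMeasure (extendLaw α k) := by
  unfold extendLaw
  split_ifs <;> infer_instance

theorem map_extendNoise (α : Measure S2) [IsProbabilityMeasure α] :
    (α.prod reflectionLaw).map extendNoise = Measure.infinitePi (extendLaw α) := by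
  classical
  refine Measure.eq_infinitePi _ fun s t ht => ?_
  rw [Measure.map_apply measurable_extendNoise (.pi s.countable_toSet fun k _ => ht k)]
  set s' : Finset ZStar := s.subtype (fun k => k ≠ 0)
  have h1 : extendNoise ⁻¹' (s : Set ℤ).pi t =
      (if (0 : ℤ) ∈ s then t 0 else univ) ×ˢ (s' : Set ZStar).pi fun k => t k.1 := by
    ext p
    simp only [mem_preimage, Set.mem_pi, mem_prod, extendNoise, Finset.mem_coe]
    constructor
    · intro h
      refine ⟨?_, fun k hk => ?_⟩
      · split_ifs with h0
        · simpa using h 0 h0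
        · trivial
      · have := h k.1 (Finset.mem_subtype.1 hk)
        simpa [k.2] using this
    · rintro ⟨h2, h3⟩ k hk
      by_cases h0 : k = 0
      · subst h0; simpa [hk] using h2
      · simpa [h0] using h3 ⟨k, h0⟩ (Finset.mem_subtype.2 hk)
  rw [h1, Measure.prod_prod, reflectionLaw, Measure.infinitePi_pi _ fun k _ => ht k.1]
  have h2 : ∏ k ∈ s', angleLaw k (t k.1) = ∏ k ∈ s.filter (fun k => k ≠ 0), extendLaw α k (t k) := by
    rw [← Finset.subtype_map (fun k : ℤ => k ≠ 0), Finset.prod_map]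
    refine Finset.prod_congr rfl fun k _ => ?_
    simp [extendLaw, k.2]
  rw [h2]
  by_cases h0 : (0 : ℤ) ∈ s
  · rw [if_pos h0, Finset.filter_ne', ← Finset.mul_prod_erase s _ h0]
    simp [extendLaw]
  · rw [if_neg h0, measure_univ, one_mul, Finset.filter_true_of_mem]
    rintro k hk rfl
    exact h0 hk

theorem cosDensity_congr {j k : ZStar} (h : j.1.sign = k.1.sign) : cosDensity j = cosDensity k := by
  unfold cosDensity
  rw [h]

theorem angleLaw_congr {j k : ZStar} (h : j.1.sign = k.1.sign) : angleLaw j = angleLaw k := by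
  unfold angleLaw
  rw [cosDensity_congr h]

theorem measurable_shiftNoise : Measurable fun p : S2 × Noise => shiftNoise p.1 p.2 := by
  refine measurable_pi_iff.2 fun k => ?_
  unfold shiftNoise
  split_ifs <;> fun_prop

/-- With the incoming direction as an independent entry at index 0, the map is the shift of a
sequence of independent directions indexed by all integers. Before the shift the indices ≤ 0 carry
the law of the outer hemisphere and the indices ≥ 1 that of the inner one. After it the border lies
between −1 and 0, so the entry at 0, the outgoing direction, has the law of ω^1. -/
theorem measurePreserving_shiftNoise : MeasurePreserving
    (fun p : S2 × Noise => (p.2 ⟨1, by decide⟩, shiftNoise p.1 p.2))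
    ((angleLaw ⟨-1, by decide⟩).prod reflectionLaw) ((angleLaw ⟨1, by decide⟩).prod reflectionLaw) := by
  set R : (ℤ → S2) → S2 × Noise := fun X => (X 0, fun k => X k.1)
  have hR : Measurable R := by fun_prop
  have hRE : ∀ p, R (extendNoise p) = p := by
    rintro ⟨θ, ω⟩
    refine Prod.ext (by simp [R, extendNoise]) (funext fun k => by simp [R, extendNoise, k.2])
  set e : ℤ ≃ ℤ := Equiv.subRight 1
  set S : (ℤ → S2) → ℤ → S2 := ⇑(MeasurableEquiv.piCongrLeft (fun _ : ℤ => S2) e)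
  have hS : Measurable S := (MeasurableEquiv.piCongrLeft (fun _ : ℤ => S2) e).measurable
  have hSX : ∀ X k, S X k = X (k + 1) := by
    intro X k
    have := MeasurableEquiv.piCongrLeft_apply_apply (β := fun _ : ℤ => S2) e X (k + 1)
    simpa [e] using this
  have hM : Measurable fun p : S2 × Noise =>
      ((p.2 ⟨1, by decide⟩, shiftNoise p.1 p.2) : S2 × Noise) :=
    Measurable.prodMk (by fun_prop) measurable_shiftNoise
  refine ⟨hM, ?_⟩
  have hcomp : (fun p : S2 × Noise => ((p.2 ⟨1, by decide⟩, shiftNoise p.1 p.2) : S2 × Noise)) =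
      R ∘ S ∘ extendNoise := by
    funext p
    refine Prod.ext ?_ (funext fun k => ?_)
    · simp [R, hSX, extendNoise]
    · simp only [R, Function.comp_apply, hSX, extendNoise, shiftNoise]
      by_cases h : k.1 = -1
      · simp [h]
      · have h' : ¬ k.1 + 1 = 0 := by omega
        simp [h, h']
  have hlaw : (fun k => extendLaw (angleLaw ⟨1, by decide⟩) (e k)) =
      extendLaw (angleLaw ⟨-1, by decide⟩) := by
    funext k
    simp only [extendLaw, e, Equiv.subRight_apply]
    by_cases h0 : k = 0
    · subst h0
      simp
    by_cases h1 : k - 1 = 0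
    · obtain rfl : k = 1 := by omega
      simp
    simp only [h0, h1, dif_neg, not_false_eq_true]
    refine angleLaw_congr ?_
    rcases lt_or_gt_of_ne h0 with h | h
    · rw [Int.sign_eq_neg_one_of_neg h, Int.sign_eq_neg_one_of_neg (by simp only; omega)]
    · rw [Int.sign_eq_one_of_pos h, Int.sign_eq_one_of_pos (by simp only; omega)]
  have hSmap := Measure.infinitePi_map_piCongrLeft (extendLaw (angleLaw ⟨1, by decide⟩)) e
  rw [hlaw] at hSmap
  rw [hcomp, ← Measure.map_map hR (hS.comp measurable_extendNoise),
    ← Measure.map_map hS measurable_extendNoise, map_extendNoise, hSmap, ← map_extendNoise,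
    Measure.map_map hR measurable_extendNoise]
  have : R ∘ extendNoise = id := funext hRE
  rw [this, Measure.map_id]

/-- Polar coordinates. -/
def polar (p : S2 × Ioi (0 : ℝ)) : E3 := (p.2 : ℝ) • (p.1 : E3)

theorem measurable_polar : Measurable polar := by
  unfold polar
  fun_prop

theorem measurePreserving_polar :
    MeasurePreserving polar (surface.prod (Measure.volumeIoiPow 2)) volume := by
  have h1 := (volume : Measure E3).measurePreserving_homeomorphUnitSphereProd
  have h2 : MeasurePreserving (homeomorphUnitSphereProd E3).symm
      (surface.prod (Measure.volumeIoiPow 2)) (Measure.comap (↑) (volume : Measure E3)) := by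
    have := MeasurePreserving.symm (homeomorphUnitSphereProd E3).toMeasurableEquiv h1
    rw [finrank_euclideanSpace_fin] at this
    exact this
  refine ⟨measurable_polar, ?_⟩
  have h3 : polar = (↑) ∘ (homeomorphUnitSphereProd E3).symm := by
    funext p
    simp [polar]
  rw [h3, ← Measure.map_map measurable_subtype_coe h2.measurable, h2.map_eq,
    map_comap_subtype_coe (measurableSet_singleton _).compl,
    restrict_compl_singleton]

/-- The radial measure of the flux. -/
def radial : Measure (Ioi (0 : ℝ)) :=
  (Measure.volumeIoiPow 2).withDensity fun r => ENNReal.ofReal r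

instance : SFinite radial := by unfold radial; infer_instance

/-- The flux density of a wall. -/
def wallFlux (s : ℝ) : Measure E3 := volume.withDensity fun v => ENNReal.ofReal (s * v 0)

/-- In polar coordinates v = rω, the density (s v·e)₊ dv becomes (s ω·e)₊ dω times r · r² dr. This
is where the reflection law has to be the cosine law. The truncation at 0 in `ENNReal.ofReal`
discards the velocities of the wrong sign. -/
theorem wallFlux_eq_map (j : ZStar) : wallFlux (j.1.sign : ℝ) =
    ((surface.withDensity (cosDensity j)).prod radial).map polar := by
  have hfin : IsFiniteMeasure surface := by unfold surface; infer_instance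
  have hd : Measurable fun v : E3 => ENNReal.ofReal ((j.1.sign : ℝ) * v 0) := by fun_prop
  rw [radial, prod_withDensity (measurable_cosDensity j) (by fun_prop)]
  ext A hA
  rw [Measure.map_apply measurable_polar hA, wallFlux, withDensity_apply _ hA,
    withDensity_apply _ (measurable_polar hA),
    ← measurePreserving_polar.setLIntegral_comp_preimage hA hd]
  refine lintegral_congr fun p => ?_
  simp only [polar, cosDensity, PiLp.smul_apply, smul_eq_mul]
  rw [← ENNReal.ofReal_mul' (le_of_lt p.2.2)]
  congr 1
  ring

theorem wallFlux_one : wallFlux 1 = wallFlux ((⟨1, by decide⟩ : ZStar).1.sign : ℝ) := by simp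

theorem wallFlux_neg_one : wallFlux (-1) = wallFlux ((⟨-1, by decide⟩ : ZStar).1.sign : ℝ) := by
  simp

theorem measurePreserving_neg_wallFlux (s : ℝ) :
    MeasurePreserving (fun v : E3 => -v) (wallFlux s) (wallFlux (-s)) := by
  refine ⟨measurable_neg, ?_⟩
  ext A hA
  rw [Measure.map_apply measurable_neg hA, wallFlux, wallFlux, withDensity_apply _ hA,
    withDensity_apply _ (measurable_neg hA),
    ← (Measure.measurePreserving_neg (volume : Measure E3)).setLIntegral_comp_preimage hA
      (by fun_prop)]
  simp

theorem surface_neg {A : Set S2} (hA : MeasurableSet A) :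
    surface ((fun θ => -θ) ⁻¹' A) = surface A := by
  have hm : Measurable fun θ : S2 => -θ := continuous_neg.measurable
  rw [surface, Measure.toSphere_apply' _ (hm hA), Measure.toSphere_apply' _ hA]
  congr 1
  rw [← Measure.measure_neg]
  congr 1
  have : ((↑) '' ((fun θ : S2 => -θ) ⁻¹' A) : Set E3) = -((↑) '' A) := by
    ext x
    constructor
    · rintro ⟨θ, hθ, rfl⟩
      exact ⟨-θ, hθ, by simp⟩
    · rintro ⟨θ, hθ, h⟩
      exact ⟨-θ, by simpa using hθ, by simp [h]⟩
  rw [this]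
  ext x
  simp only [Set.mem_neg, Set.mem_smul]
  constructor
  · rintro ⟨r, hr, y, hy, h⟩
    exact ⟨r, hr, -y, hy, by rw [smul_neg, h, neg_neg]⟩
  · rintro ⟨r, hr, y, hy, h⟩
    exact ⟨r, hr, -y, by rwa [neg_neg], by rw [smul_neg, h]⟩

theorem measurePreserving_neg_surface :
    MeasurePreserving (fun θ : S2 => -θ) surface surface := by
  have hm : Measurable fun θ : S2 => -θ := continuous_neg.measurable
  refine ⟨hm, ?_⟩
  ext A hA
  rw [Measure.map_apply hm hA, surface_neg hA]

/-- The normalizing constant of the reflection law. -/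
def fluxMass : ℝ≥0∞ := ∫⁻ ω, cosDensity ⟨1, by decide⟩ ω ∂surface

/-- By the antipodal symmetry, incoming and outgoing flux have the same total angular mass, so the
constants of both hemispheres cancel. -/
theorem fluxMass_eq : ∫⁻ ω, cosDensity ⟨-1, by decide⟩ ω ∂surface = fluxMass := by
  rw [fluxMass, ← measurePreserving_neg_surface.lintegral_comp (measurable_cosDensity _)]
  refine lintegral_congr fun ω => ?_
  simp [cosDensity]

theorem lintegral_cosDensity_ne (j : ZStar) : ∫⁻ ω, cosDensity j ω ∂surface ≠ 0 ∧
    ∫⁻ ω, cosDensity j ω ∂surface ≠ ∞ := by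
  have h : angleLaw j univ = 1 := measure_univ
  rw [angleLaw, Measure.smul_apply, withDensity_apply _ MeasurableSet.univ, setLIntegral_univ,
    smul_eq_mul] at h
  constructor
  · intro h0
    rw [h0] at h
    simp at h
  · intro h0
    rw [h0] at h
    simp at h

theorem withDensity_cosDensity (j : ZStar) : surface.withDensity (cosDensity j) =
    (∫⁻ ω, cosDensity j ω ∂surface) • angleLaw j := by
  obtain ⟨h0, h1⟩ := lintegral_cosDensity_ne j
  rw [angleLaw, smul_smul, ENNReal.mul_inv_cancel h0 h1, one_smul]

theorem wallFlux_one_eq : wallFlux 1 =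
    fluxMass • ((angleLaw ⟨1, by decide⟩).prod radial).map polar := by
  rw [wallFlux_one, wallFlux_eq_map, withDensity_cosDensity, Measure.prod_smul_left,
    Measure.map_smul]
  rfl

theorem wallFlux_neg_one_eq : wallFlux (-1) =
    fluxMass • ((angleLaw ⟨-1, by decide⟩).prod radial).map polar := by
  rw [wallFlux_neg_one, wallFlux_eq_map, withDensity_cosDensity, Measure.prod_smul_left,
    Measure.map_smul, fluxMass_eq]

/-- The effect of a reflection on the velocity and the noise. -/
def wallMap (Γ : ℝ) (p : E3 × Noise) : E3 × Noise :=
  ((‖p.1‖ * Γ) • (p.2 ⟨1, by decide⟩ : E3), shiftNoise (dirS2 (Γ • p.1)) p.2)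

theorem measurable_dirS2 : Measurable dirS2 := by
  have h : (fun v : E3 => (dirS2 v : E3)) =
      fun v => if v = 0 then EuclideanSpace.single 0 1 else ‖v‖⁻¹ • v := by
    funext v
    by_cases hv : v = 0 <;> simp [dirS2, hv]
  have h' : Measurable fun v : E3 => (dirS2 v : E3) := by
    rw [h]
    exact Measurable.ite (measurableSet_singleton 0) measurable_const (by fun_prop)
  exact h'.subtype_mk (h := fun v => (dirS2 v).2)

theorem measurable_wallMap (Γ : ℝ) : Measurable (wallMap Γ) := by
  unfold wallMap
  refine Measurable.prodMk (by fun_prop) (measurable_shiftNoise.comp (Measurable.prodMk ?_ ?_))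
  · exact measurable_dirS2.comp (by fun_prop)
  · exact measurable_snd

theorem measurePreserving_prod_right_comm {A B C : Type*} [MeasurableSpace A] [MeasurableSpace B]
    [MeasurableSpace C] (μ : Measure A) (ν : Measure B) (τ : Measure C) [SFinite μ] [SFinite ν]
    [SFinite τ] : MeasurePreserving (fun p : (A × B) × C => ((p.1.1, p.2), p.1.2))
      ((μ.prod ν).prod τ) ((μ.prod τ).prod ν) := by
  have h1 := (MeasurePreserving.id μ).prod (Measure.measurePreserving_swap (μ := ν) (ν := τ))
  exact ((measurePreserving_prodAssoc μ τ ν).symm.comp h1).comp (measurePreserving_prodAssoc μ ν τ)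

instance (s : ℝ) : SFinite (wallFlux s) := by unfold wallFlux; infer_instance

/-- In polar coordinates the speed is a spectator: the incoming direction and the noise undergo the
shift of `measurePreserving_shiftNoise`. -/
theorem measurePreserving_wallMap_one : MeasurePreserving (wallMap 1)
    ((wallFlux (-1)).prod reflectionLaw) ((wallFlux 1).prod reflectionLaw) := by
  refine ⟨measurable_wallMap 1, ?_⟩
  have hP : ∀ j : ZStar, (((angleLaw j).prod radial).map polar).prod reflectionLaw =
      (((angleLaw j).prod radial).prod reflectionLaw).map (Prod.map polar id) := by
    intro j
    conv_lhs => rw [← Measure.map_id (μ := reflectionLaw)]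
    rw [Measure.map_prod_map _ _ measurable_polar measurable_id]
  have hpm : Measurable (Prod.map polar (id : Noise → Noise)) :=
    measurable_polar.prodMap measurable_id
  have h1 := (measurePreserving_prod_right_comm (angleLaw ⟨1, by decide⟩) reflectionLaw radial).comp
    ((measurePreserving_shiftNoise.prod (MeasurePreserving.id radial)).comp
      (measurePreserving_prod_right_comm (angleLaw ⟨-1, by decide⟩) radial reflectionLaw))
  rw [wallFlux_one_eq, wallFlux_neg_one_eq, Measure.prod_smul_left, Measure.prod_smul_left,
    Measure.map_smul, hP, hP, Measure.map_map (measurable_wallMap 1) hpm, ← h1.map_eq,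
    Measure.map_map hpm h1.measurable]
  congr 2
  funext p
  obtain ⟨⟨θ, r⟩, ω⟩ := p
  have hr : (0 : ℝ) < r := r.2
  refine Prod.ext ?_ ?_
  · simp [wallMap, polar, norm_smul, abs_of_pos hr]
  · simp [wallMap, polar, dirS2_smul_sphere hr]

/-- The case Γ = −1 is the case Γ = 1 conjugated by v ↦ −v. -/
theorem measurePreserving_wallMap {Γ : ℝ} (hΓ : Γ * Γ = 1) : MeasurePreserving (wallMap Γ)
    ((wallFlux (-Γ)).prod reflectionLaw) ((wallFlux Γ).prod reflectionLaw) := by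
  rcases mul_self_eq_one_iff.1 hΓ with rfl | rfl
  · exact measurePreserving_wallMap_one
  · have h1 := (measurePreserving_neg_wallFlux 1).prod (MeasurePreserving.id reflectionLaw)
    have h2 := (measurePreserving_neg_wallFlux 1).prod (MeasurePreserving.id reflectionLaw)
    rw [neg_neg]
    have h3 := h2.comp (measurePreserving_wallMap_one.comp
      ((measurePreserving_neg_wallFlux 1).prod (MeasurePreserving.id reflectionLaw)))
    convert h3 using 1
    funext p
    refine Prod.ext ?_ ?_
    · simp [wallMap]
    · simp [wallMap]

end

/-! ### Invariance of the flux at the walls -/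

section

variable {ε : ℝ} {i : Fin N}

/-- For fixed data the map has slope −c in the time variable, and σ records the sign of c, so that
σc is the Jacobian. -/
theorem measure_image_affine {Y : Type*} [MeasurableSpace Y] [StandardBorelSpace Y]
    {ρ : Measure Y} [SFinite ρ] {b σ : ℝ} (hσ : σ * σ = 1) {c : Y → ℝ} (hc : Measurable c)
    {Q : Set (ℝ × Y)} (hm : MeasurableSet Q) (hs : ∀ p ∈ Q, 0 < σ * c p.2) :
    (volume : Measure ℝ).prod ρ ((fun p => (b - p.1 * c p.2, p.2)) '' Q) =
      ∫⁻ p in Q, ENNReal.ofReal (σ * c p.2) ∂(volume : Measure ℝ).prod ρ := by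
  have hf : Measurable fun p : ℝ × Y => (b - p.1 * c p.2, p.2) := by fun_prop
  have hne : ∀ p ∈ Q, c p.2 ≠ 0 := fun p hp h => by
    have := hs p hp
    simp [h] at this
  have hinj1 : ∀ y, InjOn (fun t => b - t * c y) {t | (t, y) ∈ Q} := by
    intro y t ht t' ht' h
    exact mul_right_cancel₀ (hne _ ht) (sub_right_inj.1 h)
  have hinj : InjOn (fun p : ℝ × Y => (b - p.1 * c p.2, p.2)) Q := by
    rintro ⟨t, y⟩ ht ⟨t', y'⟩ ht' h
    simp only [Prod.mk.injEq] at h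
    obtain ⟨h, rfl⟩ := h
    have : t = t' := hinj1 y ht ht' h
    rw [this]
  have hd : Measurable fun p : ℝ × Y => ENNReal.ofReal (σ * c p.2) := by fun_prop
  rw [Measure.prod_apply_symm (measurableSet_image_of_injOn hf hm hinj), ← lintegral_indicator hm,
    lintegral_prod_symm' _ (hd.indicator hm)]
  refine lintegral_congr fun y => ?_
  have hy : MeasurableSet {t | (t, y) ∈ Q} := measurable_prodMk_right hm
  have he : (fun x => (x, y)) ⁻¹' ((fun p : ℝ × Y => (b - p.1 * c p.2, p.2)) '' Q) =
      (fun t => b - t * c y) '' {t | (t, y) ∈ Q} := by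
    ext x
    constructor
    · rintro ⟨⟨a, y'⟩, ha, h⟩
      simp only [Prod.mk.injEq] at h
      obtain ⟨h, rfl⟩ := h
      exact ⟨a, ha, h⟩
    · rintro ⟨a, ha, rfl⟩
      exact ⟨(a, y), ha, rfl⟩
  have h := lintegral_image_eq_lintegral_abs_deriv_mul hy (f := fun t => b - t * c y)
    (f' := fun _ => -c y) (fun t _ => by
      have := ((hasDerivAt_id t).mul_const (c y)).const_sub b
      simpa using this.hasDerivWithinAt) (hinj1 y) fun _ => 1
  simp only [mul_one, lintegral_one, Measure.restrict_apply MeasurableSet.univ, univ_inter] at h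
  rw [he, h, ← lintegral_indicator hy]
  refine lintegral_congr fun t => ?_
  by_cases ht : (t, y) ∈ Q
  · have h1 := hs _ ht
    rw [indicator_of_mem (show t ∈ {t | (t, y) ∈ Q} from ht), indicator_of_mem ht, abs_neg]
    congr 1
    rcases mul_self_eq_one_iff.1 hσ with rfl | rfl
    · rw [one_mul] at h1 ⊢
      exact abs_of_pos h1
    · rw [neg_one_mul] at h1 ⊢
      exact abs_of_neg (by simpa using h1)
  · rw [indicator_of_notMem (show t ∉ {t | (t, y) ∈ Q} from ht), indicator_of_notMem ht]

/-- The state at time `-p.1` before (or after) a contact with the wall `x₁ = b`. -/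
def wallState (b : ℝ) (i : Fin N)
    (p : ℝ × ((UnitAddCircle × UnitAddCircle) × (E3 × (Noise × Rest N i)))) : State N :=
  assemble i (((b, p.2.1) : Pos) - proj (p.1 • p.2.2.1), p.2.2)

/-- The flux of the contacts with a wall. -/
def wallMeasure (i : Fin N) (σ : ℝ) :
    Measure (ℝ × ((UnitAddCircle × UnitAddCircle) × (E3 × (Noise × Rest N i)))) :=
  volume.prod (volume.prod ((wallFlux σ).prod (reflectionLaw.prod (restMeasure N i))))

theorem wallMeasure_eq (i : Fin N) (σ : ℝ) : wallMeasure i σ =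
    (volume.prod (volume.prod (dataMeasure N i))).withDensity
      fun p => ENNReal.ofReal (σ * p.2.2.1 0) := by
  rw [wallMeasure, wallFlux, prod_withDensity_left (by fun_prop), prod_withDensity_right (by fun_prop),
    prod_withDensity_right (by fun_prop), dataMeasure]

/-- The parameters of the contacts in `Q`. -/
def wallSet (b : ℝ) (i : Fin N) (Q : Set (State N × ℝ)) :
    Set (ℝ × ((UnitAddCircle × UnitAddCircle) × (E3 × (Noise × Rest N i)))) :=
  {p | (freeFlow p.1 (wallState b i p), p.1) ∈ Q}

theorem measurable_wallState (b : ℝ) (i : Fin N) : Measurable (wallState b i) := by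
  refine (measurePreserving_assemble i).measurable.comp (Measurable.prodMk ?_ ?_)
  · have hpr : Measurable proj := continuous_proj.measurable
    fun_prop
  · fun_prop

theorem measurableSet_wallSet (b : ℝ) {Q : Set (State N × ℝ)} (hQ : MeasurableSet Q) :
    MeasurableSet (wallSet b i Q) :=
  ((measurable_freeFlow measurable_fst (measurable_wallState b i)).prodMk measurable_fst) hQ

theorem pos_wallState (b : ℝ) (i : Fin N) (p) : pos (freeFlow p.1 (wallState b i p)) i = (b, p.2.1) := by
  rw [pos_freeFlow, wallState, pos_assemble_self, vel_assemble_self]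
  simp

theorem wallState_injOn {b : ℝ} {t : ℝ}
    {p p' : (UnitAddCircle × UnitAddCircle) × (E3 × (Noise × Rest N i))}
    (h : wallState b i (t, p) = wallState b i (t, p')) : p = p' := by
  have h1 := assemble_injective i h
  simp only [Prod.mk.injEq] at h1
  obtain ⟨h2, h3⟩ := h1
  rw [h3] at h2
  have := sub_left_injective h2
  exact Prod.ext (congrArg Prod.snd this) h3

/-- The measure of a set of states that are reached by free motion from contacts with a wall. -/
theorem measure_image_wallContact {b σ : ℝ} (hσ : σ * σ = 1) {Q : Set (State N × ℝ)}
    (hm : MeasurableSet Q)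
    (hQ : ∀ q ∈ Q, (pos q.1 i).1 = b ∧ 0 < σ * vel q.1 i 0)
    (hinj : InjOn (fun q : State N × ℝ => freeFlow (-q.2) q.1) Q) :
    phaseMeasure N ((fun q => freeFlow (-q.2) q.1) '' Q) = wallMeasure i σ (wallSet b i Q) := by
  set S := wallSet b i Q
  have hS : MeasurableSet S := measurableSet_wallSet b hm
  have hsgn : ∀ p ∈ S, 0 < σ * p.2.2.1 0 := by
    intro p hp
    have h := (hQ _ hp).2
    simpa only [vel_freeFlow, wallState, vel_assemble_self] using h
  have hfinj : InjOn (wallState b i) S := by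
    rintro ⟨t, p⟩ hp ⟨t', p'⟩ hp' h
    have h1 := hinj hp hp' (by simp only [freeFlow_freeFlow, neg_add_cancel, freeFlow_zero, h])
    simp only [Prod.mk.injEq] at h1
    obtain rfl := h1.2
    rw [wallState_injOn h]
  have himg : (fun q : State N × ℝ => freeFlow (-q.2) q.1) '' Q = wallState b i '' S := by
    ext z
    constructor
    · rintro ⟨⟨ζ, t⟩, hq, rfl⟩
      have h1 := (hQ _ hq).1
      simp only at h1
      have hst : wallState b i (t, ((pos ζ i).2, (disassemble i (freeFlow (-t) ζ)).2)) =
          freeFlow (-t) ζ := by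
        rw [← assemble_disassemble i (freeFlow (-t) ζ), wallState]
        refine congrArg (assemble i) (Prod.ext ?_ ?_)
        · rw [assemble_disassemble]
          have h2 : ((b, (pos ζ i).2) : Pos) = pos ζ i := Prod.ext h1.symm rfl
          simp only [disassemble, pos_freeFlow, vel_freeFlow, neg_smul, proj_neg, h2]
          rw [sub_eq_add_neg]
        · rw [assemble_disassemble]
      refine ⟨_, ?_, hst⟩
      show (freeFlow t _, t) ∈ Q
      rw [hst, freeFlow_freeFlow, add_neg_cancel, freeFlow_zero]
      exact hq
    · rintro ⟨p, hp, rfl⟩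
      exact ⟨_, hp, by simp [freeFlow_freeFlow]⟩
  have hpr : Measurable proj := continuous_proj.measurable
  set P : ℝ × ((UnitAddCircle × UnitAddCircle) × (E3 × (Noise × Rest N i))) →
      ℝ × ((UnitAddCircle × UnitAddCircle) × (E3 × (Noise × Rest N i))) :=
    fun p => (p.1, (p.2.1 + -(proj (p.1 • p.2.2.1)).2, p.2.2)) with hPdef
  set T : ℝ × ((UnitAddCircle × UnitAddCircle) × (E3 × (Noise × Rest N i))) →
      ℝ × ((UnitAddCircle × UnitAddCircle) × (E3 × (Noise × Rest N i))) :=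
    fun p => (b - p.1 * p.2.2.1 0, p.2) with hTdef
  set R : ℝ × ((UnitAddCircle × UnitAddCircle) × (E3 × (Noise × Rest N i))) → State N :=
    fun p => assemble i ((p.1, p.2.1), p.2.2) with hRdef
  -- A shear in the torus coordinates, then the affine motion orthogonal to the wall, then the
  -- assembling of the state. Only the middle map has a Jacobian, the normal velocity.
  have hcomp : wallState b i = R ∘ T ∘ P := by
    funext p
    simp only [hRdef, hTdef, hPdef, wallState, Function.comp_apply]
    refine congrArg (assemble i) (Prod.ext (Prod.ext ?_ ?_) rfl)
    · simp [proj]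
    · simp [sub_eq_add_neg]
  have hPm : MeasurePreserving P (volume.prod (volume.prod (dataMeasure N i)))
      (volume.prod (volume.prod (dataMeasure N i))) := by
    refine (MeasurePreserving.id _).skew_product (f := id)
      (g := fun t (p : (UnitAddCircle × UnitAddCircle) × (E3 × (Noise × Rest N i))) =>
        (p.1 + -(proj (t • p.2.1)).2, p.2)) (by fun_prop) (ae_of_all _ fun t => ?_)
    refine (measurePreserving_skew_fst (g := fun (y : E3 × (Noise × Rest N i)) x => x + -(proj (t • y.1)).2) (by fun_prop)
      fun y => ?_).map_eq
    exact (measurePreserving_add_right volume _).prod (measurePreserving_add_right volume _)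
  have hPi : Function.Injective P := by
    rintro ⟨t, q, y⟩ ⟨t', q', y'⟩ h
    simp only [hPdef, Prod.mk.injEq] at h
    obtain ⟨rfl, h, rfl⟩ := h
    rw [add_right_cancel h]
  have hRm : MeasurePreserving R (volume.prod (volume.prod (dataMeasure N i))) (phaseMeasure N) :=
    (measurePreserving_assemble i).comp (measurePreserving_prodAssoc volume volume (dataMeasure N i)).symm
  have hRi : Function.Injective R := by
    intro p p' h
    have := assemble_injective i h
    simp only [Prod.mk.injEq] at this
    exact Prod.ext this.1.1 (Prod.ext this.1.2 this.2)
  have hPS : MeasurableSet (P '' S) := measurableSet_image_of_injOn hPm.measurable hS hPi.injOn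
  have hTm : Measurable T := by fun_prop
  have hsgn' : ∀ p ∈ P '' S, 0 < σ * p.2.2.1 0 := by
    rintro _ ⟨p, hp, rfl⟩
    exact hsgn p hp
  have hTi : InjOn T (P '' S) := by
    rintro ⟨t, p⟩ hp ⟨t', p'⟩ hp' h
    simp only [hTdef, Prod.mk.injEq] at h
    obtain ⟨h, rfl⟩ := h
    have h0 : p.2.1 0 ≠ 0 := fun h0 => by
      have := hsgn' _ hp
      simp [h0] at this
    rw [mul_right_cancel₀ h0 (sub_right_inj.1 h)]
  have hTS : MeasurableSet (T '' (P '' S)) := measurableSet_image_of_injOn hTm hPS hTi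
  rw [himg, hcomp, image_comp, image_comp, ← hRm.measure_preimage
    (measurableSet_image_of_injOn hRm.measurable hTS hRi.injOn).nullMeasurableSet,
    preimage_image_eq _ hRi,
    measure_image_affine hσ (c := fun y : (UnitAddCircle × UnitAddCircle) ×
      (E3 × (Noise × Rest N i)) => y.2.1 0) (by fun_prop) hPS hsgn',
    ← hPm.setLIntegral_comp_preimage hPS (by fun_prop), preimage_image_eq _ hPi,
    wallMeasure_eq, withDensity_apply _ hS]

/-- The density vanishes where the normal velocity has the wrong sign. This discards spurious
parameters in the preimage under `wallReflect`, which ignores that sign. -/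
theorem wallMeasure_inter (σ : ℝ)
    (A : Set (ℝ × ((UnitAddCircle × UnitAddCircle) × (E3 × (Noise × Rest N i))))) :
    wallMeasure i σ (A ∩ {p | 0 < σ * p.2.2.1 0}) = wallMeasure i σ A := by
  refine measure_inter_conull ?_
  have hm : MeasurableSet {p : ℝ × ((UnitAddCircle × UnitAddCircle) × (E3 × (Noise × Rest N i))) |
      0 < σ * p.2.2.1 0} := measurableSet_lt (by fun_prop) (by fun_prop)
  rw [wallMeasure_eq, withDensity_apply _ hm.compl, setLIntegral_eq_zero_iff hm.compl (by fun_prop)]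
  refine ae_of_all _ fun p hp => ?_
  exact ENNReal.ofReal_of_nonpos (not_lt.1 hp)

instance (σ : ℝ) : SFinite ((wallFlux σ).prod (reflectionLaw.prod (restMeasure N i))) :=
  inferInstance

/-- The reflection in the coordinates of `wallState`. -/
def wallReflect (i : Fin N) (Γ : ℝ)
    (p : ℝ × ((UnitAddCircle × UnitAddCircle) × (E3 × (Noise × Rest N i)))) :
    ℝ × ((UnitAddCircle × UnitAddCircle) × (E3 × (Noise × Rest N i))) :=
  (p.1, (p.2.1, ((wallMap Γ (p.2.2.1, p.2.2.2.1)).1, ((wallMap Γ (p.2.2.1, p.2.2.2.1)).2,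
    p.2.2.2.2))))

theorem measurePreserving_wallReflect {Γ : ℝ} (hΓ : Γ * Γ = 1) :
    MeasurePreserving (wallReflect i Γ) (wallMeasure i (-Γ)) (wallMeasure i Γ) := by
  have h1 := (measurePreserving_prodAssoc (wallFlux Γ) reflectionLaw (restMeasure N i)).comp
    (((measurePreserving_wallMap hΓ).prod (MeasurePreserving.id (restMeasure N i))).comp
      (measurePreserving_prodAssoc (wallFlux (-Γ)) reflectionLaw (restMeasure N i)).symm)
  exact (MeasurePreserving.id _).prod ((MeasurePreserving.id _).prod h1)

theorem measurable_wallSign : Measurable wallSign := by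
  unfold wallSign
  exact Measurable.ite (measurable_fst (measurableSet_singleton 0)) measurable_const measurable_const

theorem measurable_jump_reflection (i : Fin N) :
    Measurable (jump (.reflection i) : State N → State N) := by
  have h : ∀ k, Measurable fun z : State N => pos z k := fun k => (continuous_pos k).measurable
  have h' : ∀ k, Measurable fun z : State N => vel z k := fun k => (continuous_vel k).measurable
  have h'' : ∀ k, Measurable fun z : State N => noise z k := fun k => (continuous_noise k).measurable
  have hw : Measurable fun z : State N => wallSign (pos z i) := measurable_wallSign.comp (h i)
  unfold jump
  refine Measurable.prodMk (measurable_pi_iff.2 fun k => ?_) (measurable_pi_iff.2 fun k => ?_)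
  · by_cases hi : k = i
    · subst hi
      simp only [Function.update_self]
      have h1 := h k
      have h2 := h' k
      have h3 : Measurable fun z : State N => noise z k ⟨1, by decide⟩ :=
        (measurable_pi_apply _).comp (h'' k)
      exact h1.prodMk ((h2.norm.mul hw).smul (measurable_subtype_coe.comp h3))
    · simp only [Function.update_of_ne hi]
      fun_prop
  · by_cases hi : k = i
    · subst hi
      simp only [Function.update_self]
      exact measurable_shiftNoise.comp ((measurable_dirS2.comp (hw.smul (h' k))).prodMk (h'' k))
    · simp only [Function.update_of_ne hi]
      fun_prop

/-- The flow through a reflection preserves the measure. -/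
theorem measure_image_reflection (hε : 0 < ε) {b : ℝ} (hb : b = 0 ∨ b = 1) {Q : Set (State N × ℝ)}
    (hm : MeasurableSet Q)
    (hQ : ∀ q ∈ Q, (pos q.1 i).1 = b ∧ normalVel q.1 (.reflection i) < 0 ∧ noise q.1 i ∈ Omega)
    (hinj : InjOn (fun q : State N × ℝ => freeFlow (-q.2) q.1) Q)
    (hinj' : InjOn (fun q : State N × ℝ => freeFlow (-q.2) (jump (.reflection i) q.1)) Q) :
    phaseMeasure N ((fun q => freeFlow (-q.2) (jump (.reflection i) q.1)) '' Q) =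
      phaseMeasure N ((fun q => freeFlow (-q.2) q.1) '' Q) := by
  obtain ⟨Γ, hΓ, hw⟩ : ∃ Γ : ℝ, Γ * Γ = 1 ∧ ∀ x : Pos, x.1 = b → wallSign x = Γ := by
    rcases hb with rfl | rfl
    · exact ⟨1, by norm_num, fun x hx => by simp [wallSign, hx]⟩
    · exact ⟨-1, by norm_num, fun x hx => by simp [wallSign, hx]⟩
  have hshock : ∀ z : State N, (pos z i).1 = b → IsShock ε z (.reflection i) := by
    intro z hz
    rcases hb with rfl | rfl
    · exact Or.inl hz
    · exact Or.inr hz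
  set C : State N × ℝ → State N × ℝ := fun q => (jump (.reflection i) q.1, q.2) with hC
  have hCm : Measurable C := ((measurable_jump_reflection i).comp measurable_fst).prodMk measurable_snd
  have hCi : ∀ q q', (pos q.1 i).1 = b → (pos q'.1 i).1 = b →
      normalVel q.1 (.reflection i) < 0 → normalVel q'.1 (.reflection i) < 0 → C q = C q' →
      q = q' := by
    rintro ⟨ζ, t⟩ ⟨ζ', t'⟩ h1 h1' h2 h2' h
    simp only [hC, Prod.mk.injEq] at h
    rw [← unjump_jump hε (hshock ζ h1) h2.ne, h.1, unjump_jump hε (hshock ζ' h1') h2'.ne, h.2]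
  have hCQ : InjOn C Q := fun q hq q' hq' h =>
    hCi q q' (hQ q hq).1 (hQ q' hq').1 (hQ q hq).2.1 (hQ q' hq').2.1 h
  -- Unlike a collision, a reflection is not an involution, so the set of states after it is handled
  -- as an injective image.
  have hQ'm : MeasurableSet (C '' Q) := measurableSet_image_of_injOn hCm hm hCQ
  have himg : (fun q : State N × ℝ => freeFlow (-q.2) (jump (.reflection i) q.1)) '' Q =
      (fun q : State N × ℝ => freeFlow (-q.2) q.1) '' (C '' Q) := by
    rw [image_image]
  have hnv : ∀ z : State N, (pos z i).1 = b → normalVel z (.reflection i) = Γ * vel z i 0 := by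
    intro z hz
    rw [normalVel, hw _ hz]
  have hQ' : ∀ q ∈ C '' Q, (pos q.1 i).1 = b ∧ 0 < Γ * vel q.1 i 0 := by
    rintro _ ⟨q, hq, rfl⟩
    obtain ⟨h1, h2, h3⟩ := hQ q hq
    simp only [hC, pos_jump]
    refine ⟨h1, ?_⟩
    rw [vel_jump_reflection, hw _ h1, PiLp.smul_apply, smul_eq_mul]
    have hv : vel q.1 i ≠ 0 := vel_ne_zero_of_normalVel h2.ne
    have h4 := (h3 ⟨1, by decide⟩).1 (by norm_num)
    calc 0 < ‖vel q.1 i‖ * (noise q.1 i ⟨1, by decide⟩ : E3) 0 := mul_pos (norm_pos_iff.2 hv) h4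
      _ = (Γ * Γ) * (‖vel q.1 i‖ * (noise q.1 i ⟨1, by decide⟩ : E3) 0) := by rw [hΓ, one_mul]
      _ = _ := by ring
  have hinjQ' : InjOn (fun q : State N × ℝ => freeFlow (-q.2) q.1) (C '' Q) := by
    rintro _ ⟨q, hq, rfl⟩ _ ⟨q', hq', rfl⟩ h
    rw [hinj' hq hq' h]
  have hΓ' : -Γ * -Γ = 1 := by rw [neg_mul_neg, hΓ]
  rw [himg, measure_image_wallContact hΓ hQ'm hQ' hinjQ',
    measure_image_wallContact hΓ' hm (fun q hq => by
      obtain ⟨h1, h2, -⟩ := hQ q hq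
      rw [hnv _ h1] at h2
      exact ⟨h1, by linarith⟩) hinj,
    ← (measurePreserving_wallReflect hΓ).measure_preimage
      (measurableSet_wallSet b hQ'm).nullMeasurableSet,
    ← wallMeasure_inter (-Γ) (wallReflect i Γ ⁻¹' _)]
  congr 1
  have hjump : ∀ p, (freeFlow (wallReflect i Γ p).1 (wallState b i (wallReflect i Γ p)),
      (wallReflect i Γ p).1) = C (freeFlow p.1 (wallState b i p), p.1) := by
    intro p
    simp only [hC]
    refine Prod.ext ?_ rfl
    have hp := pos_wallState b i p
    have hws : wallSign (pos (freeFlow p.1 (wallState b i p)) i) = Γ := hw _ (by rw [hp])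
    refine state_ext (fun k => ?_) (fun k => ?_) (fun k => ?_)
    · rw [pos_jump]
      by_cases hk : k = i
      · subst hk
        rw [pos_wallState, pos_wallState]
        rfl
      · rw [pos_freeFlow, pos_freeFlow]
        simp only [wallState, pos_assemble_of_ne hk, vel_assemble_of_ne hk, wallReflect]
    · by_cases hk : k = i
      · subst hk
        rw [vel_jump_reflection, hws]
        simp only [vel_freeFlow, noise_freeFlow, wallState, vel_assemble_self, noise_assemble_self,
          wallReflect, wallMap]
      · rw [vel_freeFlow]
        simp only [wallState, vel_assemble_of_ne hk, wallReflect]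
        simp [jump, vel, hk, freeFlow, assemble, insertAt]
    · by_cases hk : k = i
      · subst hk
        rw [noise_jump_reflection, hws]
        simp only [vel_freeFlow, noise_freeFlow, wallState, vel_assemble_self, noise_assemble_self,
          wallReflect, wallMap]
      · rw [noise_freeFlow]
        simp only [wallState, noise_assemble_of_ne hk, wallReflect]
        simp [jump, noise, hk, freeFlow, assemble, insertAt]
  ext p
  constructor
  · rintro ⟨hp, hs⟩
    have hp' : (freeFlow (wallReflect i Γ p).1 (wallState b i (wallReflect i Γ p)),
      (wallReflect i Γ p).1) ∈ C '' Q := hp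
    rw [hjump] at hp'
    obtain ⟨q, hq, h⟩ := hp'
    have hb' : (pos (freeFlow p.1 (wallState b i p)) i).1 = b := by rw [pos_wallState]
    have := hCi q _ (hQ q hq).1 hb' (hQ q hq).2.1 (by
      simp only
      rw [hnv _ hb', vel_freeFlow, wallState, vel_assemble_self]
      simp only [mem_ofPred_eq] at hs
      linarith) h
    rw [wallSet, mem_ofPred_eq, ← this]
    exact hq
  · intro hp
    have h1 := hQ _ hp
    refine ⟨?_, ?_⟩
    · show (freeFlow (wallReflect i Γ p).1 (wallState b i (wallReflect i Γ p)),
        (wallReflect i Γ p).1) ∈ C '' Q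
      rw [hjump]
      exact ⟨_, hp, rfl⟩
    · have h2 := h1.2.1
      rw [hnv _ h1.1] at h2
      simp only [vel_freeFlow, wallState, vel_assemble_self] at h2
      simp only [mem_ofPred_eq]
      linarith

end

/-! ### Finitely many kinds of shocks; measurability -/

section

variable {ε : ℝ}

/-! ### Labels of shocks -/

/-- The particles that take part in a shock, and the wall in the case of a reflection. -/
abbrev Label (N : ℕ) := (Fin N × Fin N) ⊕ (Fin N × Bool)

/-- The coordinate of a wall. -/
def wallCoord (b : Bool) : ℝ := if b then 1 else 0

/-- The shock with the given label and representative. -/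
def shockOf : Label N → E3 → Shock N
  | .inl p, u => .collision p.1 p.2 u
  | .inr p, _ => .reflection p.1

/-- The shock with label `l` and representative `u` takes place. For reflections, `u = 0`. -/
def Contact (ε : ℝ) : Label N → State N → E3 → Prop
  | .inl p, z, u => p.1 < p.2 ∧ proj u = pos z p.1 - pos z p.2 ∧ ‖u‖ = ε
  | .inr p, z, u => (pos z p.1).1 = wallCoord p.2 ∧ u = 0

/-- A multiple of the normal velocity that is continuous. -/
def rate : Label N → State N → E3 → ℝ
  | .inl p, z, u => inner ℝ u (vel z p.1 - vel z p.2)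
  | .inr p, z, _ => (if p.2 then -1 else 1) * vel z p.1 0

theorem Contact.isShock {l : Label N} {z : State N} {u : E3} (h : Contact ε l z u) :
    IsShock ε z (shockOf l u) := by
  rcases l with p | ⟨i, b⟩
  · exact h
  · cases b
    · exact Or.inl h.1
    · exact Or.inr h.1

theorem IsShock.exists_contact {z : State N} {s : Shock N} (h : IsShock ε z s) :
    ∃ l u, Contact ε l z u ∧ shockOf l u = s := by
  cases s with
  | collision i j u => exact ⟨.inl (i, j), u, h, rfl⟩
  | reflection i =>
    rcases h with h | h
    · exact ⟨.inr (i, false), 0, ⟨h, rfl⟩, rfl⟩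
    · exact ⟨.inr (i, true), 0, ⟨h, rfl⟩, rfl⟩

theorem Contact.eq_of_shockOf_eq {l l' : Label N} {z : State N} {u u' : E3}
    (h : Contact ε l z u) (h' : Contact ε l' z u') (he : shockOf l u = shockOf l' u') :
    l = l' ∧ u = u' := by
  rcases l with ⟨i, j⟩ | ⟨i, b⟩ <;> rcases l' with ⟨i', j'⟩ | ⟨i', b'⟩
  · simp only [shockOf, Shock.collision.injEq] at he
    obtain ⟨rfl, rfl, rfl⟩ := he
    exact ⟨rfl, rfl⟩
  · simp [shockOf] at he
  · simp [shockOf] at he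
  · simp only [shockOf, Shock.reflection.injEq] at he
    subst he
    have h1 := h.1.symm.trans h'.1
    cases b <;> cases b' <;> simp [wallCoord] at h1 <;> exact ⟨rfl, h.2.trans h'.2.symm⟩

theorem Contact.norm_le (hε : 0 < ε) {l : Label N} {z : State N} {u : E3} (h : Contact ε l z u) :
    u ∈ Metric.closedBall (0 : E3) ε := by
  rw [mem_closedBall_zero_iff]
  rcases l with p | p
  · exact h.2.2.le
  · rw [h.2, norm_zero]; exact hε.le

theorem Contact.normalVel (hε : 0 < ε) {l : Label N} {z : State N} {u : E3}
    (h : Contact ε l z u) : ∃ c > 0, rate l z u = c * normalVel z (shockOf l u) := by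
  rcases l with p | ⟨i, b⟩
  · refine ⟨ε, hε, ?_⟩
    simp only [rate, shockOf, HardSphere.normalVel]
    rw [unitDir_inner, h.2.2, mul_inv_cancel_left₀ hε.ne']
  · refine ⟨1, one_pos, ?_⟩
    have h1 : (pos z i).1 = wallCoord b := h.1
    simp only [rate, shockOf, HardSphere.normalVel, wallSign, h1, wallCoord]
    cases b <;> simp

theorem Contact.rate_neg_iff (hε : 0 < ε) {l : Label N} {z : State N} {u : E3}
    (h : Contact ε l z u) : rate l z u < 0 ↔ HardSphere.normalVel z (shockOf l u) < 0 := by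
  obtain ⟨c, hc, h⟩ := h.normalVel hε
  rw [h]
  exact ⟨fun h => by by_contra h'; exact absurd h (not_lt.2 (mul_nonneg hc.le (not_lt.1 h'))),
    fun h => mul_neg_of_pos_of_neg hc h⟩

theorem Contact.rate_nonpos_iff (hε : 0 < ε) {l : Label N} {z : State N} {u : E3}
    (h : Contact ε l z u) : rate l z u ≤ 0 ↔ HardSphere.normalVel z (shockOf l u) ≤ 0 := by
  obtain ⟨c, hc, h⟩ := h.normalVel hε
  rw [h]
  constructor
  · intro h; by_contra h'; exact absurd h (not_le.2 (mul_pos hc (not_le.1 h')))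
  · intro h; exact mul_nonpos_of_nonneg_of_nonpos hc.le h

theorem Contact.rate_eq_zero_iff (hε : 0 < ε) {l : Label N} {z : State N} {u : E3}
    (h : Contact ε l z u) : rate l z u = 0 ↔ HardSphere.normalVel z (shockOf l u) = 0 := by
  obtain ⟨c, hc, h⟩ := h.normalVel hε
  rw [h, mul_eq_zero, or_iff_right hc.ne']

theorem isClosed_contact (l : Label N) : IsClosed {q : State N × E3 | Contact ε l q.1 q.2} := by
  have hp : ∀ k, Continuous fun q : State N × E3 => pos q.1 k := fun k =>
    (continuous_pos k).comp continuous_fst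
  rcases l with ⟨i, j⟩ | ⟨i, b⟩
  · refine IsClosed.inter (isClosed_const (p := i < j)) (IsClosed.inter ?_ ?_)
    · exact isClosed_eq (continuous_proj.comp continuous_snd) ((hp i).sub (hp j))
    · exact isClosed_eq continuous_snd.norm continuous_const
  · exact (isClosed_eq (hp i).fst continuous_const).inter (isClosed_eq continuous_snd continuous_const)

theorem continuous_rate (l : Label N) : Continuous fun q : State N × E3 => rate l q.1 q.2 := by
  have hp : ∀ k, Continuous fun q : State N × E3 => vel q.1 k := fun k =>
    (continuous_vel k).comp continuous_fst
  rcases l with ⟨i, j⟩ | ⟨i, b⟩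
  · have h1 := hp i
    have h2 := hp j
    exact continuous_snd.inner (h1.sub h2)
  · have h1 := hp i
    unfold rate
    fun_prop

/-- The projection along a compact set of a closed set is closed. -/
theorem isClosed_exists_mem {X Y : Type*} [TopologicalSpace X] [TopologicalSpace Y] {K : Set Y}
    (hK : IsCompact K) {C : Set (X × Y)} (hC : IsClosed C) :
    IsClosed {x | ∃ y ∈ K, (x, y) ∈ C} := by
  have : CompactSpace K := isCompact_iff_compactSpace.1 hK
  have h : {x | ∃ y ∈ K, (x, y) ∈ C} = Prod.fst '' ((Prod.map id ((↑) : K → Y)) ⁻¹' C : Set (X × K)) := by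
    ext x
    constructor
    · rintro ⟨y, hy, h⟩
      exact ⟨(x, ⟨y, hy⟩), h, rfl⟩
    · rintro ⟨⟨x', y⟩, h, rfl⟩
      exact ⟨y, y.2, h⟩
  rw [h]
  exact isClosedMap_fst_of_compactSpace _
    (hC.preimage (continuous_id.prodMap continuous_subtype_val))

/-- Two different shocks with the labels `l` and `l'` take place. -/
def DoubleContact (ε : ℝ) (l l' : Label N) (z : State N) : Prop :=
  ∃ u ∈ Metric.closedBall (0 : E3) ε, ∃ u' ∈ Metric.closedBall (0 : E3) ε,
    Contact ε l z u ∧ Contact ε l' z u' ∧ (l ≠ l' ∨ 1 ≤ ‖u - u'‖)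

/-- For equal labels, `u ≠ u'` would not be a closed condition; the gap 1 between representatives
is. The representatives range over a compact ball, and projecting along it preserves closedness. -/
theorem isClosed_doubleContact (l l' : Label N) : IsClosed {z | DoubleContact ε l l' z} := by
  have hc : IsCompact (Metric.closedBall (0 : E3) ε) := isCompact_closedBall 0 ε
  refine isClosed_exists_mem hc (isClosed_exists_mem (X := State N × E3) hc
    (C := {q | Contact ε l q.1.1 q.1.2 ∧ Contact ε l' q.1.1 q.2 ∧ (l ≠ l' ∨ 1 ≤ ‖q.1.2 - q.2‖)}) ?_)
  refine IsClosed.inter ((isClosed_contact l).preimage continuous_fst) (IsClosed.inter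
    ((isClosed_contact l').preimage (by fun_prop : Continuous fun q : (State N × E3) × E3 =>
      (q.1.1, q.2))) (IsClosed.union (isClosed_const (p := l ≠ l')) ?_))
  have : Continuous fun q : (State N × E3) × E3 => ‖q.1.2 - q.2‖ := by fun_prop
  exact isClosed_le continuous_const this

theorem hasMultipleShocks_iff (hε : 0 < ε) {z : State N} :
    HasMultipleShocks ε z ↔ ∃ l l', DoubleContact ε l l' z := by
  constructor
  · rintro ⟨s, s', hne, hs, hs'⟩
    obtain ⟨l, u, h, rfl⟩ := hs.exists_contact
    obtain ⟨l', u', h', rfl⟩ := hs'.exists_contact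
    refine ⟨l, l', u, h.norm_le hε, u', h'.norm_le hε, h, h', ?_⟩
    by_cases hl : l = l'
    · right
      subst hl
      have hu : u ≠ u' := fun hu => hne (by rw [hu])
      rcases l with p | p
      · exact one_le_norm_sub (h.2.1.trans h'.2.1.symm) hu
      · exact absurd (h.2.trans h'.2.symm) hu
    · exact Or.inl hl
  · rintro ⟨l, l', u, -, u', -, h, h', hne⟩
    refine ⟨_, _, fun he => ?_, h.isShock, h'.isShock⟩
    obtain ⟨rfl, rfl⟩ := h.eq_of_shockOf_eq h' he
    rcases hne with hne | hne
    · exact hne rfl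
    · simp at hne
      linarith

theorem isClosed_hasMultipleShocks (hε : 0 < ε) : IsClosed {z : State N | HasMultipleShocks ε z} := by
  have : {z : State N | HasMultipleShocks ε z} = ⋃ l, ⋃ l', {z | DoubleContact ε l l' z} := by
    ext z
    simp [hasMultipleShocks_iff hε]
  rw [this]
  exact isClosed_iUnion_of_finite fun l => isClosed_iUnion_of_finite fun l' =>
    isClosed_doubleContact l l'

theorem isClosed_exists_contact (l : Label N) {F : Set ℝ} (hF : IsClosed F) :
    IsClosed {z : State N | ∃ u ∈ Metric.closedBall (0 : E3) ε, Contact ε l z u ∧ rate l z u ∈ F} :=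
  isClosed_exists_mem (isCompact_closedBall 0 ε)
    (C := {q : State N × E3 | Contact ε l q.1 q.2 ∧ rate l q.1 q.2 ∈ F})
    ((isClosed_contact l).inter (hF.preimage (continuous_rate l)))

theorem exists_isShock_iff (hε : 0 < ε) {z : State N} {P : Shock N → Prop} :
    (∃ s, IsShock ε z s ∧ P s) ↔
      ∃ l, ∃ u ∈ Metric.closedBall (0 : E3) ε, Contact ε l z u ∧ P (shockOf l u) := by
  constructor
  · rintro ⟨s, hs, h⟩
    obtain ⟨l, u, hu, rfl⟩ := hs.exists_contact
    exact ⟨l, u, hu.norm_le hε, hu, h⟩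
  · rintro ⟨l, u, -, hu, h⟩
    exact ⟨_, hu.isShock, h⟩

theorem isClosed_exists_isShock (hε : 0 < ε) : IsClosed {z : State N | ∃ s, IsShock ε z s} := by
  have : {z : State N | ∃ s, IsShock ε z s} = ⋃ l,
      {z | ∃ u ∈ Metric.closedBall (0 : E3) ε, Contact ε l z u ∧ rate l z u ∈ univ} := by
    ext z
    have := exists_isShock_iff hε (z := z) (P := fun _ => True)
    simpa using this
  rw [this]
  exact isClosed_iUnion_of_finite fun l => isClosed_exists_contact l isClosed_univ

theorem measurableSet_Omega : MeasurableSet Omega := by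
  have : Omega = ⋂ j : ZStar, {ω | (0 < j.1 → 0 < (ω j : E3) 0) ∧ (j.1 < 0 → (ω j : E3) 0 < 0)} := by
    ext ω; simp [Omega]
  rw [this]
  refine MeasurableSet.iInter fun j => ?_
  have h : Measurable fun ω : Noise => (ω j : E3) 0 := by fun_prop
  by_cases hj : 0 < j.1
  · have e : {ω : Noise | (0 < j.1 → 0 < (ω j : E3) 0) ∧ (j.1 < 0 → (ω j : E3) 0 < 0)} =
        {ω | 0 < (ω j : E3) 0} := by
      ext ω; simp [hj, hj.le]
    rw [e]
    exact measurableSet_lt measurable_const h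
  · have hj' : j.1 < 0 := lt_of_le_of_ne (not_lt.1 hj) j.2
    have e : {ω : Noise | (0 < j.1 → 0 < (ω j : E3) 0) ∧ (j.1 < 0 → (ω j : E3) 0 < 0)} =
        {ω | (ω j : E3) 0 < 0} := by
      ext ω; simp [hj, hj']
    rw [e]
    exact measurableSet_lt h measurable_const

theorem measurableSet_contactPhaseSpace : MeasurableSet (contactPhaseSpace ε N) := by
  have : contactPhaseSpace ε N = {z | NoOverlap ε z} ∩ ⋂ i, {z | noise z i ∈ Omega} := by
    ext z
    simp [mem_contact_iff]
  rw [this]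
  exact isClosed_noOverlap.measurableSet.inter (MeasurableSet.iInter fun i =>
    (continuous_noise i).measurable measurableSet_Omega)

theorem measurableSet_adm (hε : 0 < ε) : MeasurableSet {z : State N | Adm ε z} := by
  have : {z : State N | Adm ε z} = contactPhaseSpace ε N ∩ ({z | HasMultipleShocks ε z}ᶜ ∩
      (⋃ l, {z | ∃ u ∈ Metric.closedBall (0 : E3) ε, Contact ε l z u ∧ rate l z u ∈ Iic (0 : ℝ)})ᶜ) := by
    ext z
    simp only [Adm, mem_inter_iff, mem_ofPred_eq, mem_compl_iff, mem_iUnion]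
    refine and_congr_right fun _ => and_congr_right fun _ => ?_
    have := exists_isShock_iff hε (z := z) (P := fun s => normalVel z s ≤ 0)
    rw [← not_iff_not]
    push Not
    rw [this]
    refine exists_congr fun l => exists_congr fun u => and_congr_right fun _ => ?_
    exact and_congr_right fun h => (h.rate_nonpos_iff hε).symm
  rw [this]
  refine measurableSet_contactPhaseSpace.inter (MeasurableSet.inter
    (isClosed_hasMultipleShocks hε).measurableSet.compl (MeasurableSet.compl ?_))
  exact (isClosed_iUnion_of_finite fun l => isClosed_exists_contact l isClosed_Iic).measurableSet

/-- The states just before a regular shock with label `l`. -/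
def PreContact (ε : ℝ) (l : Label N) (z : State N) (u : E3) : Prop :=
  Contact ε l z u ∧ Pre ε (shockOf l u) z

/-- This form is built from closed and open conditions: it replaces `normalVel`, which involves the
discontinuous `wallSign` and `unitDir`, by the continuous `rate`, and the uniqueness of the shock by
the absence of multiple shocks. -/
theorem preContact_iff (hε : 0 < ε) {l : Label N} {z : State N} {u : E3} :
    PreContact ε l z u ↔ Contact ε l z u ∧ z ∈ contactPhaseSpace ε N ∧ ¬ HasMultipleShocks ε z ∧
      rate l z u < 0 := by
  constructor
  · rintro ⟨h, hp⟩
    exact ⟨h, hp.1, hp.not_hasMultipleShocks, (h.rate_neg_iff hε).2 hp.2.2.2⟩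
  · rintro ⟨h, hc, hm, hr⟩
    exact ⟨h, hc, h.isShock, fun s' hs' => eq_of_not_hasMultipleShocks hm h.isShock hs',
      (h.rate_neg_iff hε).1 hr⟩

theorem measurableSet_preContact (hε : 0 < ε) (l : Label N) :
    MeasurableSet {q : State N × E3 | PreContact ε l q.1 q.2} := by
  simp only [preContact_iff hε]
  refine (isClosed_contact l).measurableSet.inter (MeasurableSet.inter
    (measurable_fst measurableSet_contactPhaseSpace) (MeasurableSet.inter
    (measurable_fst (isClosed_hasMultipleShocks hε).measurableSet).compl ?_))
  exact measurableSet_lt (continuous_rate l).measurable measurable_const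

theorem measurable_jump_shockOf (l : Label N) {X : Type*} [MeasurableSpace X] {z : X → State N}
    {u : X → E3} (hz : Measurable z) (hu : Measurable u) :
    Measurable fun x => jump (shockOf l (u x)) (z x) := by
  rcases l with ⟨i, j⟩ | ⟨i, b⟩
  · exact measurable_collide i j hu hz
  · exact (measurable_jump_reflection i).comp hz

/-- The flow through a shock preserves the measure. -/
theorem measure_image_shock (hε : 0 < ε) (l : Label N) {Q : Set (State N × E3 × ℝ)}
    (hm : MeasurableSet Q) (hQ : ∀ q ∈ Q, PreContact ε l q.1 q.2.1)
    (hinj : InjOn (fun q : State N × E3 × ℝ => freeFlow (-q.2.2) q.1) Q)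
    (hinj' : InjOn (fun q : State N × E3 × ℝ => freeFlow (-q.2.2) (jump (shockOf l q.2.1) q.1)) Q) :
    phaseMeasure N ((fun q => freeFlow (-q.2.2) (jump (shockOf l q.2.1) q.1)) '' Q) =
      phaseMeasure N ((fun q => freeFlow (-q.2.2) q.1) '' Q) := by
  rcases Q.eq_empty_or_nonempty with rfl | ⟨q₀, hq₀⟩
  · simp
  rcases l with ⟨i, j⟩ | ⟨i, b⟩
  · refine measure_image_collision hε (hQ q₀ hq₀).1.1.ne hm (fun q hq => ?_) hinj hinj'
    obtain ⟨h, hp⟩ := hQ q hq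
    exact ⟨h.2.1, h.2.2, (h.rate_neg_iff hε).2 hp.2.2.2⟩
  -- For a wall contact the representative is always 0 and can be dropped.
  · set Q' : Set (State N × ℝ) := {q | (q.1, (0 : E3), q.2) ∈ Q}
    have hQ' : MeasurableSet Q' := (by fun_prop : Measurable fun q : State N × ℝ =>
      (q.1, (0 : E3), q.2)) hm
    have himg : ∀ f : State N × ℝ → State N,
        (fun q : State N × E3 × ℝ => f (q.1, q.2.2)) '' Q = f '' Q' := by
      intro f
      ext z
      constructor
      · rintro ⟨⟨ζ, u, t⟩, hq, rfl⟩
        obtain ⟨h, -⟩ := hQ _ hq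
        obtain rfl : u = 0 := h.2
        exact ⟨(ζ, t), hq, rfl⟩
      · rintro ⟨⟨ζ, t⟩, hq, rfl⟩
        exact ⟨(ζ, 0, t), hq, rfl⟩
    have h1 := himg fun q => freeFlow (-q.2) q.1
    have h2 := himg fun q => freeFlow (-q.2) (jump (.reflection i) q.1)
    have key := measure_image_reflection (i := i) hε (b := wallCoord b)
      (by cases b <;> simp [wallCoord]) hQ' (fun q hq => by
        obtain ⟨h, hp⟩ := hQ _ hq
        exact ⟨h.1, hp.2.2.2, hp.1.2.2 i⟩)
      (fun q hq q' hq' h => by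
        have := hinj hq hq' h
        simp only [Prod.mk.injEq, true_and] at this
        exact Prod.ext this.1 this.2)
      (fun q hq q' hq' h => by
        have := hinj' hq hq' h
        simp only [Prod.mk.injEq, true_and] at this
        exact Prod.ext this.1 this.2)
    exact (congrArg _ h2).trans (key.trans (congrArg _ h1).symm)

end

/-! ### Null sets for free motion -/

section

variable {ε : ℝ}

/-! ### Null sets -/

theorem measurePreserving_particles {f : Fin N → Pos × E3 → Pos × E3}
    (hf : ∀ k, MeasurePreserving (f k) volume volume) :
    MeasurePreserving (fun z : State N => ((fun k => f k (z.1 k), z.2) : State N))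
      (phaseMeasure N) (phaseMeasure N) := by
  have h : SigmaFinite (volume : Measure (Pos × E3)) := inferInstance
  exact (@measurePreserving_pi (Fin N) _ (fun _ => Pos × E3) (fun _ => Pos × E3) _ _
    (fun _ => volume) (fun _ => volume) f (fun _ => h) hf).prod (MeasurePreserving.id _)

theorem measurePreserving_freeFlow (t : ℝ) :
    MeasurePreserving (freeFlow t : State N → State N) (phaseMeasure N) (phaseMeasure N) := by
  have hpr : Measurable proj := continuous_proj.measurable
  exact measurePreserving_particles fun k => measurePreserving_skew_fst
    (μ := (volume : Measure Pos)) (ν := (volume : Measure E3))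
    (g := fun v x => x + proj (t • v)) (by fun_prop) fun v => measurePreserving_add_pos _

/-- Translation of the position and the velocity of particle `m`. -/
def moveParticle (m : Fin N) (b w : E3) (z : State N) : State N :=
  (fun k => if k = m then ((z.1 k).1 + proj b, (z.1 k).2 + w) else z.1 k, z.2)

theorem measurePreserving_moveParticle (m : Fin N) (b w : E3) :
    MeasurePreserving (moveParticle m b w) (phaseMeasure N) (phaseMeasure N) := by
  refine measurePreserving_particles
    (f := fun k y => if k = m then (y.1 + proj b, y.2 + w) else y) fun k => ?_
  by_cases hk : k = m
  · simp only [hk, if_true]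
    exact (measurePreserving_add_pos _).prod (measurePreserving_add_right volume w)
  · simp only [hk, if_false]
    exact MeasurePreserving.id _

theorem pos_moveParticle_self (m : Fin N) (b w : E3) (z : State N) :
    pos (moveParticle m b w z) m = pos z m + proj b := by simp [moveParticle, pos]

theorem vel_moveParticle_self (m : Fin N) (b w : E3) (z : State N) :
    vel (moveParticle m b w z) m = vel z m + w := by simp [moveParticle, vel]

theorem pos_moveParticle_of_ne {m k : Fin N} (h : k ≠ m) (b w : E3) (z : State N) :
    pos (moveParticle m b w z) k = pos z k := by simp [moveParticle, pos, h]

theorem vel_moveParticle_of_ne {m k : Fin N} (h : k ≠ m) (b w : E3) (z : State N) :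
    vel (moveParticle m b w z) k = vel z k := by simp [moveParticle, vel, h]

theorem vel_moveParticle_zero (m k : Fin N) (b : E3) (z : State N) :
    vel (moveParticle m b 0 z) k = vel z k := by
  by_cases h : k = m
  · subst h; rw [vel_moveParticle_self, add_zero]
  · exact vel_moveParticle_of_ne h _ _ _

/-- A set that meets the lines in one direction in countable sets is null. -/
theorem null_of_countable_lines {S : Set (State N)} (hS : MeasurableSet S) (m : Fin N) (b w : E3)
    (h : ∀ z, {a : ℝ | moveParticle m (a • b) (a • w) z ∈ S}.Countable) : phaseMeasure N S = 0 := by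
  have hpr : Measurable proj := continuous_proj.measurable
  have hm : Measurable fun q : ℝ × State N => moveParticle m (q.1 • b) (q.1 • w) q.2 := by
    unfold moveParticle
    refine Measurable.prodMk (measurable_pi_iff.2 fun k => ?_) (by fun_prop)
    split_ifs <;> fun_prop
  have hm' : Measurable fun q : State N × ℝ => moveParticle m (q.2 • b) (q.2 • w) q.1 :=
    hm.comp measurable_swap
  have h1 : (phaseMeasure N).prod (volume : Measure ℝ)
      ((fun q : State N × ℝ => moveParticle m (q.2 • b) (q.2 • w) q.1) ⁻¹' S) = 0 := by
    rw [Measure.measure_prod_null (hm' hS)]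
    exact ae_of_all _ fun z => (h z).measure_zero _
  have h2 : (volume : Measure ℝ).prod (phaseMeasure N)
      ((fun q : ℝ × State N => moveParticle m (q.1 • b) (q.1 • w) q.2) ⁻¹' S) = 0 := by
    rw [← Measure.measurePreserving_swap.measure_preimage (hm hS).nullMeasurableSet]
    exact h1
  rw [Measure.measure_prod_null (hm hS)] at h2
  -- By Fubini almost every translate of the set is null. One of them suffices, because translations
  -- preserve the measure.
  obtain ⟨a, ha⟩ := h2.exists
  rw [← (measurePreserving_moveParticle m (a • b) (a • w)).measure_preimage hS.nullMeasurableSet]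
  exact ha

theorem countable_quadratic {A B C : ℝ} (h : A ≠ 0 ∨ B ≠ 0) :
    {a : ℝ | A * a ^ 2 + B * a + C = 0}.Countable := by
  rcases eq_empty_or_nonempty {a : ℝ | A * a ^ 2 + B * a + C = 0} with he | ⟨r, hr⟩
  · rw [he]; exact countable_empty
  · have hr : A * r ^ 2 + B * r + C = 0 := hr
    refine Countable.mono (s₂ := {r, -B / A - r}) (fun a ha => ?_) (by simp)
    have ha : A * a ^ 2 + B * a + C = 0 := ha
    have h1 : (a - r) * (A * (a + r) + B) = 0 := by linear_combination ha - hr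
    rcases mul_eq_zero.1 h1 with h2 | h2
    · exact Or.inl (by linarith)
    · by_cases hA : A = 0
      · rw [hA] at h2
        rcases h with h | h
        · exact absurd hA h
        · exact absurd (by simpa using h2) h
      · right
        rw [mem_singleton_iff]
        field_simp
        linarith

theorem measurableSet_exists_freeFlow {C : Set (State N)} (hC : IsClosed C) :
    MeasurableSet {z | ∃ t : ℝ, freeFlow t z ∈ C} := by
  have : {z | ∃ t : ℝ, freeFlow t z ∈ C} =
      ⋃ n : ℕ, {z | ∃ t ∈ Icc (-(n : ℝ)) n, freeFlow t z ∈ C} := by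
    ext z
    simp only [mem_ofPred_eq, mem_iUnion]
    constructor
    · rintro ⟨t, ht⟩
      obtain ⟨n, hn⟩ := exists_nat_ge |t|
      exact ⟨n, t, abs_le.1 hn, ht⟩
    · rintro ⟨n, t, -, ht⟩
      exact ⟨t, ht⟩
  rw [this]
  refine MeasurableSet.iUnion fun n => (isClosed_exists_mem isCompact_Icc
    (C := {q : State N × ℝ | freeFlow q.2 q.1 ∈ C}) ?_).measurableSet
  exact hC.preimage (continuous_freeFlow_uncurry.comp continuous_swap)

theorem inner_latticeVec (k : ℤ × ℤ) (V : E3) : inner ℝ (latticeVec k) V = k.1 * V 1 + k.2 * V 2 := by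
  simp [latticeVec, PiLp.inner_apply, Fin.sum_univ_three, mul_comm]

/-- Generic velocities. -/
def Generic (z : State N) : Prop :=
  (∀ i, vel z i 0 ≠ 0) ∧
    ∀ i j, i ≠ j → ∀ k : ℤ × ℤ, k ≠ 0 → inner ℝ (latticeVec k) (vel z i - vel z j) ≠ 0

theorem latticeVec_ne_zero {k : ℤ × ℤ} (hk : k ≠ 0) : latticeVec k ≠ 0 := by
  intro h
  apply hk
  have h1 := congrFun (congrArg WithLp.ofLp h) 1
  have h2 := congrFun (congrArg WithLp.ofLp h) 2
  simp [latticeVec] at h1 h2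
  exact Prod.ext h1 h2

/-- The unit vector orthogonal to the walls. -/
def e0 : E3 := EuclideanSpace.single 0 1

theorem norm_e0 : ‖e0‖ = 1 := by simp [e0]

theorem inner_e0 (V : E3) : inner ℝ e0 V = V 0 := by simp [e0, EuclideanSpace.inner_single_left]

theorem inner_latticeVec_e0 (k : ℤ × ℤ) : inner ℝ (latticeVec k) e0 = (0 : ℝ) := by
  rw [inner_latticeVec]; simp [e0]

theorem generic_eq : {z : State N | Generic z} = (⋂ i, {z | vel z i 0 = 0}ᶜ) ∩
    ⋂ i, ⋂ j, ⋂ (_ : i ≠ j), ⋂ k : ℤ × ℤ, ⋂ (_ : k ≠ 0),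
      {z | inner ℝ (latticeVec k) (vel z i - vel z j) = (0 : ℝ)}ᶜ := by
  ext z
  simp [Generic]

theorem isClosed_vel_zero (i : Fin N) : IsClosed {z : State N | vel z i 0 = 0} := by
  have := continuous_vel i
  exact isClosed_eq (by fun_prop) continuous_const

theorem isClosed_inner_vel (i j : Fin N) (w : E3) :
    IsClosed {z : State N | inner ℝ w (vel z i - vel z j) = (0 : ℝ)} :=
  isClosed_eq (continuous_const.inner ((continuous_vel i).sub (continuous_vel j))) continuous_const

theorem measurableSet_generic : MeasurableSet {z : State N | Generic z} := by
  rw [generic_eq]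
  refine MeasurableSet.inter (MeasurableSet.iInter fun i => (isClosed_vel_zero i).measurableSet.compl)
    (MeasurableSet.iInter fun i => MeasurableSet.iInter fun j => MeasurableSet.iInter fun _ =>
      MeasurableSet.iInter fun k => MeasurableSet.iInter fun _ =>
      (isClosed_inner_vel i j _).measurableSet.compl)

/-- Each excluded condition is affine and not constant along a translation of one velocity. The
conditions make wall contacts transversal, relative velocities nonzero, and determine the time at
which one pair can have two contacts. -/
theorem measure_not_generic : phaseMeasure N {z | Generic z}ᶜ = 0 := by
  rw [generic_eq, compl_inter]
  simp only [compl_iInter, compl_compl]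
  refine measure_union_null ?_ ?_
  · refine measure_iUnion_null fun i => ?_
    refine null_of_countable_lines (isClosed_vel_zero i).measurableSet i 0 e0 fun z => ?_
    refine (countable_quadratic (A := 0) (B := 1) (C := vel z i 0) (by simp)).mono fun a ha => ?_
    have ha : vel (moveParticle i (a • 0) (a • e0) z) i 0 = 0 := ha
    rw [vel_moveParticle_self] at ha
    simp [e0] at ha
    simp only [mem_ofPred_eq]
    linarith
  · refine measure_iUnion_null fun i => measure_iUnion_null fun j => measure_iUnion_null fun hij =>
      measure_iUnion_null fun k => measure_iUnion_null fun hk => ?_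
    refine null_of_countable_lines (isClosed_inner_vel i j _).measurableSet i 0 (latticeVec k)
      fun z => ?_
    refine (countable_quadratic (A := 0) (B := ‖latticeVec k‖ ^ 2)
      (C := inner ℝ (latticeVec k) (vel z i - vel z j))
      (Or.inr (pow_ne_zero _ (norm_ne_zero_iff.2 (latticeVec_ne_zero hk))))).mono fun a ha => ?_
    have ha : inner ℝ (latticeVec k) (vel (moveParticle i (a • 0) (a • latticeVec k) z) i -
      vel (moveParticle i (a • 0) (a • latticeVec k) z) j) = (0 : ℝ) := ha
    rw [vel_moveParticle_self, vel_moveParticle_of_ne hij.symm, add_sub_right_comm, inner_add_right,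
      inner_smul_right, real_inner_self_eq_norm_sq] at ha
    simp only [mem_ofPred_eq]
    linarith

theorem Generic.congr {z z' : State N} (h : Generic z) (hv : ∀ k, vel z' k = vel z k) :
    Generic z' := by
  unfold Generic at h ⊢
  simpa only [hv] using h

theorem Generic.sub_ne_zero {z : State N} (h : Generic z) {i j : Fin N} (hij : i ≠ j) :
    vel z i - vel z j ≠ 0 := by
  intro h0
  have := h.2 i j hij (1, 0) (by simp)
  rw [h0, inner_zero_right] at this
  exact this rfl

theorem norm_sq_add_smul (w V : E3) (t : ℝ) :
    ‖w + t • V‖ ^ 2 = ‖V‖ ^ 2 * t ^ 2 + 2 * inner ℝ w V * t + ‖w‖ ^ 2 := by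
  rw [norm_add_smul_sq]; ring

theorem countable_norm_add_smul_eq (w : E3) {V : E3} (hV : V ≠ 0) (r : ℝ) :
    {t : ℝ | ‖w + t • V‖ = r}.Countable := by
  refine (countable_quadratic (A := ‖V‖ ^ 2) (B := 2 * inner ℝ w V) (C := ‖w‖ ^ 2 - r ^ 2)
    (Or.inl (pow_ne_zero _ (norm_ne_zero_iff.2 hV)))).mono fun t ht => ?_
  have ht : ‖w + t • V‖ = r := ht
  have := norm_sq_add_smul w V t
  rw [ht] at this
  simp only [mem_ofPred_eq]
  linarith

theorem e0_ne_zero : e0 ≠ 0 := by rw [← norm_ne_zero_iff, norm_e0]; exact one_ne_zero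

/-- The times of the contacts with a given label under free motion. -/
theorem countable_contact_times {z : State N} (hz : Generic z) (l : Label N) :
    {t : ℝ | ∃ u, Contact ε l (freeFlow t z) u}.Countable := by
  rcases l with ⟨i, j⟩ | ⟨i, b⟩
  · by_cases hij : i < j
    · have hc : (⋃ w ∈ {w : E3 | proj w = pos z i - pos z j},
          {t : ℝ | ‖w + t • (vel z i - vel z j)‖ = ε}).Countable :=
        (countable_reps _).biUnion fun w _ => countable_norm_add_smul_eq w (hz.sub_ne_zero hij.ne) ε
      refine hc.mono ?_
      rintro t ⟨u, -, h1, h2⟩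
      refine mem_biUnion (x := u - t • (vel z i - vel z j)) ?_ ?_
      · simp only [pos_freeFlow] at h1
        simp only [mem_ofPred_eq, proj_sub, h1, smul_sub]
        abel
      · simpa using h2
    · refine countable_empty.mono ?_
      rintro t ⟨u, h, -⟩
      exact absurd h hij
  · refine (countable_quadratic (A := 0) (B := vel z i 0) (C := (pos z i).1 - wallCoord b)
      (Or.inr (hz.1 i))).mono ?_
    rintro t ⟨u, h, -⟩
    simp [proj] at h
    simp only [mem_ofPred_eq]
    linarith

/-- The particle `m` takes part in the shocks with label `l`. -/
def Involves (l : Label N) (m : Fin N) : Prop :=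
  match l with
  | .inl p => m = p.1 ∨ m = p.2
  | .inr p => m = p.1

theorem contact_moveParticle {l : Label N} {m : Fin N} (h : ¬ Involves l m) (b w u : E3) (t : ℝ)
    (z : State N) : Contact ε l (freeFlow t (moveParticle m b w z)) u ↔
      Contact ε l (freeFlow t z) u := by
  rcases l with ⟨i, j⟩ | ⟨i, c⟩
  · simp only [Involves, not_or] at h
    simp only [Contact, pos_freeFlow, pos_moveParticle_of_ne (Ne.symm h.1),
      pos_moveParticle_of_ne (Ne.symm h.2), vel_moveParticle_of_ne (Ne.symm h.1),
      vel_moveParticle_of_ne (Ne.symm h.2)]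
  · simp only [Involves] at h
    simp only [Contact, pos_freeFlow, pos_moveParticle_of_ne (Ne.symm h),
      vel_moveParticle_of_ne (Ne.symm h)]

/-- The translations that lead to a contact at a given time. -/
theorem countable_contact_translates {l : Label N} {m : Fin N} (h : Involves l m) (t : ℝ)
    (z : State N) :
    {a : ℝ | ∃ u, Contact ε l (freeFlow t (moveParticle m (a • e0) 0 z)) u}.Countable := by
  have key : ∀ (p : Pos) (V : E3), V ≠ 0 →
      (⋃ w ∈ {w : E3 | proj w = p}, {a : ℝ | ‖w + a • V‖ = ε}).Countable := fun p V hV =>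
    (countable_reps _).biUnion fun w _ => countable_norm_add_smul_eq w hV ε
  rcases l with ⟨i, j⟩ | ⟨i, c⟩
  · by_cases hij : i < j
    · rcases h with rfl | rfl
      · refine (key (pos (freeFlow t z) m - pos (freeFlow t z) j) e0 e0_ne_zero).mono ?_
        rintro a ⟨u, -, h1, h2⟩
        refine mem_biUnion (x := u - a • e0) ?_ (by simpa using h2)
        simp only [pos_freeFlow, vel_moveParticle_zero, pos_moveParticle_self,
          pos_moveParticle_of_ne hij.ne'] at h1
        simp only [mem_ofPred_eq, proj_sub, h1, pos_freeFlow]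
        abel
      · refine (key (pos (freeFlow t z) i - pos (freeFlow t z) m) (-e0) (neg_ne_zero.2 e0_ne_zero)).mono ?_
        rintro a ⟨u, -, h1, h2⟩
        refine mem_biUnion (x := u + a • e0) ?_ (by simpa using h2)
        simp only [pos_freeFlow, vel_moveParticle_zero, pos_moveParticle_self,
          pos_moveParticle_of_ne hij.ne] at h1
        simp only [mem_ofPred_eq, proj_add, h1, pos_freeFlow]
        abel
    · refine countable_empty.mono ?_
      rintro t ⟨u, h, -⟩
      exact absurd h hij
  · obtain rfl : m = i := h
    refine (countable_quadratic (A := 0) (B := 1) (C := (pos (freeFlow t z) m).1 - wallCoord c)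
      (by simp)).mono ?_
    rintro a ⟨u, h1, -⟩
    simp only [pos_freeFlow, vel_moveParticle_zero, pos_moveParticle_self] at h1
    simp only [mem_ofPred_eq, pos_freeFlow]
    simp [proj, e0] at h1 ⊢
    linarith

/-- Translate `m` along e. The contact times of `l` do not change and are countable; at each of them
only countably many translations produce a contact `l'`. -/
theorem null_double_of_involves {l l' : Label N} {m : Fin N} (h : ¬ Involves l m)
    (h' : Involves l' m) : phaseMeasure N ({z | Generic z} ∩
      {z | ∃ t : ℝ, DoubleContact ε l l' (freeFlow t z)}) = 0 := by
  refine null_of_countable_lines (measurableSet_generic.inter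
    (measurableSet_exists_freeFlow (isClosed_doubleContact l l'))) m e0 0 fun z => ?_
  by_cases hz : Generic z
  · have hc : (⋃ t ∈ {t : ℝ | ∃ u, Contact ε l (freeFlow t z) u},
        {a : ℝ | ∃ u, Contact ε l' (freeFlow t (moveParticle m (a • e0) 0 z)) u}).Countable :=
      (countable_contact_times hz l).biUnion fun t _ => countable_contact_translates h' t z
    refine hc.mono ?_
    rintro a ⟨-, t, u, -, u', -, h1, h2, -⟩
    rw [smul_zero] at h1 h2
    exact mem_biUnion (x := t) ⟨u, (contact_moveParticle h _ _ _ _ _).1 h1⟩ ⟨u', h2⟩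
  · refine countable_empty.mono ?_
    rintro a ⟨hg, -⟩
    refine hz (Generic.congr hg fun k => ?_)
    rw [smul_zero, vel_moveParticle_zero]

theorem doubleContact_symm {l l' : Label N} {z : State N} :
    DoubleContact ε l l' z ↔ DoubleContact ε l' l z := by
  constructor <;> rintro ⟨u, hu, u', hu', h1, h2, h3⟩ <;>
    exact ⟨u', hu', u, hu, h2, h1, h3.imp Ne.symm fun h => by rwa [norm_sub_rev]⟩

/-- Two contacts of the same pair of particles. -/
theorem null_double_self (l : Label N) : phaseMeasure N ({z | Generic z} ∩
      {z | ∃ t : ℝ, DoubleContact ε l l (freeFlow t z)}) = 0 := by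
  rcases l with ⟨i, j⟩ | ⟨i, b⟩
  swap
  · convert measure_empty (μ := phaseMeasure N)
    rw [eq_empty_iff_forall_notMem]
    rintro z ⟨-, t, u, -, u', -, h1, h2, h3⟩
    rcases h3 with h3 | h3
    · exact h3 rfl
    · rw [h1.2, h2.2, sub_zero, norm_zero] at h3
      linarith
  by_cases hij : i < j
  swap
  · convert measure_empty (μ := phaseMeasure N)
    rw [eq_empty_iff_forall_notMem]
    rintro z ⟨-, t, u, -, u', -, h1, -⟩
    exact hij h1.1
  refine null_of_countable_lines (measurableSet_generic.inter
    (measurableSet_exists_freeFlow (isClosed_doubleContact _ _))) i e0 0 fun z => ?_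
  by_cases hz : Generic z
  swap
  · refine countable_empty.mono ?_
    rintro a ⟨hg, -⟩
    refine hz (Generic.congr hg fun k => ?_)
    rw [smul_zero, vel_moveParticle_zero]
  set V := vel z i - vel z j with hV
  -- Two contacts with representatives u and u + k of length ε give 2⟨k, u⟩ + |k|² = 0. Here u = w +
  -- tV + ae, and e is orthogonal to k, so this equation fixes t independently of the translation a.
  -- At this time |u| = ε leaves countably many a.
  set τ : E3 → ℤ × ℤ → ℝ := fun w k =>
    (-‖latticeVec k‖ ^ 2 / 2 - inner ℝ (latticeVec k) w) / inner ℝ (latticeVec k) V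
  have hc : (⋃ w ∈ {w : E3 | proj w = pos z i - pos z j}, ⋃ k : ℤ × ℤ,
      {a : ℝ | ‖(w + τ w k • V) + a • e0‖ = ε}).Countable :=
    (countable_reps _).biUnion fun w _ => countable_iUnion fun k =>
      countable_norm_add_smul_eq _ e0_ne_zero ε
  refine hc.mono ?_
  rintro a ⟨-, t, u, -, u', -, ⟨-, h1, h2⟩, ⟨-, h1', h2'⟩, h3⟩
  rw [or_iff_right (by simp)] at h3
  obtain ⟨k, hk⟩ := proj_eq_proj_iff.1 (h1'.trans h1.symm)
  have hk0 : k ≠ 0 := by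
    rintro rfl
    have : latticeVec 0 = 0 := by ext l; fin_cases l <;> simp [latticeVec]
    rw [hk, this, add_zero, sub_self, norm_zero] at h3
    linarith
  have hkV := hz.2 i j hij.ne k hk0
  set w := u - a • e0 - t • V with hw
  have huw : u = (w + t • V) + a • e0 := by rw [hw]; abel
  have hpw : proj w = pos z i - pos z j := by
    simp only [smul_zero, pos_freeFlow, vel_moveParticle_zero, pos_moveParticle_self,
      pos_moveParticle_of_ne hij.ne'] at h1
    simp only [hw, hV, proj_sub, h1, smul_sub]
    abel
  have h4 : 2 * inner ℝ (latticeVec k) u + ‖latticeVec k‖ ^ 2 = 0 := by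
    have h5 := norm_add_sq_real u (latticeVec k)
    rw [← hk, h2, h2', real_inner_comm] at h5
    linarith
  have ht : t = τ w k := by
    rw [huw, inner_add_right, inner_add_right, inner_smul_right, inner_smul_right,
      inner_latticeVec_e0, mul_zero, add_zero] at h4
    simp only [τ]
    rw [eq_div_iff hkV]
    linarith
  refine mem_biUnion (x := w) hpw (mem_iUnion.2 ⟨k, ?_⟩)
  simp only [mem_ofPred_eq]
  rw [← ht, ← huw, h2]

/-- For different labels, some particle takes part in one shock and not in the other. The exception
is one particle at both walls, which is impossible. -/
theorem null_double (l l' : Label N) : phaseMeasure N ({z | Generic z} ∩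
      {z | ∃ t : ℝ, DoubleContact ε l l' (freeFlow t z)}) = 0 := by
  have hempty : (∀ z : State N, ¬ DoubleContact ε l l' z) → phaseMeasure N ({z | Generic z} ∩
      {z | ∃ t : ℝ, DoubleContact ε l l' (freeFlow t z)}) = 0 := by
    intro h
    convert measure_empty (μ := phaseMeasure N)
    rw [eq_empty_iff_forall_notMem]
    rintro z ⟨-, t, ht⟩
    exact h _ ht
  have hsymm : ∀ m, ¬ Involves l' m → Involves l m → phaseMeasure N ({z | Generic z} ∩
      {z | ∃ t : ℝ, DoubleContact ε l l' (freeFlow t z)}) = 0 := by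
    intro m h h'
    simp only [doubleContact_symm (l := l)]
    exact null_double_of_involves h h'
  by_cases hl : l = l'
  · subst hl
    exact null_double_self l
  rcases l with ⟨i, j⟩ | ⟨i, b⟩ <;> rcases l' with ⟨i', j'⟩ | ⟨i', b'⟩
  · by_cases hij : i < j
    swap
    · exact hempty fun z ⟨u, _, u', _, h, _⟩ => hij h.1
    by_cases hij' : i' < j'
    swap
    · exact hempty fun z ⟨u, _, u', _, _, h, _⟩ => hij' h.1
    by_cases h1 : Involves (.inl (i, j)) i'
    · by_cases h2 : Involves (.inl (i, j)) j'
      · exfalso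
        apply hl
        simp only [Involves] at h1 h2
        have : i = i' ∧ j = j' := by
          rcases h1 with rfl | rfl <;> rcases h2 with rfl | rfl
          · exact absurd hij' (lt_irrefl _)
          · exact ⟨rfl, rfl⟩
          · exact absurd (hij.trans hij') (lt_irrefl _)
          · exact absurd hij' (lt_irrefl _)
        rw [this.1, this.2]
      · exact null_double_of_involves h2 (Or.inr rfl)
    · exact null_double_of_involves h1 (Or.inl rfl)
  · by_cases hij : i < j
    swap
    · exact hempty fun z ⟨u, _, u', _, h, _⟩ => hij h.1
    by_cases h : i = i'
    · refine hsymm j ?_ (Or.inr rfl)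
      simp only [Involves]
      exact fun h' => hij.ne (h.trans h'.symm)
    · exact hsymm i h (Or.inl rfl)
  · by_cases hij : i' < j'
    swap
    · exact hempty fun z ⟨u, _, u', _, _, h, _⟩ => hij h.1
    by_cases h : i' = i
    · refine null_double_of_involves (m := j') ?_ (Or.inr rfl)
      simp only [Involves]
      exact fun h' => hij.ne (h.trans h'.symm)
    · exact null_double_of_involves (m := i') h (Or.inl rfl)
  · by_cases h : i = i'
    · subst h
      refine hempty fun z ⟨u, _, u', _, h, h', _⟩ => hl ?_
      have := h.1.symm.trans h'.1
      cases b <;> cases b' <;> simp [wallCoord] at this ⊢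
    · exact hsymm i h rfl

/-- Grazing contacts. -/
theorem null_grazing (l : Label N) : phaseMeasure N ({z | Generic z} ∩ {z | ∃ t : ℝ, freeFlow t z ∈
      {z | ∃ u ∈ Metric.closedBall (0 : E3) ε, Contact ε l z u ∧ rate l z u ∈ ({0} : Set ℝ)}}) = 0 := by
  rcases l with ⟨i, j⟩ | ⟨i, b⟩
  swap
  · convert measure_empty (μ := phaseMeasure N)
    rw [eq_empty_iff_forall_notMem]
    rintro z ⟨hz, t, u, -, -, h⟩
    have h : (if b then (-1 : ℝ) else 1) * vel z i 0 = 0 := h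
    have := hz.1 i
    cases b <;> simp at h <;> exact this h
  by_cases hij : i < j
  swap
  · convert measure_empty (μ := phaseMeasure N)
    rw [eq_empty_iff_forall_notMem]
    rintro z ⟨-, t, u, -, h1, -⟩
    exact hij h1.1
  refine null_of_countable_lines (measurableSet_generic.inter
    (measurableSet_exists_freeFlow (isClosed_exists_contact _ isClosed_singleton))) i e0 0 fun z => ?_
  by_cases hz : Generic z
  swap
  · refine countable_empty.mono ?_
    rintro a ⟨hg, -⟩
    refine hz (Generic.congr hg fun k => ?_)
    rw [smul_zero, vel_moveParticle_zero]
  set V := vel z i - vel z j with hV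
  -- This is V₁² + V₂², and the generic condition for the lattice vector (0, 1, 0) says V₁ ≠ 0.
  have hlead : ‖V‖ ^ 2 - V 0 ^ 2 ≠ 0 := by
    have h1 := hz.2 i j hij.ne (1, 0) (by simp)
    rw [inner_latticeVec] at h1
    simp only [Int.cast_one, one_mul, Int.cast_zero, zero_mul, add_zero] at h1
    rw [EuclideanSpace.norm_sq_eq, Fin.sum_univ_three]
    simp only [Real.norm_eq_abs, sq_abs]
    have : 0 < V 1 ^ 2 := by positivity
    nlinarith [sq_nonneg (V 2)]
  -- Grazing means that the line through q = w + ae with direction V has distance ε from the origin: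
  -- |V|²|q|² − ⟨q, V⟩² = |V|²ε². This is a quadratic equation for a.
  have hc : (⋃ w ∈ {w : E3 | proj w = pos z i - pos z j},
      {a : ℝ | (‖V‖ ^ 2 - V 0 ^ 2) * a ^ 2 + (2 * ‖V‖ ^ 2 * w 0 - 2 * inner ℝ w V * V 0) * a +
        (‖V‖ ^ 2 * ‖w‖ ^ 2 - (inner ℝ w V) ^ 2 - ‖V‖ ^ 2 * ε ^ 2) = 0}).Countable :=
    (countable_reps _).biUnion fun w _ => countable_quadratic (Or.inl hlead)
  refine hc.mono ?_
  rintro a ⟨-, t, u, -, ⟨-, h1, h2⟩, h3⟩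
  have h3 : inner ℝ u (vel (freeFlow t (moveParticle i (a • e0) (a • 0) z)) i -
    vel (freeFlow t (moveParticle i (a • e0) (a • 0) z)) j) = (0 : ℝ) := h3
  rw [smul_zero, vel_freeFlow, vel_freeFlow, vel_moveParticle_zero, vel_moveParticle_zero, ← hV] at h3
  set w := u - a • e0 - t • V with hw
  have hpw : proj w = pos z i - pos z j := by
    simp only [smul_zero, pos_freeFlow, vel_moveParticle_zero, pos_moveParticle_self,
      pos_moveParticle_of_ne hij.ne'] at h1
    simp only [hw, hV, proj_sub, h1, smul_sub]
    abel
  refine mem_biUnion (x := w) hpw ?_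
  have hq : w + a • e0 = u + (-t) • V := by rw [hw, neg_smul]; abel
  have h4 : ‖w + a • e0‖ ^ 2 = ε ^ 2 + t ^ 2 * ‖V‖ ^ 2 := by
    rw [hq, norm_sq_add_smul, h2, h3]; ring
  have h5 : inner ℝ w V + a * V 0 = -t * ‖V‖ ^ 2 := by
    have := congrArg (fun x => inner ℝ x V) hq
    simp only [inner_add_left, inner_smul_left, inner_e0, h3, real_inner_self_eq_norm_sq,
      conj_trivial] at this
    linarith
  have h6 : ‖w + a • e0‖ ^ 2 = a ^ 2 + 2 * w 0 * a + ‖w‖ ^ 2 := by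
    rw [norm_sq_add_smul, norm_e0, real_inner_comm, inner_e0]; ring
  have h7 : ‖V‖ ^ 2 * (a ^ 2 + 2 * w 0 * a + ‖w‖ ^ 2) - (inner ℝ w V + a * V 0) ^ 2 =
      ‖V‖ ^ 2 * ε ^ 2 := by
    rw [← h6, h4, h5]; ring
  simp only [mem_ofPred_eq]
  linarith

/-- The states whose free motion has a multiple or grazing shock. -/
def Singular (ε : ℝ) (z : State N) : Prop :=
  ∃ t : ℝ, HasMultipleShocks ε (freeFlow t z) ∨ HasGrazingShock ε (freeFlow t z)

theorem measure_singular (hε : 0 < ε) : phaseMeasure N {z | Singular ε z} = 0 := by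
  have hsub : {z : State N | Singular ε z} ⊆ {z | Generic z}ᶜ ∪
      ((⋃ l, ⋃ l', {z | Generic z} ∩ {z | ∃ t : ℝ, DoubleContact ε l l' (freeFlow t z)}) ∪
      ⋃ l, {z | Generic z} ∩ {z | ∃ t : ℝ, freeFlow t z ∈
      {z | ∃ u ∈ Metric.closedBall (0 : E3) ε, Contact ε l z u ∧ rate l z u ∈ ({0} : Set ℝ)}}) := by
    rintro z ⟨t, ht⟩
    by_cases hz : Generic z
    · right
      rcases ht with ht | ht
      · left
        obtain ⟨l, l', h⟩ := (hasMultipleShocks_iff hε).1 ht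
        exact mem_iUnion.2 ⟨l, mem_iUnion.2 ⟨l', hz, t, h⟩⟩
      · right
        obtain ⟨l, u, hu, h, hn⟩ := (exists_isShock_iff hε).1 ht
        exact mem_iUnion.2 ⟨l, hz, t, u, hu, h, (h.rate_eq_zero_iff hε).2 hn⟩
    · exact Or.inl hz
  refine measure_mono_null hsub (measure_union_null measure_not_generic (measure_union_null ?_ ?_))
  · exact measure_iUnion_null fun l => measure_iUnion_null fun l' => null_double l l'
  · exact measure_iUnion_null fun l => null_grazing l

theorem measure_wall : phaseMeasure N {z | ∃ i, IsShock ε z (.reflection i)} = 0 := by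
  have : {z : State N | ∃ i, IsShock ε z (.reflection i)} =
      ⋃ i, ⋃ b : Bool, {z | (pos z i).1 = wallCoord b} := by
    ext z
    simp [IsShock, wallCoord]
  rw [this]
  refine measure_iUnion_null fun i => measure_iUnion_null fun b => ?_
  have hc : IsClosed {z : State N | (pos z i).1 = wallCoord b} :=
    isClosed_eq (continuous_pos i).fst continuous_const
  refine null_of_countable_lines hc.measurableSet i e0 0 fun z => ?_
  refine (countable_contact_translates (ε := ε) (l := .inr (i, b)) (m := i) rfl 0 z).mono fun a ha => ?_
  refine ⟨0, ?_, rfl⟩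
  rw [freeFlow_zero]
  rwa [mem_ofPred_eq, smul_zero] at ha

end

/-! ### Invariance of the measure by finitely many steps -/

section

variable {ε : ℝ}

/-! ### Transport of measure by the dynamics -/

/-- The dynamics over the time `T` is defined, measurable and measure preserving on `D`. -/
structure Transports (ε T : ℝ) (D : Set (State N)) : Prop where
  measurableSet : MeasurableSet D
  mem_life : ∀ z ∈ D, T ∈ life ε z
  measurableSet_preimage : ∀ C, MeasurableSet C → MeasurableSet {z | z ∈ D ∧ orbit ε z T ∈ C}
  measure_image : ∀ B ⊆ D, MeasurableSet B →
    phaseMeasure N ((fun z => orbit ε z T) '' B) = phaseMeasure N B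

theorem orbit_injOn (hε : 0 < ε) (T : ℝ) :
    InjOn (fun z : State N => orbit ε z T) {z | T ∈ life ε z} := by
  intro z hz z' hz' h
  have h : orbit ε z T = orbit ε z' T := h
  rw [← (neg_mem_life hε hz).2, h, (neg_mem_life hε hz').2]

theorem Transports.injOn (hε : 0 < ε) {T : ℝ} {D : Set (State N)} (h : Transports ε T D) :
    InjOn (fun z => orbit ε z T) D := (orbit_injOn hε T).mono h.mem_life

/-- The time-T map is continued by the identity outside `D`, which gives a measurable map on the
whole space that is injective on `B`. -/
theorem Transports.measurableSet_image (hε : 0 < ε) {T : ℝ} {D B : Set (State N)}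
    (h : Transports ε T D) (hB : MeasurableSet B) (hBD : B ⊆ D) :
    MeasurableSet ((fun z => orbit ε z T) '' B) := by
  classical
  set g : State N → State N := fun z => if z ∈ D then orbit ε z T else z
  have hg : Measurable g := by
    intro C hC
    have : g ⁻¹' C = {z | z ∈ D ∧ orbit ε z T ∈ C} ∪ (Dᶜ ∩ C) := by
      ext z
      by_cases hz : z ∈ D <;> simp [g, hz]
    rw [this]
    exact (h.measurableSet_preimage C hC).union (h.measurableSet.compl.inter hC)
  have he : EqOn g (fun z => orbit ε z T) B := fun z hz => by simp [g, hBD hz]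
  rw [← he.image_eq]
  exact measurableSet_image_of_injOn hg hB (((h.injOn hε).mono hBD).congr he.symm)

/-- Cut `B` into disjoint pieces, one for each domain; the pieces have disjoint images because the
time-T map is injective. No monotonicity of the domains is needed. -/
theorem Transports.iUnion (hε : 0 < ε) {ι : Type*} [Countable ι] [Nonempty ι] {T : ℝ}
    {D : ι → Set (State N)} (h : ∀ i, Transports ε T (D i)) : Transports ε T (⋃ i, D i) := by
  obtain ⟨f, hf⟩ := exists_surjective_nat ι
  rw [← hf.iUnion_comp]
  set D' : ℕ → Set (State N) := fun n => D (f n)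
  have h' : ∀ n, Transports ε T (D' n) := fun n => h (f n)
  have hlife : ∀ z ∈ ⋃ n, D' n, T ∈ life ε z := by
    intro z hz
    obtain ⟨n, hn⟩ := mem_iUnion.1 hz
    exact (h' n).mem_life z hn
  refine ⟨MeasurableSet.iUnion fun n => (h' n).measurableSet, hlife, fun C hC => ?_,
    fun B hBD hB => ?_⟩
  · have : {z | z ∈ ⋃ n, D' n ∧ orbit ε z T ∈ C} = ⋃ n, {z | z ∈ D' n ∧ orbit ε z T ∈ C} := by
      ext z
      simp
    rw [this]
    exact MeasurableSet.iUnion fun n => (h' n).measurableSet_preimage C hC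
  · set E : ℕ → Set (State N) := fun n => B ∩ disjointed D' n
    have hE : ∀ n, MeasurableSet (E n) := fun n =>
      hB.inter (MeasurableSet.disjointed (fun k => (h' k).measurableSet) n)
    have hED : ∀ n, E n ⊆ D' n := fun n => inter_subset_right.trans (disjointed_subset D' n)
    have hBE : B = ⋃ n, E n := by
      rw [← inter_iUnion, iUnion_disjointed, inter_eq_left.2 hBD]
    have hdisj : Pairwise (Function.onFun Disjoint E) := fun m n hmn =>
      (disjoint_disjointed D' hmn).mono inter_subset_right inter_subset_right
    rw [hBE, image_iUnion, measure_iUnion ?_ fun n => (h' n).measurableSet_image hε (hE n) (hED n),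
      measure_iUnion hdisj hE]
    · exact tsum_congr fun n => (h' n).measure_image _ (hED n) (hE n)
    · intro m n hmn
      rw [Function.onFun, disjoint_left]
      rintro _ ⟨a, ha, rfl⟩ ⟨b, hb, hab⟩
      have : b = a := orbit_injOn hε T (hlife b (hBD hb.1)) (hlife a (hBD ha.1)) hab
      subst this
      exact disjoint_left.1 (hdisj hmn) ha hb

theorem Transports.comp (hε : 0 < ε) {T T' : ℝ} {D D' : Set (State N)} (h : Transports ε T D)
    (h' : Transports ε T' D') : Transports ε (T + T') {z | z ∈ D ∧ orbit ε z T ∈ D'} := by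
  have key : ∀ z, z ∈ D → orbit ε z T ∈ D' → T + T' ∈ life ε z ∧
      orbit ε z (T + T') = orbit ε (orbit ε z T) T' := fun z hz hz' =>
    add_mem_life hε (h.mem_life z hz) (h'.mem_life _ hz')
  refine ⟨h.measurableSet_preimage _ h'.measurableSet, fun z hz => (key z hz.1 hz.2).1,
    fun C hC => ?_, fun B hBD hB => ?_⟩
  · convert h.measurableSet_preimage _ (h'.measurableSet_preimage C hC) using 1
    ext z
    constructor
    · rintro ⟨⟨h1, h2⟩, h3⟩
      rw [(key z h1 h2).2] at h3
      exact ⟨h1, h2, h3⟩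
    · rintro ⟨h1, h2, h3⟩
      refine ⟨⟨h1, h2⟩, ?_⟩
      rwa [(key z h1 h2).2]
  · have himg : (fun z => orbit ε z (T + T')) '' B =
        (fun z => orbit ε z T') '' ((fun z => orbit ε z T) '' B) := by
      rw [image_image]
      exact image_congr fun z hz => (key z (hBD hz).1 (hBD hz).2).2
    have hBD1 : B ⊆ D := fun z hz => (hBD hz).1
    rw [himg, h'.measure_image _ ?_ (h.measurableSet_image hε hB hBD1), h.measure_image B hBD1 hB]
    rintro _ ⟨z, hz, rfl⟩
    exact (hBD hz).2

theorem transports_zero (hε : 0 < ε) : Transports (N := N) ε 0 {z | Adm ε z} := by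
  have h0 : ∀ z : State N, Adm ε z → (0 : ℝ) ∈ life ε z ∧ orbit ε z 0 = z := fun z hz =>
    ⟨zero_mem_life hε hz, orbit_zero z⟩
  refine ⟨measurableSet_adm hε, fun z hz => (h0 z hz).1, fun C hC => ?_, fun B hBD hB => ?_⟩
  · convert (measurableSet_adm hε).inter hC using 1
    ext z
    refine and_congr_right fun hz => ?_
    rw [(h0 z hz).2]
  · have : (fun z => orbit ε z 0) '' B = B := by
      rw [image_congr fun z hz => (h0 z (hBD hz)).2, image_id']
    rw [this]

/-! ### A single step -/

/-- There is no shock during free motion in `(0, c]`. -/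
def NoShock (ε c : ℝ) (z : State N) : Prop := ∀ s ∈ Ioc 0 c, ∀ σ, ¬ IsShock ε (freeFlow s z) σ

/-- The half-open time interval is exhausted by compact ones bounded away from 0, and for each of
these the existence of a shock is a closed condition. -/
theorem measurableSet_noShock (hε : 0 < ε) :
    MeasurableSet {q : State N × ℝ | NoShock ε q.2 q.1} := by
  have : {q : State N × ℝ | NoShock ε q.2 q.1}ᶜ = ⋃ n : ℕ, {q : State N × ℝ |
      ∃ s ∈ Icc (1 / ((n : ℝ) + 1)) n, (q, s) ∈ {p : (State N × ℝ) × ℝ | p.2 ≤ p.1.2 ∧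
        freeFlow p.2 p.1.1 ∈ {z | ∃ σ, IsShock ε z σ}}} := by
    ext ⟨z, c⟩
    simp only [NoShock, mem_compl_iff, mem_ofPred_eq, mem_iUnion]
    push Not
    constructor
    · rintro ⟨s, ⟨hs0, hsc⟩, h⟩
      obtain ⟨n, hn⟩ := exists_nat_ge s
      obtain ⟨m, hm⟩ := exists_nat_one_div_lt hs0
      refine ⟨max n m, s, ⟨le_trans ?_ hm.le, hn.trans ?_⟩, hsc, h⟩
      · have : (m : ℝ) ≤ (max n m : ℕ) := by exact_mod_cast le_max_right n m
        gcongr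
      · exact_mod_cast le_max_left n m
    · rintro ⟨n, s, ⟨hs, -⟩, hsc, h⟩
      exact ⟨s, ⟨lt_of_lt_of_le (by positivity) hs, hsc⟩, h⟩
  refine MeasurableSet.of_compl ?_
  rw [this]
  refine MeasurableSet.iUnion fun n => (isClosed_exists_mem isCompact_Icc ?_).measurableSet
  refine IsClosed.inter (isClosed_le continuous_snd (by fun_prop)) ?_
  exact (isClosed_exists_isShock hε).preimage
    (continuous_freeFlow_uncurry.comp (by fun_prop : Continuous fun p : (State N × ℝ) × ℝ =>
      (p.2, p.1.1)))

theorem measurableSet_noShock_lt (hε : 0 < ε) : MeasurableSet {q : State N × ℝ |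
    ∀ s ∈ Ioo 0 q.2, ∀ σ, ¬ IsShock ε (freeFlow s q.1) σ} := by
  have : {q : State N × ℝ | ∀ s ∈ Ioo 0 q.2, ∀ σ, ¬ IsShock ε (freeFlow s q.1) σ} =
      ⋂ n : ℕ, (fun q : State N × ℝ => (q.1, q.2 - 1 / ((n : ℝ) + 1))) ⁻¹'
        {q | NoShock ε q.2 q.1} := by
    ext ⟨z, c⟩
    simp only [mem_ofPred_eq, mem_iInter, mem_preimage, NoShock]
    constructor
    · intro h n s hs
      have : (0 : ℝ) < 1 / ((n : ℝ) + 1) := by positivity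
      exact h s ⟨hs.1, by linarith [hs.2]⟩
    · intro h s hs
      obtain ⟨n, hn⟩ := exists_nat_one_div_lt (sub_pos.2 hs.2)
      exact h n s ⟨hs.1, by linarith⟩
  rw [this]
  exact MeasurableSet.iInter fun n => (by fun_prop : Measurable fun q : State N × ℝ =>
    (q.1, q.2 - 1 / ((n : ℝ) + 1))) (measurableSet_noShock hε)

theorem measurableSet_freeStep (hε : 0 < ε) :
    MeasurableSet {q : State N × ℝ | FreeStep ε q.2 q.1} :=
  (measurable_fst (measurableSet_adm hε)).inter (measurableSet_noShock hε)

theorem measure_image_freeFlow (t : ℝ) {X : Set (State N)} (hX : MeasurableSet X) :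
    phaseMeasure N (freeFlow t '' X) = phaseMeasure N X := by
  have : freeFlow t '' X = freeFlow (-t) ⁻¹' X := by
    ext z
    constructor
    · rintro ⟨y, hy, rfl⟩
      rwa [mem_preimage, freeFlow_freeFlow, neg_add_cancel, freeFlow_zero]
    · intro h
      exact ⟨_, h, by rw [freeFlow_freeFlow, add_neg_cancel, freeFlow_zero]⟩
  rw [this, (measurePreserving_freeFlow (-t)).measure_preimage hX.nullMeasurableSet]

theorem transports_freeStep (hε : 0 < ε) {δ : ℝ} (hδ : 0 ≤ δ) :
    Transports (N := N) ε δ {z | FreeStep ε δ z} := by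
  have hm : MeasurableSet {z : State N | FreeStep ε δ z} :=
    (by fun_prop : Measurable fun z : State N => (z, δ)) (measurableSet_freeStep hε)
  refine ⟨hm, fun z hz => (FreeStep.orbit_eq hε hδ hz).1, fun C hC => ?_, fun B hBD hB => ?_⟩
  · convert hm.inter ((continuous_freeFlow δ).measurable hC) using 1
    ext z
    refine and_congr_right fun hz => ?_
    rw [(FreeStep.orbit_eq hε hδ hz).2, mem_preimage]
  · rw [image_congr fun z hz => (FreeStep.orbit_eq hε hδ (hBD hz)).2, measure_image_freeFlow δ hB]

theorem ShockStep.unique {δ t t' : ℝ} {σ σ' : Shock N} {z : State N}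
    (h : ShockStep ε δ σ t z) (h' : ShockStep ε δ σ' t' z) : t = t' ∧ σ = σ' := by
  have ht : t = t' := by
    rcases lt_trichotomy t t' with hlt | heq | hlt
    · exact absurd h.2.2.2.1.2.1 (h'.2.2.1 t ⟨h.2.1.1, hlt⟩ σ)
    · exact heq
    · exact absurd h'.2.2.2.1.2.1 (h.2.2.1 t' ⟨h'.2.1.1, hlt⟩ σ')
  subst ht
  exact ⟨rfl, h'.2.2.2.1.2.2.1 σ h.2.2.2.1.2.1⟩

/-- The shocks (state before the shock, representative, time) of the steps with exactly one shock. -/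
def stepEvents (ε δ : ℝ) (l : Label N) : Set (State N × E3 × ℝ) :=
  {q | Contact ε l q.1 q.2.1 ∧ ShockStep ε δ (shockOf l q.2.1) q.2.2 (freeFlow (-q.2.2) q.1)}

/-- The initial state of a step determines the time and the kind of its first shock. -/
theorem stepEvents_injOn {δ : ℝ} {l : Label N} :
    InjOn (fun q : State N × E3 × ℝ => freeFlow (-q.2.2) q.1) (stepEvents ε δ l) := by
  rintro ⟨ζ, u, t⟩ ⟨hc, h⟩ ⟨ζ', u', t'⟩ ⟨hc', h'⟩ he
  simp only at he hc hc' h h'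
  rw [← he] at h'
  obtain ⟨rfl, hσ⟩ := h.unique h'
  have : ζ = ζ' := freeFlow_injective _ he
  subst this
  obtain ⟨-, rfl⟩ := hc.eq_of_shockOf_eq hc' hσ
  rfl

theorem stepEvents_preContact {δ : ℝ} {l : Label N} {q : State N × E3 × ℝ}
    (hq : q ∈ stepEvents ε δ l) : PreContact ε l q.1 q.2.1 := by
  have := hq.2.2.2.2.1
  rw [freeFlow_freeFlow, add_neg_cancel, freeFlow_zero] at this
  exact ⟨hq.1, this⟩

/-- The final state is written as free flow over δ of the state after the shock extrapolated back by
the same time t. So start and end of the step are, up to free flow, the two images compared in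
`measure_image_shock`. -/
theorem stepEvents_orbit (hε : 0 < ε) {δ : ℝ} {l : Label N} {q : State N × E3 × ℝ}
    (hq : q ∈ stepEvents ε δ l) : δ ∈ life ε (freeFlow (-q.2.2) q.1) ∧
      orbit ε (freeFlow (-q.2.2) q.1) δ =
        freeFlow δ (freeFlow (-q.2.2) (jump (shockOf l q.2.1) q.1)) := by
  have := ShockStep.orbit_eq hε hq.2
  rw [freeFlow_freeFlow q.2.2, add_neg_cancel, freeFlow_zero] at this
  rw [freeFlow_freeFlow δ, ← sub_eq_add_neg]
  exact this

theorem measurableSet_stepEvents (hε : 0 < ε) (δ : ℝ) (l : Label N) :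
    MeasurableSet (stepEvents ε δ l) := by
  have h1 : Measurable fun q : State N × E3 × ℝ => q.2.2 := by fun_prop
  have h2 : Measurable fun q : State N × E3 × ℝ => freeFlow (-q.2.2) q.1 :=
    measurable_freeFlow h1.neg measurable_fst
  have h3 : Measurable fun q : State N × E3 × ℝ => jump (shockOf l q.2.1) q.1 :=
    measurable_jump_shockOf l measurable_fst (by fun_prop)
  have : stepEvents ε δ l = {q : State N × E3 × ℝ | PreContact ε l q.1 q.2.1} ∩
      ({q | freeFlow (-q.2.2) q.1 ∈ {z | Adm ε z}} ∩ ({q | q.2.2 ∈ Ioc 0 δ} ∩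
      ({q | (freeFlow (-q.2.2) q.1, q.2.2) ∈ {q : State N × ℝ |
        ∀ s ∈ Ioo 0 q.2, ∀ σ, ¬ IsShock ε (freeFlow s q.1) σ}} ∩
      {q | (jump (shockOf l q.2.1) q.1, δ - q.2.2) ∈ {q : State N × ℝ | FreeStep ε q.2 q.1}}))) := by
    ext ⟨ζ, u, t⟩
    simp only [stepEvents, ShockStep, PreContact, mem_inter_iff, mem_ofPred_eq, freeFlow_freeFlow t,
      add_neg_cancel, freeFlow_zero]
    tauto
  rw [this]
  refine MeasurableSet.inter ?_ (MeasurableSet.inter (h2 (measurableSet_adm hε))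
    (MeasurableSet.inter (h1 measurableSet_Ioc) (MeasurableSet.inter
    ((h2.prodMk h1) (measurableSet_noShock_lt hε))
    ((h3.prodMk (measurable_const.sub h1)) (measurableSet_freeStep hε)))))
  exact (by fun_prop : Measurable fun q : State N × E3 × ℝ => (q.1, q.2.1))
    (measurableSet_preContact hε l)

theorem transports_shockStep (hε : 0 < ε) (δ : ℝ) (l : Label N) :
    Transports ε δ ((fun q : State N × E3 × ℝ => freeFlow (-q.2.2) q.1) '' stepEvents ε δ l) := by
  have hA : Measurable fun q : State N × E3 × ℝ => freeFlow (-q.2.2) q.1 :=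
    measurable_freeFlow (by fun_prop) measurable_fst
  have hB : Measurable fun q : State N × E3 × ℝ =>
      freeFlow (-q.2.2) (jump (shockOf l q.2.1) q.1) :=
    measurable_freeFlow (by fun_prop) (measurable_jump_shockOf l measurable_fst (by fun_prop))
  have hE := measurableSet_stepEvents hε δ l
  have hBi : InjOn (fun q : State N × E3 × ℝ => freeFlow (-q.2.2) (jump (shockOf l q.2.1) q.1))
      (stepEvents ε δ l) := by
    intro q hq q' hq' h
    obtain ⟨h1, h2⟩ := stepEvents_orbit hε hq
    obtain ⟨h1', h2'⟩ := stepEvents_orbit hε hq'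
    refine stepEvents_injOn hq hq' (orbit_injOn hε δ h1 h1' ?_)
    simp only at h ⊢
    rw [h2, h2', h]
  refine ⟨measurableSet_image_of_injOn hA hE stepEvents_injOn, ?_, fun C hC => ?_, fun B hBD hBm => ?_⟩
  · rintro _ ⟨q, hq, rfl⟩
    exact (stepEvents_orbit hε hq).1
  · have : {z | z ∈ (fun q : State N × E3 × ℝ => freeFlow (-q.2.2) q.1) '' stepEvents ε δ l ∧
        orbit ε z δ ∈ C} = (fun q : State N × E3 × ℝ => freeFlow (-q.2.2) q.1) ''
        (stepEvents ε δ l ∩ {q | freeFlow (-q.2.2) (jump (shockOf l q.2.1) q.1) ∈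
          freeFlow δ ⁻¹' C}) := by
      ext z
      constructor
      · rintro ⟨⟨q, hq, rfl⟩, h⟩
        refine ⟨q, ⟨hq, ?_⟩, rfl⟩
        rwa [(stepEvents_orbit hε hq).2] at h
      · rintro ⟨q, ⟨hq, h⟩, rfl⟩
        refine ⟨⟨q, hq, rfl⟩, ?_⟩
        rw [(stepEvents_orbit hε hq).2]
        exact h
    rw [this]
    exact measurableSet_image_of_injOn hA
      (hE.inter (hB ((continuous_freeFlow δ).measurable hC))) (stepEvents_injOn.mono inter_subset_left)
  · set Q := stepEvents ε δ l ∩ (fun q : State N × E3 × ℝ => freeFlow (-q.2.2) q.1) ⁻¹' B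
    have hQ : MeasurableSet Q := hE.inter (hA hBm)
    have hQB : (fun q : State N × E3 × ℝ => freeFlow (-q.2.2) q.1) '' Q = B := by
      ext z
      constructor
      · rintro ⟨q, hq, rfl⟩
        exact hq.2
      · intro hz
        obtain ⟨q, hq, rfl⟩ := hBD hz
        exact ⟨q, ⟨hq, hz⟩, rfl⟩
    have himg : (fun z => orbit ε z δ) '' B = freeFlow δ ''
        ((fun q : State N × E3 × ℝ => freeFlow (-q.2.2) (jump (shockOf l q.2.1) q.1)) '' Q) := by
      rw [← hQB, image_image, image_image]
      exact image_congr fun q hq => (stepEvents_orbit hε hq.1).2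
    rw [himg, measure_image_freeFlow δ (measurableSet_image_of_injOn hB hQ (hBi.mono inter_subset_left)),
      measure_image_shock hε l hQ (fun q hq => stepEvents_preContact hq.1)
        (stepEvents_injOn.mono inter_subset_left) (hBi.mono inter_subset_left), hQB]

/-- The states with at most one shock in `(0, δ]`. -/
def StepSet (ε δ : ℝ) (N : ℕ) : Set (State N) :=
  {z | FreeStep ε δ z ∨ ∃ σ t, ShockStep ε δ σ t z}

theorem transports_stepSet (hε : 0 < ε) {δ : ℝ} (hδ : 0 ≤ δ) :
    Transports ε δ (StepSet ε δ N) := by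
  -- One domain for the steps without a shock and one for each of the finitely many labels.
  set D : Option (Label N) → Set (State N) := fun o => o.elim {z | FreeStep ε δ z} fun l =>
    (fun q : State N × E3 × ℝ => freeFlow (-q.2.2) q.1) '' stepEvents ε δ l
  have hD : StepSet ε δ N = ⋃ o, D o := by
    ext z
    simp only [mem_iUnion]
    constructor
    · rintro (h | ⟨σ, t, h⟩)
      · exact ⟨none, h⟩
      · obtain ⟨l, u, hc, rfl⟩ := h.2.2.2.1.2.1.exists_contact
        refine ⟨some l, (freeFlow t z, u, t), ⟨hc, ?_⟩, ?_⟩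
        · simpa only [freeFlow_freeFlow, neg_add_cancel, freeFlow_zero] using h
        · simp only [freeFlow_freeFlow, neg_add_cancel, freeFlow_zero]
    · rintro ⟨_ | l, h⟩
      · exact Or.inl h
      · obtain ⟨q, hq, rfl⟩ := h
        exact Or.inr ⟨_, _, hq.2⟩
  rw [hD]
  refine Transports.iUnion hε fun o => ?_
  rcases o with _ | l
  · exact transports_freeStep hε hδ
  · exact transports_shockStep hε δ l

/-- The states for which each of the first `n` steps of length `δ` has at most one shock. -/
def StepSets (ε δ : ℝ) (N : ℕ) : ℕ → Set (State N)
  | 0 => {z | Adm ε z}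
  | n + 1 => {z | z ∈ StepSets ε δ N n ∧ orbit ε z (n * δ) ∈ StepSet ε δ N}

theorem transports_stepSets (hε : 0 < ε) {δ : ℝ} (hδ : 0 ≤ δ) (n : ℕ) :
    Transports ε (n * δ) (StepSets ε δ N n) := by
  induction n with
  | zero =>
    rw [Nat.cast_zero, zero_mul]
    exact transports_zero hε
  | succ n ih =>
    have := ih.comp hε (transports_stepSet hε hδ)
    rw [Nat.cast_succ, add_mul, one_mul]
    exact this

/-- Choose the number of steps so large that the step length is below the minimal gap between shock
times. -/
theorem mem_stepSets_of_mem_life (hε : 0 < ε) {T : ℝ} (hT : 0 < T) {z : State N}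
    (h : T ∈ life ε z) : ∃ n : ℕ, z ∈ StepSets ε (T / (n + 1)) N (n + 1) := by
  obtain ⟨r, hr, hgap⟩ := exists_gap hε h
  obtain ⟨n, hn⟩ := exists_nat_one_div_lt (div_pos hr hT)
  refine ⟨n, ?_⟩
  have hn0 : (0 : ℝ) < (n : ℝ) + 1 := by positivity
  set δ := T / ((n : ℝ) + 1) with hδdef
  have hδ : 0 < δ := div_pos hT hn0
  have hδr : δ < r := by
    have h1 : T * (1 / ((n : ℝ) + 1)) < T * (r / T) := mul_lt_mul_of_pos_left hn hT
    rw [mul_div_cancel₀ _ hT.ne'] at h1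
    rw [hδdef]
    rwa [mul_one_div] at h1
  have hnT : ((n : ℝ) + 1) * δ = T := by rw [hδdef]; field_simp
  have h0 : (0 : ℝ) ∈ life ε z := zero_mem_life_of_mem h
  have hlife : ∀ s ∈ Icc 0 T, s ∈ life ε z := fun s hs => (ordConnected_life z).out h0 h hs
  have hk : ∀ k : ℕ, k ≤ n + 1 → (k : ℝ) * δ ∈ Icc 0 T := by
    intro k hk
    have : (k : ℝ) ≤ (n : ℝ) + 1 := by exact_mod_cast hk
    exact ⟨by positivity, by rw [← hnT]; gcongr⟩
  suffices ∀ k : ℕ, k ≤ n + 1 → z ∈ StepSets ε δ N k from this (n + 1) le_rfl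
  intro k
  induction k with
  | zero =>
    intro _
    have := adm_orbit hε h0
    rwa [orbit_zero] at this
  | succ k ih =>
    intro hk1
    refine ⟨ih (by omega), ?_⟩
    have h1 := hlife _ (hk k (by omega))
    have h2 := hk (k + 1) hk1
    have horb : ∀ s ∈ Ioc 0 δ, (k : ℝ) * δ + s ∈ Icc 0 T ∧ s ∈ life ε (orbit ε z (k * δ)) ∧
        orbit ε (orbit ε z (k * δ)) s = orbit ε z (k * δ + s) := by
      intro s hs
      have hmem : (k : ℝ) * δ + s ∈ Icc 0 T := by
        refine ⟨add_nonneg (hk k (by omega)).1 hs.1.le, le_trans ?_ h2.2⟩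
        push_cast
        linarith [hs.2]
      have := sub_mem_life hε h1 (hlife _ hmem)
      rw [add_sub_cancel_left] at this
      exact ⟨hmem, this⟩
    refine step_of_mem_life hε (horb δ ⟨hδ, le_rfl⟩).2.1 ?_
    intro s hs s' hs' hsh hsh'
    obtain ⟨a1, -, a3⟩ := horb s hs
    obtain ⟨b1, -, b3⟩ := horb s' hs'
    rw [a3] at hsh
    rw [b3] at hsh'
    have := hgap _ a1 _ b1 hsh hsh' (by
      rw [add_sub_add_left_eq_sub, abs_lt]
      constructor <;> linarith [hs.1, hs.2, hs'.1, hs'.2])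
    linarith

/-- The states whose trajectory lives until the time `T`. -/
def Alive (ε T : ℝ) (N : ℕ) : Set (State N) := {z | T ∈ life ε z}

theorem transports_alive (hε : 0 < ε) {T : ℝ} (hT : 0 < T) : Transports ε T (Alive ε T N) := by
  have hn : ∀ n : ℕ, ((n + 1 : ℕ) : ℝ) * (T / ((n : ℝ) + 1)) = T := fun n => by
    push_cast; field_simp
  have htr : ∀ n : ℕ, Transports ε T (StepSets ε (T / ((n : ℝ) + 1)) N (n + 1)) := by
    intro n
    have := transports_stepSets (N := N) hε (δ := T / ((n : ℝ) + 1)) (by positivity) (n + 1)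
    rwa [hn n] at this
  have : Alive ε T N = ⋃ n : ℕ, StepSets ε (T / ((n : ℝ) + 1)) N (n + 1) := by
    ext z
    rw [mem_iUnion]
    exact ⟨mem_stepSets_of_mem_life hε hT, fun ⟨n, hz⟩ => (htr n).mem_life z hz⟩
  rw [this]
  exact Transports.iUnion hε htr

end

/-! ### Two shocks within a short time have measure o(δ) -/

section

variable {ε : ℝ}

/-! ### Energy -/

/-- Twice the kinetic energy. -/
def energy (z : State N) : ℝ := ∑ i, ‖vel z i‖ ^ 2

theorem continuous_energy : Continuous (energy : State N → ℝ) := by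
  have := fun i : Fin N => continuous_vel i
  unfold energy
  fun_prop

@[simp] theorem energy_freeFlow (t : ℝ) (z : State N) : energy (freeFlow t z) = energy z := rfl

theorem norm_vel_le_of_energy {z : State N} {R : ℝ} (hR : 0 ≤ R) (h : energy z ≤ R ^ 2) (i : Fin N) :
    ‖vel z i‖ ≤ R := by
  refine (sq_le_sq₀ (norm_nonneg _) hR).1 (le_trans ?_ h)
  exact Finset.single_le_sum (f := fun i => ‖vel z i‖ ^ 2) (fun i _ => sq_nonneg _) (Finset.mem_univ i)

theorem energy_jump (hε : 0 < ε) {z : State N} {s : Shock N} (h : IsShock ε z s) :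
    energy (jump s z) = energy z := by
  rw [← sub_eq_zero, energy, energy, ← Finset.sum_sub_distrib]
  cases s with
  | collision i j u =>
    have hij : i ≠ j := h.1.ne
    have hu := ne_zero_of_isShock hε h
    change ∑ k, (‖vel (collide i j u z) k‖ ^ 2 - ‖vel z k‖ ^ 2) = 0
    rw [Fintype.sum_eq_add i j hij fun k hk => by rw [vel_collide_other hk.1 hk.2, sub_self],
      vel_collide_left hij, vel_collide_right]
    set ν := unitDir u
    set v := vel z i
    set w := vel z j
    have hν : ‖ν‖ = 1 := norm_unitDir hu
    rw [norm_sub_sq_real, norm_add_sq_real, norm_smul, hν, inner_smul_right, inner_smul_right,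
      real_inner_comm ν v, real_inner_comm ν w, inner_sub_right, mul_one, Real.norm_eq_abs, sq_abs]
    ring
  | reflection i =>
    rw [Fintype.sum_eq_single i fun k hk => by simp [jump, vel, hk], vel_jump_reflection,
      norm_smul_wallSign _ _ (norm_nonneg _), sub_self]

theorem energy_of_mem_stepSet (hε : 0 < ε) {δ : ℝ} (hδ : 0 ≤ δ) {z : State N}
    (h : z ∈ StepSet ε δ N) : energy (orbit ε z δ) = energy z := by
  rcases h with h | ⟨σ, t, h⟩
  · rw [(FreeStep.orbit_eq hε hδ h).2, energy_freeFlow]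
  · rw [(ShockStep.orbit_eq hε h).2, energy_freeFlow, energy_jump hε h.2.2.2.1.2.1, energy_freeFlow]

/-- The states of a trajectory with energy at most `R²`. -/
def EnergyBall (ε R : ℝ) (N : ℕ) : Set (State N) := {z | Adm ε z ∧ energy z ≤ R ^ 2}

theorem measurableSet_energyBall (hε : 0 < ε) (R : ℝ) : MeasurableSet (EnergyBall ε R N) :=
  (measurableSet_adm hε).inter (isClosed_le continuous_energy continuous_const).measurableSet

theorem measure_bounded_lt_top (K R : ℝ) :
    phaseMeasure N {z | ∀ i, |(pos z i).1| ≤ K ∧ ‖vel z i‖ ≤ R} < ∞ := by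
  have : {z : State N | ∀ i, |(pos z i).1| ≤ K ∧ ‖vel z i‖ ≤ R} =
      (univ.pi fun _ : Fin N => (Icc (-K) K ×ˢ (univ : Set (UnitAddCircle × UnitAddCircle))) ×ˢ
        Metric.closedBall (0 : E3) R) ×ˢ univ := by
    ext z
    simp [pos, vel, abs_le]
  have hσ : SigmaFinite (volume : Measure (Pos × E3)) := inferInstance
  rw [this, phaseMeasure, Measure.prod_prod, measure_univ, mul_one, volume_pi, Measure.pi_pi]
  refine ENNReal.prod_lt_top fun _ _ => ?_
  rw [Measure.volume_eq_prod, Measure.prod_prod]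
  exact ENNReal.mul_lt_top (isCompact_Icc.prod isCompact_univ).measure_lt_top
    (isCompact_closedBall 0 R).measure_lt_top

theorem measure_energyBall_lt_top {R : ℝ} (hR : 0 ≤ R) :
    phaseMeasure N (EnergyBall ε R N) < ∞ := by
  refine lt_of_le_of_lt (measure_mono ?_) (measure_bounded_lt_top 1 R)
  intro z hz i
  have h := (mem_contact_iff.1 hz.1.1).1.1 i
  exact ⟨abs_le.2 ⟨by linarith [h.1], h.2⟩, norm_vel_le_of_energy hR hz.2 i⟩

/-! ### Tubes -/

/-- The states that reach, under free motion, an element of `P` at a time in `(a, b]`. -/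
def tube (P : Set (State N × E3)) (a b : ℝ) : Set (State N) :=
  (fun q : State N × E3 × ℝ => freeFlow (-q.2.2) q.1) '' {q | (q.1, q.2.1) ∈ P ∧ q.2.2 ∈ Ioc a b}

/-- Different elements of `P` are not reached from the same state in the time interval `(0, h]`. -/
def TubeInj (P : Set (State N × E3)) (h : ℝ) : Prop :=
  InjOn (fun q : State N × E3 × ℝ => freeFlow (-q.2.2) q.1)
    {q | (q.1, q.2.1) ∈ P ∧ q.2.2 ∈ Ioc 0 h}

theorem TubeInj.mono {P P' : Set (State N × E3)} {h : ℝ} (hP : TubeInj P h) (hs : P' ⊆ P) :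
    TubeInj P' h := by
  refine InjOn.mono ?_ hP
  intro q hq
  exact ⟨hs hq.1, hq.2⟩

theorem measurableSet_tube {P : Set (State N × E3)} (hP : MeasurableSet P) {h a b : ℝ}
    (hinj : TubeInj P h) (ha : 0 ≤ a) (hb : b ≤ h) : MeasurableSet (tube P a b) := by
  have hsub : {q : State N × E3 × ℝ | (q.1, q.2.1) ∈ P ∧ q.2.2 ∈ Ioc a b} ⊆
      {q | (q.1, q.2.1) ∈ P ∧ q.2.2 ∈ Ioc 0 h} :=
    fun q hq => ⟨hq.1, ha.trans_lt hq.2.1, hq.2.2.trans hb⟩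
  refine measurableSet_image_of_injOn (measurable_freeFlow (by fun_prop) measurable_fst) ?_
    (InjOn.mono hsub hinj)
  exact ((by fun_prop : Measurable fun q : State N × E3 × ℝ => (q.1, q.2.1)) hP).inter
    ((by fun_prop : Measurable fun q : State N × E3 × ℝ => q.2.2) measurableSet_Ioc)

theorem tube_shift (P : Set (State N × E3)) (a b c : ℝ) :
    tube P (a + c) (b + c) = freeFlow (-c) '' tube P a b := by
  ext z
  constructor
  · rintro ⟨⟨ζ, u, t⟩, ⟨hq, ht⟩, rfl⟩
    refine ⟨_, ⟨(ζ, u, t - c), ⟨hq, by linarith [ht.1], by linarith [ht.2]⟩, rfl⟩, ?_⟩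
    rw [freeFlow_freeFlow]
    exact congrArg (fun s => freeFlow s ζ) (by ring)
  · rintro ⟨_, ⟨⟨ζ, u, t⟩, ⟨hq, ht⟩, rfl⟩, rfl⟩
    refine ⟨(ζ, u, t + c), ⟨hq, by linarith [ht.1], by linarith [ht.2]⟩, ?_⟩
    rw [freeFlow_freeFlow]
    exact congrArg (fun s => freeFlow s ζ) (by ring)

theorem measure_tube_add {P : Set (State N × E3)} (hP : MeasurableSet P) {h a b c : ℝ}
    (hinj : TubeInj P h) (ha : 0 ≤ a) (hab : a ≤ b) (hbc : b ≤ c) (hc : c ≤ h) :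
    phaseMeasure N (tube P a c) = phaseMeasure N (tube P a b) + phaseMeasure N (tube P b c) := by
  have hu : tube P a c = tube P a b ∪ tube P b c := by
    rw [tube, tube, tube, ← image_union]
    congr 1
    ext q
    have : q.2.2 ∈ Ioc a c ↔ q.2.2 ∈ Ioc a b ∨ q.2.2 ∈ Ioc b c := by
      rw [← mem_union, Ioc_union_Ioc_eq_Ioc hab hbc]
    simp only [mem_ofPred_eq, mem_union, this]
    tauto
  rw [hu, measure_union ?_ (measurableSet_tube hP hinj (ha.trans hab) hc)]
  rw [disjoint_left]
  rintro _ ⟨q, hq, rfl⟩ ⟨q', hq', he⟩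
  have : q' = q := hinj ⟨hq'.1, (ha.trans hab).trans_lt hq'.2.1, hq'.2.2.trans hc⟩
    ⟨hq.1, ha.trans_lt hq.2.1, hq.2.2.trans (hbc.trans hc)⟩ he
  subst this
  exact absurd hq'.2.1 (not_lt.2 hq.2.2)

/-- The tube over (kδ, (k+1)δ] is the image of the tube over (0, δ] under free flow, hence of the
same measure, and the pieces are disjoint by injectivity. -/
theorem measure_tube_mul {P : Set (State N × E3)} (hP : MeasurableSet P) {h δ : ℝ} (hδ : 0 ≤ δ)
    (hinj : TubeInj P h) (k : ℕ) (hk : k * δ ≤ h) :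
    phaseMeasure N (tube P 0 (k * δ)) = k * phaseMeasure N (tube P 0 δ) := by
  induction k with
  | zero => simp [tube]
  | succ k ih =>
    have h1 : (k : ℝ) * δ ≤ ((k + 1 : ℕ) : ℝ) * δ := by gcongr; simp
    have h2 : (k : ℝ) * δ ≤ h := h1.trans hk
    have h3 := tube_shift P 0 δ (k * δ)
    rw [zero_add] at h3
    have h4 : ((k + 1 : ℕ) : ℝ) * δ = δ + k * δ := by push_cast; ring
    rcases Nat.eq_zero_or_pos k with rfl | hkpos
    · simp
    have h5 : δ ≤ h := by
      have : (1 : ℝ) ≤ k := by exact_mod_cast hkpos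
      nlinarith
    rw [measure_tube_add hP hinj le_rfl (by positivity) h1 hk, ih h2, h4, h3,
      measure_image_freeFlow _ (measurableSet_tube hP hinj le_rfl h5)]
    push_cast
    ring

/-! ### Shocks followed by another shock -/

/-- The states before a shock, with energy at most `R²` and representative close to `c`. -/
def LocalContact (ε R : ℝ) (l : Label N) (c : E3) : Set (State N × E3) :=
  {q | PreContact ε l q.1 q.2 ∧ q.2 ∈ Metric.ball c (1 / 4) ∧ energy q.1 ≤ R ^ 2}

/-- Such states for which another shock follows within the time `δ`. -/
def QuickContact (ε R δ : ℝ) (l : Label N) (c : E3) : Set (State N × E3) :=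
  {q | q ∈ LocalContact ε R l c ∧ ¬ NoShock ε δ (jump (shockOf l q.2) q.1)}

theorem measurableSet_quickContact (hε : 0 < ε) (R δ : ℝ) (l : Label N) (c : E3) :
    MeasurableSet (QuickContact ε R δ l c) := by
  refine MeasurableSet.inter (MeasurableSet.inter (measurableSet_preContact hε l) (MeasurableSet.inter
    (measurable_snd measurableSet_ball)
    (measurable_fst (isClosed_le continuous_energy continuous_const).measurableSet))) ?_
  have h : Measurable fun q : State N × E3 => jump (shockOf l q.2) q.1 :=
    measurable_jump_shockOf l measurable_fst measurable_snd
  exact ((h.prodMk measurable_const) (measurableSet_noShock hε)).compl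

/-- Two representatives near `c` differ by less than 1/2, and relative motion with speed at most 2R
within time h contributes at most 1/2. So the representatives extrapolated to the common state are
less than 1 apart and therefore equal, and a line enters the sphere only once. At a wall the time is
determined by the nonzero normal velocity. -/
theorem tubeInj_localContact (hε : 0 < ε) {R h : ℝ} (hR : 0 ≤ R) (hh : 2 * R * h ≤ 1 / 2)
    (l : Label N) (c : E3) : TubeInj (LocalContact ε R l c) h := by
  rintro ⟨ζ, u, t⟩ ⟨⟨hc, hu, he⟩, ht⟩ ⟨ζ', u', t'⟩ ⟨⟨hc', hu', he'⟩, ht'⟩ heq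
  simp only at hc hu he hc' hu' he' ht ht' heq
  have hv : ∀ k, vel ζ k = vel ζ' k := fun k =>
    show vel (freeFlow (-t) ζ) k = vel (freeFlow (-t') ζ') k by rw [heq]
  have hp : ∀ k, pos ζ k + proj (-t • vel ζ k) = pos ζ' k + proj (-t' • vel ζ' k) := fun k =>
    show pos (freeFlow (-t) ζ) k = pos (freeFlow (-t') ζ') k by rw [heq]
  have hr := ((preContact_iff hε).1 hc).2.2.2
  have hr' := ((preContact_iff hε).1 hc').2.2.2
  suffices h : u = u' ∧ t = t' by
    obtain ⟨rfl, rfl⟩ := h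
    rw [freeFlow_injective _ heq]
  rcases l with ⟨i, j⟩ | ⟨i, b⟩
  · set V := vel ζ i - vel ζ j with hV
    have hV' : vel ζ' i - vel ζ' j = V := by rw [hV, hv, hv]
    have hsub : u - t • V = u' - t' • V := by
      by_contra hne
      have hproj : proj (u - t • V) = proj (u' - t' • V) := by
        have h1 := hp i
        have h2 := hp j
        have e : ∀ (w : E3) (s : ℝ), w - s • V = w + -s • vel ζ i - -s • vel ζ j := fun w s => by
          rw [hV]; module
        rw [e, e, proj_sub, proj_add, proj_sub, proj_add, hc.1.2.1, hc'.1.2.1]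
        simp only
        rw [← hv i] at h1
        rw [← hv j] at h2
        calc pos ζ i - pos ζ j + proj (-t • vel ζ i) - proj (-t • vel ζ j)
            = (pos ζ i + proj (-t • vel ζ i)) - (pos ζ j + proj (-t • vel ζ j)) := by abel
          _ = pos ζ' i - pos ζ' j + proj (-t' • vel ζ i) - proj (-t' • vel ζ j) := by
            rw [h1, h2]; abel
      have h1 := one_le_norm_sub hproj hne
      have h2 : ‖u - u'‖ < 1 / 2 := by
        have := dist_triangle_right u u' c
        rw [Metric.mem_ball] at hu hu'
        rw [← dist_eq_norm]
        linarith
      have h3 : ‖V‖ ≤ 2 * R := by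
        have := norm_sub_le (vel ζ i) (vel ζ j)
        have a := norm_vel_le_of_energy hR he i
        have b := norm_vel_le_of_energy hR he j
        linarith
      have h4 : |t - t'| ≤ h := by
        rw [abs_le]; constructor <;> linarith [ht.1, ht.2, ht'.1, ht'.2]
      have h5 : ‖(t - t') • V‖ ≤ h * (2 * R) := by
        rw [norm_smul, Real.norm_eq_abs]
        exact mul_le_mul h4 h3 (norm_nonneg _) ((abs_nonneg _).trans h4)
      have h6 : u - t • V - (u' - t' • V) = (u - u') - (t - t') • V := by module
      rw [h6] at h1
      have := norm_sub_le (u - u') ((t - t') • V)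
      linarith
    refine line_sphere_unique (σ := -1) hc.1.2.2 hc'.1.2.2 hsub ?_ ?_
    · change inner ℝ u V < 0 at hr
      linarith
    · change inner ℝ u' (vel ζ' i - vel ζ' j) < 0 at hr'
      rw [hV'] at hr'
      linarith
  · refine ⟨hc.1.2.trans hc'.1.2.symm, ?_⟩
    have h1 := congrArg Prod.fst (hp i)
    have h2 : (pos ζ i).1 = (pos ζ' i).1 := hc.1.1.trans hc'.1.1.symm
    have h0 : vel ζ i 0 ≠ 0 := by
      intro h0
      simp [rate, h0] at hr
    simp only [Prod.fst_add, proj, PiLp.smul_apply, smul_eq_mul, ← hv i, h2] at h1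
    have h3 : t * vel ζ i 0 = t' * vel ζ i 0 := by linarith
    exact mul_right_cancel₀ h0 h3

theorem quickContact_anti {R δ δ' : ℝ} (h : δ ≤ δ') (l : Label N) (c : E3) :
    QuickContact ε R δ l c ⊆ QuickContact ε R δ' l c :=
  fun _ hq => ⟨hq.1, fun hn => hq.2 fun s hs => hn s ⟨hs.1, hs.2.trans h⟩⟩

/-- After any given regular shock the motion is free for some positive time, so these decreasing
sets have empty intersection. Continuity from above applies because the energy bound makes the
measure finite. -/
theorem tendsto_measure_tube (hε : 0 < ε) {R h : ℝ} (hR : 0 ≤ R) (hh0 : 0 < h)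
    (hh : 2 * R * h ≤ 1 / 2) (l : Label N) (c : E3) :
    Tendsto (fun m : ℕ => phaseMeasure N (tube (QuickContact ε R (h / (m + 1)) l c) 0 h)) atTop
      (𝓝 0) := by
  set P : ℕ → Set (State N × E3) := fun m => QuickContact ε R (h / (m + 1)) l c
  have hinjL := tubeInj_localContact hε hR hh l c
  have hinj : ∀ m, TubeInj (P m) h := fun m => hinjL.mono fun q hq => hq.1
  have hanti : Antitone fun m => tube (P m) 0 h := by
    intro m n hmn
    refine image_mono fun q hq => ⟨quickContact_anti ?_ l c hq.1, hq.2⟩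
    gcongr
  have hempty : ⋂ m, tube (P m) 0 h = ∅ := by
    rw [eq_empty_iff_forall_notMem]
    intro z hz
    rw [mem_iInter] at hz
    obtain ⟨q, ⟨hq, hqt⟩, rfl⟩ := hz 0
    have hadm := hq.1.1.2.adm_jump hε
    obtain ⟨δ, hδ, hfree⟩ := hadm.exists_free hε
    obtain ⟨m, hm⟩ := exists_nat_one_div_lt (div_pos hδ hh0)
    obtain ⟨q', ⟨hq', hqt'⟩, he⟩ := hz m
    have : q' = q := hinjL ⟨hq'.1, hqt'⟩ ⟨hq.1, hqt⟩ he
    subst this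
    refine hq'.2 fun s hs => hfree s ⟨hs.1, hs.2.trans_lt ?_⟩
    have := mul_lt_mul_of_pos_left hm hh0
    rwa [mul_one_div, mul_div_cancel₀ _ hh0.ne'] at this
  -- States of a tube are extrapolated by free flow and may lie outside the slab, but by at most hR.
  have hfin : phaseMeasure N (tube (P 0) 0 h) ≠ ∞ := by
    refine ne_of_lt (lt_of_le_of_lt (measure_mono ?_) (measure_bounded_lt_top (1 + h * R) R))
    rintro _ ⟨⟨ζ, u, t⟩, ⟨hq, ht⟩, rfl⟩ i
    have h1 := (mem_contact_iff.1 hq.1.1.2.1).1.1 i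
    have h2 := norm_vel_le_of_energy hR hq.1.2.2 i
    refine ⟨?_, h2⟩
    have h3 := (abs_apply_le_norm (vel ζ i) 0).trans h2
    have h4 : |t * vel ζ i 0| ≤ h * R := by
      rw [abs_mul]
      exact mul_le_mul (abs_le.2 ⟨by linarith [ht.1], ht.2⟩) h3 (abs_nonneg _) hh0.le
    have h5 : (pos (freeFlow (-t) ζ) i).1 = (pos ζ i).1 - t * vel ζ i 0 := by
      simp [freeFlow, pos, proj, vel, sub_eq_add_neg]
    simp only
    rw [h5]
    rw [abs_le] at h4 ⊢
    constructor <;> linarith [h1.1, h1.2, h4.1, h4.2]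
  have := tendsto_measure_iInter_atTop (μ := phaseMeasure N) (s := fun m => tube (P m) 0 h)
    (fun m => (measurableSet_tube (measurableSet_quickContact hε R _ l c) (hinj m) le_rfl
      le_rfl).nullMeasurableSet) hanti ⟨0, hfin⟩
  rwa [hempty, measure_empty] at this

/-! ### Two shocks in one step -/

/-- An admissible state is free for some time η > 0, so the shock times in (0, δ] form a nonempty
compact subset of [η, δ] and have a minimum. That shock is regular since the free motion is not
singular. -/
theorem Adm.exists_first_shock (hε : 0 < ε) {δ : ℝ} {z : State N} (hz : Adm ε z)
    (hs : ¬ Singular ε z) (h : ¬ NoShock ε δ z) : ∃ t ∈ Ioc 0 δ, ∃ σ,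
      (∀ s ∈ Ioo 0 t, ∀ σ', ¬ IsShock ε (freeFlow s z) σ') ∧ Pre ε σ (freeFlow t z) := by
  obtain ⟨η, hη, hfree⟩ := hz.exists_free hε
  have hcl : IsClosed {s : ℝ | ∃ σ, IsShock ε (freeFlow s z) σ} :=
    (isClosed_exists_isShock hε).preimage (continuous_freeFlow_left z)
  have hge : ∀ s, 0 < s → (∃ σ, IsShock ε (freeFlow s z) σ) → η ≤ s := by
    intro s hs0 ⟨σ, hσ⟩
    by_contra hlt
    exact hfree s ⟨hs0, not_le.1 hlt⟩ σ hσ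
  simp only [NoShock] at h
  push Not at h
  obtain ⟨s₀, hs₀, hσ₀⟩ := h
  obtain ⟨t, ⟨⟨hηt, htδ⟩, σ, hσ⟩, hleast⟩ := (isCompact_Icc (a := η) (b := δ)).inter_right hcl
    |>.exists_isLeast ⟨s₀, ⟨hge s₀ hs₀.1 hσ₀, hs₀.2⟩, hσ₀⟩
  have ht0 : 0 < t := hη.trans_le hηt
  have hbefore : ∀ s ∈ Ioo 0 t, ∀ σ', ¬ IsShock ε (freeFlow s z) σ' := by
    intro s hs σ' hσ'
    have h1 := hge s hs.1 ⟨σ', hσ'⟩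
    exact absurd hs.2 (not_lt.2 (hleast ⟨⟨h1, hs.2.le.trans htδ⟩, σ', hσ'⟩))
  refine ⟨t, ⟨ht0, htδ⟩, σ, hbefore, ?_⟩
  have hno := noOverlap_of_not_isShock hε hz hbefore
  have hev : ∀ᶠ s in 𝓝[<] (0 : ℝ), NoOverlap ε (freeFlow s (freeFlow t z)) := by
    have : Ioo (-t) 0 ∈ 𝓝[<] (0 : ℝ) := Ioo_mem_nhdsLT (by linarith)
    filter_upwards [this] with s hs
    rw [freeFlow_freeFlow]
    exact hno _ ⟨by linarith [hs.1], by linarith [hs.2]⟩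
  have hcontact : NoOverlap ε (freeFlow t z) := by
    have h1 : Tendsto (fun s => freeFlow s (freeFlow t z)) (𝓝[<] (0 : ℝ)) (𝓝 (freeFlow t z)) := by
      have := (continuous_freeFlow_left (freeFlow t z)).tendsto 0
      rw [freeFlow_zero] at this
      exact this.mono_left nhdsWithin_le_nhds
    exact isClosed_noOverlap.mem_of_tendsto h1 hev
  have hm : ¬ HasMultipleShocks ε (freeFlow t z) := fun hm => hs ⟨t, Or.inl hm⟩
  refine ⟨mem_contact_iff.2 ⟨hcontact, (mem_contact_iff.1 hz.1).2⟩, hσ,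
    fun s' hs' => eq_of_not_hasMultipleShocks hm hσ hs', ?_⟩
  exact lt_of_le_of_ne (normalVel_nonpos_of_frequently hε hev.frequently hσ)
    fun h0 => hs ⟨t, Or.inr ⟨σ, hσ, h0⟩⟩

/-- If the step has more than one shock, then the first shock, at time t, is followed by another one
within δ − t, in particular within δ. -/
theorem exists_mem_tube (hε : 0 < ε) {R δ : ℝ} {z : State N} (hz : z ∈ EnergyBall ε R N)
    (hs : ¬ Singular ε z) (h : z ∉ StepSet ε δ N) {C : Set E3}
    (hC : Metric.closedBall (0 : E3) ε ⊆ ⋃ c ∈ C, Metric.ball c (1 / 4)) :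
    ∃ l, ∃ c ∈ C, z ∈ tube (QuickContact ε R δ l c) 0 δ := by
  obtain ⟨t, ht, σ, hbefore, hpre⟩ := hz.1.exists_first_shock hε hs fun hn => h (Or.inl ⟨hz.1, hn⟩)
  obtain ⟨l, u, hlu, rfl⟩ := hpre.2.1.exists_contact
  obtain ⟨c, hc, huc⟩ := mem_iUnion₂.1 (hC (hlu.norm_le hε))
  refine ⟨l, c, hc, (freeFlow t z, u, t), ⟨⟨⟨⟨hlu, hpre⟩, huc, hz.2⟩, fun hn => h (Or.inr ?_)⟩, ht⟩, ?_⟩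
  · exact ⟨_, t, hz.1, ht, hbefore, hpre, hpre.adm_jump hε,
      fun s hs => hn s ⟨hs.1, by linarith [hs.2, ht.1]⟩⟩
  · simp only [freeFlow_freeFlow, neg_add_cancel, freeFlow_zero]

/-- With δ = h/(m+1), the factor m + 1 turns the tubes of length δ into tubes of the fixed length h,
whose measure tends to 0. -/
theorem tendsto_measure_not_stepSet (hε : 0 < ε) {R h : ℝ} (hR : 0 ≤ R) (hh0 : 0 < h)
    (hh : 2 * R * h ≤ 1 / 2) : Tendsto (fun m : ℕ => ((m + 1 : ℕ) : ℝ≥0∞) *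
      phaseMeasure N (EnergyBall ε R N \ StepSet ε (h / (m + 1)) N)) atTop (𝓝 0) := by
  -- Balls of radius 1/4 are small enough for the injectivity of the tubes, and finitely many
  -- suffice for all representatives of length at most ε.
  obtain ⟨C, -, hCfin, hC⟩ := finite_cover_balls_of_compact (isCompact_closedBall (0 : E3) ε)
    (show (0 : ℝ) < 1 / 4 by norm_num)
  have hlim : Tendsto (fun m : ℕ => ∑ l : Label N, ∑ c ∈ hCfin.toFinset,
      phaseMeasure N (tube (QuickContact ε R (h / (m + 1)) l c) 0 h)) atTop (𝓝 0) := by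
    rw [show (0 : ℝ≥0∞) = ∑ l : Label N, ∑ c ∈ hCfin.toFinset, 0 by simp]
    exact tendsto_finsetSum _ fun l _ => tendsto_finsetSum _ fun c _ =>
      tendsto_measure_tube hε hR hh0 hh l c
  refine tendsto_of_tendsto_of_tendsto_of_le_of_le tendsto_const_nhds hlim (fun _ => bot_le)
    fun m => ?_
  set δ := h / ((m : ℝ) + 1) with hδ
  have hδ0 : 0 < δ := by positivity
  have hmδ : ((m + 1 : ℕ) : ℝ) * δ = h := by rw [hδ]; push_cast; field_simp
  have hsub : EnergyBall ε R N \ StepSet ε δ N ⊆ {z | Singular ε z} ∪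
      ⋃ l : Label N, ⋃ c ∈ hCfin.toFinset, tube (QuickContact ε R δ l c) 0 δ := by
    intro z hz
    by_cases hs : Singular ε z
    · exact Or.inl hs
    · obtain ⟨l, c, hc, hmem⟩ := exists_mem_tube hε hz.1 hs hz.2 hC
      exact Or.inr (mem_iUnion.2 ⟨l, mem_iUnion₂.2 ⟨c, by simpa using hc, hmem⟩⟩)
  have hle : phaseMeasure N (EnergyBall ε R N \ StepSet ε δ N) ≤
      ∑ l : Label N, ∑ c ∈ hCfin.toFinset, phaseMeasure N (tube (QuickContact ε R δ l c) 0 δ) := by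
    refine (measure_mono hsub).trans ((measure_union_le _ _).trans ?_)
    rw [measure_singular hε, zero_add]
    refine (measure_iUnion_fintype_le _ _).trans (Finset.sum_le_sum fun l _ => ?_)
    exact measure_biUnion_finset_le _ _
  calc ((m + 1 : ℕ) : ℝ≥0∞) * phaseMeasure N (EnergyBall ε R N \ StepSet ε δ N)
      ≤ ((m + 1 : ℕ) : ℝ≥0∞) * ∑ l : Label N, ∑ c ∈ hCfin.toFinset,
          phaseMeasure N (tube (QuickContact ε R δ l c) 0 δ) := by gcongr
    _ = ∑ l : Label N, ∑ c ∈ hCfin.toFinset,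
          phaseMeasure N (tube (QuickContact ε R δ l c) 0 h) := by
        simp only [Finset.mul_sum]
        refine Finset.sum_congr rfl fun l _ => Finset.sum_congr rfl fun c _ => ?_
        rw [← measure_tube_mul (measurableSet_quickContact hε R δ l c) hδ0.le
          ((tubeInj_localContact hε hR hh l c).mono fun q hq => hq.1) (m + 1) hmδ.le, hmδ]

end

/-! ### Almost all trajectories are global; conclusion -/

section

variable {ε : ℝ}

/-! ### Almost all trajectories are global -/

theorem energy_of_mem_stepSets (hε : 0 < ε) {δ : ℝ} (hδ : 0 ≤ δ) {n : ℕ} {z : State N}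
    (h : z ∈ StepSets ε δ N n) : energy (orbit ε z (n * δ)) = energy z := by
  induction n with
  | zero => rw [Nat.cast_zero, zero_mul, orbit_zero]
  | succ n ih =>
    have h1 := (transports_stepSets hε hδ n).mem_life z h.1
    have h2 := (transports_stepSet hε hδ).mem_life _ h.2
    rw [Nat.cast_succ, add_mul, one_mul, (add_mem_life hε h1 h2).2,
      energy_of_mem_stepSet hε hδ h.2, ih h.1]

/-- A state that fails for the first time in step n + 1 is carried by the first n steps into the
failure set of a single step. These steps preserve measure and energy, so each step loses at most
the same amount. -/
theorem measure_not_stepSets (hε : 0 < ε) {δ : ℝ} (hδ : 0 ≤ δ) (R : ℝ) (n : ℕ) :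
    phaseMeasure N (EnergyBall ε R N \ StepSets ε δ N n) ≤
      n * phaseMeasure N (EnergyBall ε R N \ StepSet ε δ N) := by
  induction n with
  | zero =>
    have : EnergyBall ε R N \ StepSets ε δ N 0 = ∅ := sdiff_eq_empty.2 fun z hz => hz.1
    simp [this]
  | succ n ih =>
    have htr := transports_stepSets (N := N) hε hδ n
    set B : Set (State N) := {z | z ∈ StepSets ε δ N n ∧ orbit ε z (n * δ) ∈ (StepSet ε δ N)ᶜ} ∩
      {z | energy z ≤ R ^ 2}
    have hB : MeasurableSet B :=
      (htr.measurableSet_preimage _ (transports_stepSet hε hδ).measurableSet.compl).inter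
        (isClosed_le continuous_energy continuous_const).measurableSet
    have hBle : phaseMeasure N B ≤ phaseMeasure N (EnergyBall ε R N \ StepSet ε δ N) := by
      rw [← htr.measure_image B (fun z hz => hz.1.1) hB]
      refine measure_mono ?_
      rintro _ ⟨z, ⟨⟨h1, h2⟩, h3⟩, rfl⟩
      refine ⟨⟨adm_orbit hε (htr.mem_life z h1), ?_⟩, h2⟩
      rw [energy_of_mem_stepSets hε hδ h1]
      exact h3
    have hsub : EnergyBall ε R N \ StepSets ε δ N (n + 1) ⊆
        (EnergyBall ε R N \ StepSets ε δ N n) ∪ B := by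
      intro z hz
      by_cases h : z ∈ StepSets ε δ N n
      · exact Or.inr ⟨⟨h, fun h' => hz.2 ⟨h, h'⟩⟩, hz.1.2⟩
      · exact Or.inl ⟨hz.1, h⟩
    refine (measure_mono hsub).trans ((measure_union_le _ _).trans ((add_le_add ih hBle).trans ?_))
    rw [Nat.cast_succ, add_mul, one_mul]

theorem measure_energyBall_not_alive (hε : 0 < ε) {R T : ℝ} (hR : 0 ≤ R) (hT : 0 < T) :
    phaseMeasure N (EnergyBall ε R N \ Alive ε T N) = 0 := by
  -- With h = T/M this gives 2Rh ≤ 1/2. The time T is then divided into M(m+1) steps, where M is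
  -- fixed and m tends to infinity.
  obtain ⟨M, hM⟩ := exists_nat_gt (4 * R * T)
  have hM0 : (0 : ℝ) < M := lt_of_le_of_lt (by positivity) hM
  set h := T / M with hh
  have hh0 : 0 < h := by positivity
  have hhR : 2 * R * h ≤ 1 / 2 := by
    rw [hh, mul_div_assoc', div_le_iff₀ hM0]
    linarith
  have hlim := tendsto_measure_not_stepSet (N := N) hε hR hh0 hhR
  have hlim' := ENNReal.Tendsto.const_mul (a := (M : ℝ≥0∞)) hlim (Or.inr (ENNReal.natCast_ne_top M))
  rw [mul_zero] at hlim'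
  refine le_antisymm (ge_of_tendsto hlim' (Eventually.of_forall fun m => ?_)) bot_le
  have hδ : 0 ≤ h / ((m : ℝ) + 1) := by positivity
  have hT' : ((M * (m + 1) : ℕ) : ℝ) * (h / ((m : ℝ) + 1)) = T := by
    rw [hh]; push_cast; field_simp
  have hsub : StepSets ε (h / ((m : ℝ) + 1)) N (M * (m + 1)) ⊆ Alive ε T N := by
    intro z hz
    have := (transports_stepSets hε hδ _).mem_life z hz
    rwa [hT'] at this
  refine (measure_mono (sdiff_subset_sdiff_right hsub)).trans
    ((measure_not_stepSets hε hδ R _).trans (le_of_eq ?_))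
  rw [Nat.cast_mul, mul_assoc]

theorem energy_of_mem_life (hε : 0 < ε) {T : ℝ} (hT : 0 < T) {z : State N} (h : T ∈ life ε z) :
    energy (orbit ε z T) = energy z := by
  obtain ⟨n, hn⟩ := mem_stepSets_of_mem_life hε hT h
  have := energy_of_mem_stepSets hε (by positivity) hn
  rwa [show ((n + 1 : ℕ) : ℝ) * (T / ((n : ℝ) + 1)) = T by push_cast; field_simp] at this

theorem image_alive (hε : 0 < ε) (T : ℝ) :
    (fun z => orbit ε z T) '' Alive ε T N = Alive ε (-T) N := by
  ext z
  constructor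
  · rintro ⟨y, hy, rfl⟩
    exact (neg_mem_life hε hy).1
  · intro hz
    have h := neg_mem_life hε hz
    rw [neg_neg] at h
    exact ⟨_, h.1, h.2⟩

theorem measurableSet_alive (hε : 0 < ε) {T : ℝ} (hT : T ≠ 0) : MeasurableSet (Alive ε T N) := by
  rcases lt_or_gt_of_ne hT with h | h
  · rw [← neg_neg T, ← image_alive hε]
    have := transports_alive (N := N) hε (neg_pos.2 h)
    exact this.measurableSet_image hε this.measurableSet Subset.rfl
  · exact (transports_alive hε h).measurableSet

/-- The image of the alive part of the energy ball under the time-T map stays in the ball, has the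
full finite measure of the ball, and consists of states that live until −T. -/
theorem measure_energyBall_not_alive_neg (hε : 0 < ε) {R T : ℝ} (hR : 0 ≤ R) (hT : 0 < T) :
    phaseMeasure N (EnergyBall ε R N \ Alive ε (-T) N) = 0 := by
  have htr := transports_alive (N := N) hε hT
  have hE := measurableSet_energyBall (N := N) hε R
  set B := EnergyBall ε R N ∩ Alive ε T N
  have hB : MeasurableSet B := hE.inter htr.measurableSet
  set I := (fun z => orbit ε z T) '' B
  have hI : MeasurableSet I := htr.measurableSet_image hε hB inter_subset_right
  have hIE : I ⊆ EnergyBall ε R N := by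
    rintro _ ⟨z, ⟨h1, h2⟩, rfl⟩
    refine ⟨adm_orbit hε h2, ?_⟩
    rw [energy_of_mem_life hε hT h2]
    exact h1.2
  have hIA : I ⊆ Alive ε (-T) N := by
    rw [← image_alive hε]
    exact image_mono inter_subset_right
  have hIm : phaseMeasure N I = phaseMeasure N (EnergyBall ε R N) := by
    rw [htr.measure_image B inter_subset_right hB, ← measure_inter_add_sdiff (EnergyBall ε R N)
      htr.measurableSet, measure_energyBall_not_alive hε hR hT, add_zero]
  refine measure_mono_null (sdiff_subset_sdiff_right hIA) ?_
  have hfin := measure_energyBall_lt_top (N := N) (ε := ε) hR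
  rw [measure_sdiff hIE hI.nullMeasurableSet (hIm ▸ hfin.ne), hIm, tsub_self]

theorem measure_not_alive (hε : 0 < ε) {T : ℝ} (hT : T ≠ 0) :
    phaseMeasure N ({z | Adm ε z} \ Alive ε T N) = 0 := by
  have hsub : {z | Adm ε z} \ Alive ε T N ⊆ ⋃ R : ℕ, EnergyBall ε R N \ Alive ε T N := by
    intro z hz
    obtain ⟨R, hR⟩ := exists_nat_ge (energy z)
    refine mem_iUnion.2 ⟨R + 1, ⟨hz.1, ?_⟩, hz.2⟩
    push_cast
    nlinarith
  refine measure_mono_null hsub (measure_iUnion_null fun R => ?_)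
  rcases lt_or_gt_of_ne hT with h | h
  · rw [← neg_neg T]
    exact measure_energyBall_not_alive_neg hε R.cast_nonneg (neg_pos.2 h)
  · exact measure_energyBall_not_alive hε R.cast_nonneg h

/-- The states whose trajectory is defined for all times. -/
def Global (ε : ℝ) (N : ℕ) : Set (State N) := {z | life ε z = univ}

theorem global_eq : Global ε N =
    (⋂ n : ℕ, Alive ε ((n : ℝ) + 1) N) ∩ ⋂ n : ℕ, Alive ε (-((n : ℝ) + 1)) N := by
  ext z
  simp only [Global, mem_ofPred_eq, mem_inter_iff, mem_iInter, Alive]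
  constructor
  · intro h
    simp [h]
  · rintro ⟨h1, h2⟩
    refine eq_univ_of_forall fun t => ?_
    obtain ⟨n, hn⟩ := exists_nat_ge |t|
    have := abs_le.1 hn
    exact (ordConnected_life z).out (h2 n) (h1 n) ⟨by linarith, by linarith⟩

theorem measurableSet_global (hε : 0 < ε) : MeasurableSet (Global ε N) := by
  rw [global_eq]
  exact (MeasurableSet.iInter fun n => measurableSet_alive hε (by positivity)).inter
    (MeasurableSet.iInter fun n => measurableSet_alive hε (neg_ne_zero.2 (by positivity)))

theorem measure_not_global (hε : 0 < ε) : phaseMeasure N ({z | Adm ε z} \ Global ε N) = 0 := by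
  rw [global_eq, sdiff_inter, sdiff_iInter, sdiff_iInter]
  exact measure_union_null (measure_iUnion_null fun n => measure_not_alive hε (by positivity))
    (measure_iUnion_null fun n => measure_not_alive hε (neg_ne_zero.2 (by positivity)))

/-- Particles in the phase space are strictly more than ε apart, so away from the walls a datum has
no shock and is admissible. It then fails to be global only on a null set. -/
theorem measure_badSet (hε : 0 < ε) : phaseMeasure N (badSet ε N) = 0 := by
  refine measure_mono_null ?_ (measure_union_null (measure_wall (N := N) (ε := ε))
    (measure_not_global (N := N) hε))
  intro z hz
  by_cases hw : ∃ i, IsShock ε z (.reflection i)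
  · exact Or.inl hw
  refine Or.inr ⟨adm_of_forall_not_isShock ?_ ?_, fun hg => not_mem_badSet hε hg hz⟩
  · exact ⟨hz.1.1, fun i j hij u hu => (hz.1.2.1 i j hij u hu).le, hz.1.2.2⟩
  · rintro (⟨i, j, u⟩ | i) hs
    · exact absurd hs.2.2 (hz.1.2.1 i j hs.1.ne u hs.2.1).ne'
    · exact hw ⟨i, hs⟩

/-! ### Preservation of the measure -/

/-- For t < 0 the image equals the preimage under the time −t map, which is already known to
preserve the measure. -/
theorem measure_image_orbit (hε : 0 < ε) (t : ℝ) {B : Set (State N)} (hB : MeasurableSet B)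
    (hG : B ⊆ Global ε N) : MeasurableSet ((fun z => orbit ε z t) '' B) ∧
      phaseMeasure N ((fun z => orbit ε z t) '' B) = phaseMeasure N B := by
  have hlife : ∀ z ∈ B, ∀ s, s ∈ life ε z := fun z hz s => by
    have : life ε z = univ := hG hz
    rw [this]; trivial
  rcases lt_trichotomy t 0 with ht | rfl | ht
  · have htr := transports_alive (N := N) hε (neg_pos.2 ht)
    have himg : (fun z => orbit ε z t) '' B = {z | z ∈ Alive ε (-t) N ∧ orbit ε z (-t) ∈ B} := by
      ext z
      constructor
      · rintro ⟨y, hy, rfl⟩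
        obtain ⟨h1, h2⟩ := neg_mem_life hε (hlife y hy t)
        exact ⟨h1, by rwa [h2]⟩
      · rintro ⟨h1, h2⟩
        have := (neg_mem_life hε h1).2
        rw [neg_neg] at this
        exact ⟨_, h2, this⟩
    have hm := htr.measurableSet_preimage B hB
    rw [himg]
    refine ⟨hm, ?_⟩
    rw [← htr.measure_image _ (fun z hz => hz.1) hm]
    congr 1
    ext z
    constructor
    · rintro ⟨y, hy, rfl⟩
      exact hy.2
    · intro hz
      obtain ⟨h1, h2⟩ := neg_mem_life hε (hlife z hz t)
      exact ⟨orbit ε z t, ⟨h1, by rwa [h2]⟩, h2⟩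
  · simpa using hB
  · have htr := transports_alive (N := N) hε ht
    have hsub : B ⊆ Alive ε t N := fun z hz => hlife z hz t
    exact ⟨htr.measurableSet_image hε hB hsub, htr.measure_image B hsub hB⟩

end

end HardSphere

end

theorem mainTheorem3 (N : ℕ) (ε : ℝ) (hε : 0 < ε) :
    HardSphere.phaseMeasure N (HardSphere.badSet ε N) = 0 ∧
    (∀ z ∈ HardSphere.phaseSpace ε N \ HardSphere.badSet ε N,
      ∃! γ : ℝ → HardSphere.State N, HardSphere.IsTrajectoryOn ε Set.univ γ ∧ γ 0 = z) ∧
    ∀ (t : ℝ) (A : Set (HardSphere.State N)), A ⊆ HardSphere.phaseSpace ε N → MeasurableSet A →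
      MeasurableSet (HardSphere.flow ε t '' (A \ HardSphere.badSet ε N)) ∧
      HardSphere.phaseMeasure N (HardSphere.flow ε t '' (A \ HardSphere.badSet ε N)) =
        HardSphere.phaseMeasure N A := by
  refine ⟨HardSphere.measure_badSet hε, fun z hz => HardSphere.existsUnique_of_life_eq_univ hε
    (HardSphere.life_eq_univ hε hz), fun t A hA hAm => ?_⟩
  -- The bad set is defined through the existence of trajectories; its complement within `A` becomes
  -- measurable through the set of global states.
  have hB : A \ HardSphere.badSet ε N = A ∩ HardSphere.Global ε N :=
    Set.ext fun z => ⟨fun h => ⟨h.1, HardSphere.life_eq_univ hε ⟨hA h.1, h.2⟩⟩,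
      fun h => ⟨h.1, HardSphere.not_mem_badSet hε h.2⟩⟩
  have himg : HardSphere.flow ε t '' (A \ HardSphere.badSet ε N) =
      (fun z => HardSphere.orbit ε z t) '' (A \ HardSphere.badSet ε N) :=
    Set.image_congr fun z hz =>
      HardSphere.flow_eq_orbit hε (HardSphere.life_eq_univ hε ⟨hA hz.1, hz.2⟩) t
  have hm : MeasurableSet (A \ HardSphere.badSet ε N) := by
    rw [hB]
    exact hAm.inter (HardSphere.measurableSet_global hε)
  have key := HardSphere.measure_image_orbit hε t hm (hB.le.trans Set.inter_subset_right)
  rw [himg]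
  refine ⟨key.1, key.2.trans ?_⟩
  exact MeasureTheory.measure_sdiff_null (HardSphere.measure_badSet hε)
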